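/- A plane graph is a finite simple graph with at least one vertex, embedded in the sphere. Let $G$ be a plane graph and $k\ge 3$. For $k,r\ge 3$ let $\Gamma_{k,r}$ be the Cartesian product of a path with $k$ vertices and a cycle with $r$ vertices; its first and its last $r$-cycle are called its base and its roof. A *$k$-th cylindrical enhancement* $G^{(k)}$ of $G$ is a graph obtained as follows. (1) For every face $f$ of $G$ and every connected component $C$ of the boundary of $f$, let $\sigma_C$ be the number of edges of $C$, bridges counted twice (i.e. the length of the closed walk around $C$ along $f$), with $\sigma_C=1$ if $C$ is a single vertex. Draw a copy $\Gamma_C$ of $\Gamma_{k,k\sigma_C}$ in $f$ around $C$, separating $C$ from the other components of the boundary of $f$, with its base towards $C$. Split the base cyclically into $\sigma_C$ paths of $k$ consecutive vertices, one for each visit of a vertex of $C$ by the walk around $C$ and in the order of that walk, and join each vertex $v$ of $C$ to all $k$ base vertices of each of the paths that belong to visits of $v$. (For a single vertex $C=\{v\}$ this joins $v$ to all $k$ base vertices.) (2) For every face $f$ of $G$ whose boundary has $\rho\ge 2$ connected components $C_1,\dots,C_\rho$, add inside $f$, outside all the annuli $\Gamma_{C_j}$, a further copy of $\Gamma_{k,k\rho}$.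 Split its roof into $\rho$ paths $I_1,\dots,I_\rho$ of $k$ consecutive vertices, choose $k$ consecutive vertices $J_j$ of the roof of each $\Gamma_{C_j}$, and join $J_j$ to $I_j$ by $k$ pairwise disjoint edges in the way that keeps the drawing plane. The sets $J_j$ and the cyclic order in which the components $C_j$ are attached to the annulus in the middle of a face may be chosen arbitrarily. Let $\mathbf{bw}$ denote branchwidth: the minimum, over all branch decompositions (trees whose internal vertices have degree three, with a bijection from the leaves to the edges of the graph), of the largest size of a middle set; it is $0$ for a graph without edges. **Lemma.** There is an absolute constant $c_2$ such that for every plane graph $G$, every $k\ge 3$ and every $k$-th cylindrical enhancement $G^{(k)}$ of $G$, the graph $G^{(k)}$ is $3$-connected and $$\mathbf{bw}(G^{(k)})\le c_2\cdot k\cdot\max\{1,\mathbf{bw}(G)\}.$$ In particular $\mathbf{bw}(G^{(k)})\le c_2\cdot k\cdot\mathbf{bw}(G)$ whenever $\mathbf{bw}(G)\ge 1$, that is, whenever two edges of $G$ share an end vertex. -/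

import Mathlib

/-!  Plane graphs (as combinatorial embeddings in the sphere), their cylindrical enhancements,
3-connectivity and branchwidth. -/

namespace Cyl

/-! ### Connectivity and branchwidth -/

/-- A graph is `3`-connected if it has more than three vertices and stays connected after the
removal of any set of fewer than three vertices. -/
def ThreeConnected {W : Type*} (H : SimpleGraph W) : Prop :=
  3 < Nat.card W ∧ ∀ S : Set W, S.Finite → S.ncard < 3 → (H.induce Sᶜ).Connected

/-- A branch decomposition of `H`: a finite tree whose vertices are leaves or have degree three,
with a bijection from its leaves to the edges of `H`.  (The vertex of the one-vertex tree
counts as a leaf, so that a graph with a single edge has a branch decomposition.) -/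
structure BranchDecomposition {W : Type*} (H : SimpleGraph W) where
  /-- number of nodes of the tree -/
  size : ℕ
  /-- the tree -/
  tree : SimpleGraph (Fin size)
  isTree : tree.IsTree
  leaf_or_cubic : ∀ a, (tree.neighborSet a).ncard ≤ 1 ∨ (tree.neighborSet a).ncard = 3
  /-- the bijection from the leaves to the edges -/
  edgeAt : {a : Fin size // (tree.neighborSet a).ncard ≤ 1} ≃ H.edgeSet

namespace BranchDecomposition

variable {W : Type*} {H : SimpleGraph W} (D : BranchDecomposition H)

/-- For adjacent tree nodes `a`, `b`: the end vertices of the edges of `H` that sit at leaves of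
the component containing `a` of the tree minus its edge `ab`. -/
def sideVertices (a b : Fin D.size) : Set W :=
  {v | ∃ l, (D.tree.deleteEdges {s(a, b)}).Reachable a l.1 ∧ v ∈ (D.edgeAt l : Sym2 W)}

/-- The middle set of the tree edge `ab`. -/
def mid (a b : Fin D.size) : Set W :=
  D.sideVertices a b ∩ D.sideVertices b a

/-- The width of `D` is at most `w`. -/
def WidthLE (w : ℕ) : Prop :=
  ∀ a b, D.tree.Adj a b → (D.mid a b).ncard ≤ w

end BranchDecomposition

/-- The branchwidth: the minimum width of a branch decomposition (`0` for an edgeless graph). -/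
noncomputable def branchwidth {W : Type*} (H : SimpleGraph W) : ℕ :=
  sInf {w | ∃ D : BranchDecomposition H, D.WidthLE w}

/-! ### Plane graphs -/

/-- A rotation system of a simple graph: for every vertex a cyclic order of the darts (oriented
edges) that leave it. -/
structure RotationSystem {V : Type*} (G : SimpleGraph V) where
  /-- the next dart around the same vertex -/
  rot : Equiv.Perm G.Dart
  rot_fst : ∀ d, (rot d).fst = d.fst
  rot_sameCycle : ∀ d d' : G.Dart, d.fst = d'.fst → rot.SameCycle d d'

/-- The corners of an embedded graph: the dart `d` stands for the corner at `d.fst` between `d`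
and its predecessor in the rotation; an isolated vertex has one corner. -/
abbrev Corner {V : Type*} (G : SimpleGraph V) : Type _ :=
  G.Dart ⊕ {v : V // G.IsIsolated v}

/-- The vertex at which a corner lies. -/
def Corner.vertex {V : Type*} {G : SimpleGraph V} : Corner G → V
  | Sum.inl d => d.fst
  | Sum.inr v => v.1

namespace RotationSystem

variable {V : Type*} {G : SimpleGraph V} (R : RotationSystem G)

/-- The next corner along the boundary: a facial walk that leaves a vertex along `d` goes on with
the successor of `d.symm` around the other end of `d`.  The boundary walk of an isolated
vertex is constant. -/
def nextCorner : Equiv.Perm (Corner G) :=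
  Equiv.sumCongr
    ((Function.Involutive.toPerm SimpleGraph.Dart.symm SimpleGraph.Dart.symm_involutive).trans
      R.rot)
    (Equiv.refl _)

/-- Cyclic boundary walks.  Each is the walk around one connected component of the boundary of
a face; a bridge is traversed twice, and a vertex `v` is visited once for every
component that is left of this boundary component when `v` is removed (an isolated vertex
is visited once). -/
def Boundary : Type _ := Quotient (Equiv.Perm.SameCycle.setoid R.nextCorner)

/-- The boundary walk through a given corner. -/
def boundary (c : Corner G) : R.Boundary :=
  Quotient.mk (Equiv.Perm.SameCycle.setoid R.nextCorner) c

lemma component_next (c : Corner G) :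
    G.connectedComponentMk (R.nextCorner c).vertex = G.connectedComponentMk c.vertex := by
  rcases c with d | v
  · have h : (R.nextCorner (Sum.inl d)).vertex = d.snd := by
      simp [nextCorner, Corner.vertex, R.rot_fst, Function.Involutive.toPerm]
    rw [h]
    exact SimpleGraph.ConnectedComponent.sound d.adj.symm.reachable
  · rfl

lemma component_sameCycle {c c' : Corner G} (h : R.nextCorner.SameCycle c c') :
    G.connectedComponentMk c.vertex = G.connectedComponentMk c'.vertex := by
  obtain ⟨i, rfl⟩ := h
  induction i with
  | zero => simp
  | succ n ih =>
    rw [ih, add_comm, zpow_add, zpow_one, Equiv.Perm.mul_apply, R.component_next]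
  | pred n ih =>
    rw [ih, ← R.component_next ((R.nextCorner ^ (-(n : ℤ) - 1)) c), ← Equiv.Perm.mul_apply]
    congr 3
    rw [← zpow_one_add]
    congr 1
    ring

/-- The connected component of the graph to which a boundary walk belongs. -/
def component : R.Boundary → G.ConnectedComponent :=
  Quotient.lift (fun c : Corner G => G.connectedComponentMk c.vertex)
    (fun _ _ h => R.component_sameCycle h)

end RotationSystem

/-- An embedding of a finite simple graph in the sphere, up to homeomorphism.  Every
connected component comes with a rotation system of genus `0` (Euler's formula).  The boundary
walks are grouped into faces of the whole graph; walks in one class are the walks around the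
connected components of the boundary of one face.  The components are placed in each other's
faces without identifying further regions: the bipartite incidence graph between the connected
components of `G` and the faces of `G` is a tree, and a component meets the boundary of a
face in at most one boundary walk. -/
structure PlaneEmbedding {V : Type*} (G : SimpleGraph V) extends RotationSystem G where
  euler : ∀ K : G.ConnectedComponent,
    K.supp.ncard + {b : toRotationSystem.Boundary | toRotationSystem.component b = K}.ncard
      = {e ∈ G.edgeSet | ∀ v ∈ e, v ∈ K.supp}.ncard + 2
  /-- two boundary walks are equivalent if they bound the same face -/
  faceSetoid : Setoid toRotationSystem.Boundary
  boundary_unique : ∀ b b', toRotationSystem.component b = toRotationSystem.component b' →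
    faceSetoid.r b b' → b = b'
  incidence_isTree : (SimpleGraph.fromRel
    (fun x y : G.ConnectedComponent ⊕ Quotient faceSetoid =>
      ∃ b, x = Sum.inl (toRotationSystem.component b) ∧
        y = Sum.inr (Quotient.mk faceSetoid b))).IsTree

namespace PlaneEmbedding

variable {V : Type*} {G : SimpleGraph V} (P : PlaneEmbedding G)

/-- The faces of a plane graph. -/
def Face : Type _ := Quotient P.faceSetoid

/-- The face that a boundary walk bounds. -/
def face (b : P.Boundary) : P.Face := Quotient.mk P.faceSetoid b

/-- The boundary components of the non-trivial faces, that is, of the faces whose boundary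
has more than one connected component. -/
def NontrivialBoundary : Type _ := {b : P.Boundary // ∃ b', b' ≠ b ∧ P.face b' = P.face b}

end PlaneEmbedding

/-! ### Cylindrical enhancements -/

/-- Replace each point of the cycles of a permutation by `k` consecutive points: the successor
of `(a, t)` is `(a, t + 1)`, and that of `(a, k - 1)` is `(π a, 0)`.  A cycle of length `r`
becomes one of length `k * r`. -/
def colNext {α : Type*} (π : α → α) {k : ℕ} : α × Fin k → α × Fin k := fun p =>
  if h : p.2.val + 1 < k then (p.1, ⟨p.2.val + 1, h⟩)
  else (π p.1, ⟨0, p.2.pos⟩)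

/-- The choices in the construction of a `k`-th cylindrical enhancement. -/
structure EnhancementChoice {V : Type*} {G : SimpleGraph V} (P : PlaneEmbedding G) (k : ℕ) where
  /-- a cyclic order of the boundary components of each face, in which they are
  attached to the annulus in the middle of the face (if the face is non-trivial) -/
  order : Equiv.Perm P.Boundary
  order_face : ∀ b, P.face (order b) = P.face b
  order_sameCycle : ∀ b b', P.face b = P.face b' → order.SameCycle b b'
  /-- the first of the `k` consecutive roof vertices of the annulus around a boundary component
  that are joined to the annulus in the middle of the face -/
  start : P.Boundary → Corner G × Fin k
  start_boundary : ∀ b, P.boundary (start b).1 = b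

/-- The vertices of a `k`-th cylindrical enhancement. -/
inductive EnhVertex {V : Type*} {G : SimpleGraph V} (P : PlaneEmbedding G) (k : ℕ)
  /-- a vertex of `G` -/
  | old (v : V)
  /-- a vertex of the annulus around the boundary component `C` containing a given corner: the
  corners of `C`, with `k` columns for each, form a cycle of length `k` times the length of
  the boundary walk; `h` is the layer, from the base `0` to the roof `k - 1` -/
  | ring (p : Corner G × Fin k) (h : Fin k)
  /-- a vertex of the annulus in the middle of a non-trivial face, with `k` columns for each
  boundary component of the face; `h` is the layer, from the base `0` to the roof `k - 1` -/
  | hub (b : P.NontrivialBoundary) (t : Fin k) (h : Fin k)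

/-- The edges of a `k`-th cylindrical enhancement (each in one of its two directions). -/
inductive EnhRel {V : Type*} {G : SimpleGraph V} {P : PlaneEmbedding G} {k : ℕ}
    (X : EnhancementChoice P k) : EnhVertex P k → EnhVertex P k → Prop
  /-- the edges of `G` -/
  | old (u v : V) : G.Adj u v → EnhRel X (.old u) (.old v)
  /-- the cycles of the annuli around the boundary components -/
  | ringCycle (p : Corner G × Fin k) (h : Fin k) :
      EnhRel X (.ring p h) (.ring (colNext P.nextCorner p) h)
  /-- the paths of the annuli around the boundary components -/
  | ringPath (p : Corner G × Fin k) (h h' : Fin k) : h.val + 1 = h'.val →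
      EnhRel X (.ring p h) (.ring p h')
  /-- the edges from a vertex of `G` to the `k` consecutive base vertices at one of its corners -/
  | spoke (p : Corner G × Fin k) (h : Fin k) : h.val = 0 →
      EnhRel X (.old p.1.vertex) (.ring p h)
  /-- the cycles of the annuli in the middle of non-trivial faces -/
  | hubCycle (b b' : P.NontrivialBoundary) (t t' : Fin k) (h : Fin k) :
      colNext X.order (b.1, t) = (b'.1, t') → EnhRel X (.hub b t h) (.hub b' t' h)
  /-- the paths of the annuli in the middle of non-trivial faces -/
  | hubPath (b : P.NontrivialBoundary) (t : Fin k) (h h' : Fin k) : h.val + 1 = h'.val →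
      EnhRel X (.hub b t h) (.hub b t h')
  /-- the `k` edges from the annulus around a boundary component of a non-trivial face
  to the annulus in the middle of the face, roof to roof, in the planar order -/
  | link (b : P.NontrivialBoundary) (t : Fin k) (h : Fin k) : h.val + 1 = k →
      EnhRel X (.ring ((colNext P.nextCorner)^[t.val] (X.start b.1)) h) (.hub b t h)

/-- The `k`-th cylindrical enhancement of a plane graph, for given choices. -/
def enhancement {V : Type*} {G : SimpleGraph V} {P : PlaneEmbedding G} {k : ℕ}
    (X : EnhancementChoice P k) : SimpleGraph (EnhVertex P k) :=
  SimpleGraph.fromRel (EnhRel X)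

end Cyl

/-!
An enhancement `G⁽ᵏ⁾` replaces every corner of the plane graph `G` by a strip of `k` columns, so a
set of edges of `G⁽ᵏ⁾` that consists of whole strips has few vertices in common with the remaining
edges as soon as its outline on the sphere crosses few places where two strips meet.  A branch
decomposition of `G` does not control this outline by itself: a middle set counts only the vertices
on the outline, while the outline may pass through a vertex many times and may have many
components.  The proof rearranges an optimal branch decomposition such that the outlines are short.

*Carvings.*  Branch decompositions are handled as rooted binary trees of subsets (`Carved`).  A
branch decomposition of width `w` is the same as a carving of the edge set in which every set has
at most `w` vertices in common with its complement (`carved_branchwidth`,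
`branchwidth_le_of_carved`).

*Short outlines.*  The outline of a set `X` of edges is its cut in the medial graph, whose regions
are the vertices and the boundary walks.  `SphereMap` records what the argument needs of the sphere:
cuts of the medial graph are exactly the sets of medial edges that are even at every region.  From
this follows Euler's formula for a connected set `X` (`SphereMap.Conn.width_le`): the size of the
cut is at most the number of regions on it plus the number of components of the complement.  Each
region of the second colour is met at least twice, so if all but one of the components of the
complement are cut off by at least four medial edges, the cut has at most four times as many edges
as it meets vertices, up to an additive constant (`SphereMap.Conn.width_le_of_unique`).
`SphereMap.carved_width` brings this about.  A maximal proper part that is cut off by two medial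
edges (a lobe) is carved by induction and attached to one of its neighbours, and the sets of the
given carving, restricted to what lies in no lobe, are divided into connected components
(`good_of_carved`).  The result is a carving in which every set has a cut of size at most `8w + 8`.

*Disconnected graphs.*  To have one connected medial graph (`sphereMap`), a point is placed on every
boundary walk, joined to the walk by two parallel adjacencies, and the points of the walks around one
face are joined in a cycle.  This adds regions that are not vertices of `G` and are not counted by a
middle set; at such a region two medial edges already form a cut, which is why they do not
interfere.  That every closed curve is a cut is a dimension count over the field with two
elements (`exact_of_card`), based on Euler's formula for the components of `G` and on the incidence
tree of components and faces.

*Back to the enhancement.*  Each edge of `G⁽ᵏ⁾` belongs to an element of the sphere map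
(`columnOf`), and each medial edge carries a seam of at most `2k + 1` vertices, which contain all
vertices common to the edges of both sides (`ncard_edgeBoundary_elements_le`).  Inside an element the
columns are added one by one.  This bounds the branchwidth by `48 * k * max 1 (bw G)`.

*Connectivity.*  If fewer than three vertices are removed, each annulus remains connected
(`cylinder_iff`), and so do neighbouring annuli around a vertex, even if the vertex itself is removed
(`ring_iff_turn`), and the annuli of one face (`ring_iff_hub`).  As the incidence graph of components
and faces is connected, all of the graph hangs together (`iff_of_notMem`).
-/

namespace Cyl

/-! ### Carved sets -/

/-- A set is carved by `g` if it can be cut up into its elements by repeated binary splits such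
that every set that occurs on the way satisfies `g`.  This is a rooted binary tree whose leaves
are the elements of the set, with `g` true for the set of leaves below every node. -/
inductive Carved {α : Type*} (g : Set α → Prop) : Set α → Prop
  | single (a : α) : g {a} → Carved g {a}
  | union (A B : Set α) : Disjoint A B → Carved g A → Carved g B → g (A ∪ B) →
      Carved g (A ∪ B)

/-- The empty set has no binary tree; this is the variant of `Carved` that admits it. -/
def CarvedOrEmpty {α : Type*} (g : Set α → Prop) (S : Set α) : Prop :=
  S = ∅ ∨ Carved g S

namespace Carved

variable {α : Type*} {g : Set α → Prop} {S : Set α}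

lemma good (h : Carved g S) : g S := by
  cases h <;> assumption

lemma nonempty (h : Carved g S) : S.Nonempty := by
  induction h with
  | single a _ => exact ⟨a, rfl⟩
  | union A B _ _ _ _ hA _ => exact hA.mono Set.subset_union_left

lemma good_singleton (h : Carved g S) {a : α} (ha : a ∈ S) : g {a} := by
  induction h with
  | single b h => rwa [Set.mem_singleton_iff.1 ha]
  | union A B _ _ _ _ hA hB => exact ha.elim hA hB

end Carved

namespace CarvedOrEmpty

variable {α β : Type*} {g : Set α → Prop} {S : Set α}

lemma carved (h : CarvedOrEmpty g S) (hS : S.Nonempty) : Carved g S :=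
  h.resolve_left hS.ne_empty

lemma union {A B : Set α} (hd : Disjoint A B) (hA : CarvedOrEmpty g A)
    (hB : CarvedOrEmpty g B) (h : g (A ∪ B)) : CarvedOrEmpty g (A ∪ B) := by
  rcases hA with rfl | hA
  · simpa using hB
  rcases hB with rfl | hB
  · right; simpa using hA
  · exact .inr (.union A B hd hA hB h)

/-- Add the elements of a finite set one by one. -/
lemma union_finite {X : Set α} (hX : X.Finite) (hd : Disjoint S X) (hS : CarvedOrEmpty g S)
    (hsingle : ∀ x ∈ X, g {x}) (h : ∀ Y ⊆ X, g (S ∪ Y)) : CarvedOrEmpty g (S ∪ X) := by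
  induction X, hX using Set.Finite.induction_on with
  | empty => simpa using hS
  | @insert a X ha hX ih =>
    have hd' : Disjoint S X := hd.mono_right (Set.subset_insert _ _)
    have h1 := ih hd' (fun x hx => hsingle x (Set.mem_insert_of_mem _ hx))
      (fun Y hY => h Y (hY.trans (Set.subset_insert _ _)))
    have h2 : S ∪ insert a X = (S ∪ X) ∪ {a} := by
      rw [Set.union_assoc, Set.union_singleton]
    have h3 := h _ subset_rfl
    rw [h2] at h3 ⊢
    refine union ?_ h1 (.inr (.single a (hsingle a (Set.mem_insert _ _)))) h3
    rw [Set.disjoint_singleton_right]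
    rintro (h | h)
    · exact Set.disjoint_left.1 hd h (Set.mem_insert _ _)
    · exact ha h

lemma of_forall_subset (hS : S.Finite) (h : ∀ T ⊆ S, g T) : CarvedOrEmpty g S := by
  have := union_finite (g := g) (S := ∅) hS (by simp) (.inl rfl)
    (fun x hx => h _ (by simpa using hx)) (fun Y hY => by simpa using h Y hY)
  simpa using this

/-- Refine a carving by carvings of the blocks that replace the elements. -/
lemma biUnion {g : Set α → Prop} {g' : Set β → Prop} {T : α → Set β}
    (hd : Pairwise fun a b => Disjoint (T a) (T b)) (hT : ∀ a, CarvedOrEmpty g' (T a))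
    (hg : ∀ X, g X → g' (⋃ a ∈ X, T a)) {S : Set α} (h : Carved g S) :
    CarvedOrEmpty g' (⋃ a ∈ S, T a) := by
  induction h with
  | single a _ => simpa using hT a
  | union A B hAB _ _ h hA hB =>
    have := hg _ h
    rw [Set.biUnion_union] at this ⊢
    refine union ?_ hA hB this
    simp only [Set.disjoint_iUnion_left, Set.disjoint_iUnion_right]
    intro a ha b hb
    exact hd (by rintro rfl; exact Set.disjoint_left.1 hAB hb ha)

/-- Assemble a sequence of blocks in order. -/
lemma prefixes {T : ℕ → Set α} (hd : Pairwise fun a b => Disjoint (T a) (T b)) {n : ℕ}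
    (hT : ∀ i < n, CarvedOrEmpty g (T i)) (hg : ∀ j ≤ n, g (⋃ i < j, T i)) :
    CarvedOrEmpty g (⋃ i < n, T i) := by
  induction n with
  | zero => left; simp
  | succ n ih =>
    have h := hg (n + 1) le_rfl
    have h2 : (⋃ i < n + 1, T i) = (⋃ i < n, T i) ∪ T n := Set.biUnion_lt_succ T n
    rw [h2] at h ⊢
    refine union ?_ (ih (fun i hi => hT i (by omega)) fun j hj => hg j (by omega))
      (hT n (by omega)) h
    simp only [Set.disjoint_iUnion_left]
    intro i hi
    exact hd (by omega)

end CarvedOrEmpty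

/-! ### Branch decompositions as carvings of the edge set -/

/-- The vertices that lie both on an edge in `A` and on an edge outside of `A`. -/
def edgeBoundary {W : Type*} {H : SimpleGraph W} (A : Set H.edgeSet) : Set W :=
  {v | (∃ e ∈ A, v ∈ (e : Sym2 W)) ∧ ∃ e ∉ A, v ∈ (e : Sym2 W)}

lemma edgeBoundary_union_subset {W : Type*} {H : SimpleGraph W} (A B : Set H.edgeSet) :
    edgeBoundary (A ∪ B) ⊆ edgeBoundary A ∪ edgeBoundary B := by
  rintro v ⟨⟨e, he | he, hv⟩, e', he', hv'⟩
  · exact .inl ⟨⟨e, he, hv⟩, e', fun h => he' (.inl h), hv'⟩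
  · exact .inr ⟨⟨e, he, hv⟩, e', fun h => he' (.inr h), hv'⟩

lemma mem_of_reachable {N : Type*} {T : SimpleGraph N} {U : Set N}
    (hU : ∀ x ∈ U, ∀ y, T.Adj x y → y ∈ U) {a b : N} (h : T.Reachable a b) (ha : a ∈ U) :
    b ∈ U := by
  rw [SimpleGraph.reachable_iff_reflTransGen] at h
  induction h with
  | refl => exact ha
  | tail _ h ih => exact hU _ ih _ h

section Tree

variable {N : Type*} {T : SimpleGraph N}

/-- The side of `a` of the tree minus its edge `ab`. -/
def treeSide (T : SimpleGraph N) (a b : N) : Set N :=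
  {x | (T.deleteEdges {s(a, b)}).Reachable a x}

lemma self_mem_treeSide (a b : N) : a ∈ treeSide T a b := SimpleGraph.Reachable.refl _

lemma treeSide_step {a b x y : N} (hx : x ∈ treeSide T a b) (h : T.Adj x y)
    (hne : s(x, y) ≠ s(a, b)) : y ∈ treeSide T a b :=
  SimpleGraph.Reachable.trans hx (SimpleGraph.Adj.reachable (by simpa [h] using hne))

lemma treeSide_subset_of_closed {a b : N} {U : Set N} (ha : a ∈ U)
    (hU : ∀ x ∈ U, ∀ y, T.Adj x y → s(x, y) ≠ s(a, b) → y ∈ U) : treeSide T a b ⊆ U := by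
  intro x hx
  refine mem_of_reachable (fun x hx y h => ?_) hx ha
  rw [SimpleGraph.deleteEdges_adj] at h
  exact hU x hx y h.1 h.2

lemma notMem_treeSide (hT : T.IsAcyclic) {a b : N} (h : T.Adj a b) : b ∉ treeSide T a b :=
  SimpleGraph.isBridge_iff.1 (SimpleGraph.isAcyclic_iff_forall_adj_isBridge.1 hT h)

lemma disjoint_treeSide (hT : T.IsAcyclic) {a b : N} (h : T.Adj a b) :
    Disjoint (treeSide T a b) (treeSide T b a) := by
  rw [Set.disjoint_left]
  intro x hx hx'
  refine notMem_treeSide hT h (SimpleGraph.Reachable.trans hx ?_)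
  rw [treeSide, Sym2.eq_swap] at hx'
  exact SimpleGraph.Reachable.symm hx'

lemma treeSide_union (hT : T.Connected) (a b : N) :
    treeSide T a b ∪ treeSide T b a = Set.univ := by
  refine Set.eq_univ_of_forall fun x => ?_
  refine mem_of_reachable ?_ (hT.preconnected a x) (.inl (self_mem_treeSide a b))
  rintro x hx y hxy
  by_cases hne : s(x, y) = s(a, b)
  · rcases Sym2.eq_iff.1 hne with ⟨rfl, rfl⟩ | ⟨rfl, rfl⟩
    · exact .inr (self_mem_treeSide _ _)
    · exact .inl (self_mem_treeSide _ _)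
  · rcases hx with hx | hx
    · exact .inl (treeSide_step hx hxy hne)
    · exact .inr (treeSide_step hx hxy (by rwa [Sym2.eq_swap (a := b)]))

lemma treeSide_subset_insert (a b : N) :
    treeSide T a b ⊆ {a} ∪ ⋃ c ∈ {c | T.Adj a c ∧ c ≠ b}, treeSide T c a := by
  refine treeSide_subset_of_closed (.inl rfl) ?_
  rintro x (rfl | hx) y hxy hne
  · right
    simp only [Set.mem_iUnion]
    exact ⟨y, ⟨hxy, by rintro rfl; exact hne rfl⟩, self_mem_treeSide _ _⟩
  · simp only [Set.mem_iUnion] at hx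
    obtain ⟨c, hc, hx⟩ := hx
    by_cases h : s(x, y) = s(c, a)
    · rcases Sym2.eq_iff.1 h with ⟨rfl, rfl⟩ | ⟨rfl, rfl⟩
      · exact .inl rfl
      · right
        simp only [Set.mem_iUnion]
        exact ⟨_, hc, self_mem_treeSide _ _⟩
    · right
      simp only [Set.mem_iUnion]
      exact ⟨c, hc, treeSide_step hx hxy h⟩

lemma treeSide_subset (hT : T.IsAcyclic) {a b c : N} (hc : T.Adj a c) (hcb : c ≠ b) :
    treeSide T c a ⊆ treeSide T a b := by
  have key : treeSide T c a ⊆ treeSide T c a ∩ treeSide T a b := by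
    refine treeSide_subset_of_closed ⟨self_mem_treeSide _ _, treeSide_step
      (self_mem_treeSide a b) hc (by simpa [hcb] using fun _ => hc.ne')⟩ ?_
    rintro x ⟨hx, hx'⟩ y hxy hne
    have hy := treeSide_step hx hxy hne
    refine ⟨hy, treeSide_step hx' hxy ?_⟩
    intro h
    have ha := notMem_treeSide hT hc.symm
    rcases Sym2.eq_iff.1 h with ⟨rfl, rfl⟩ | ⟨rfl, rfl⟩
    · exact ha hx
    · exact ha hy
  exact fun x hx => (key hx).2

end Tree

namespace BranchDecomposition

variable {W : Type*} {H : SimpleGraph W} (D : BranchDecomposition H)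

/-- The edges at the leaves on the side of `a` of the tree edge `ab`. -/
def sideEdges (a b : Fin D.size) : Set H.edgeSet :=
  D.edgeAt '' {l | l.1 ∈ treeSide D.tree a b}

lemma edgeBoundary_sideEdges_subset (a b : Fin D.size) :
    edgeBoundary (D.sideEdges a b) ⊆ D.mid a b := by
  rintro v ⟨⟨e, ⟨l, hl, rfl⟩, hv⟩, e', he', hv'⟩
  refine ⟨⟨l, hl, hv⟩, D.edgeAt.symm e', ?_, by simpa using hv'⟩
  have := Set.mem_univ (D.edgeAt.symm e').1
  rw [← treeSide_union D.isTree.1 a b] at this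
  exact this.resolve_left fun h => he' ⟨_, h, by simp⟩

lemma sideEdges_disjoint {a b c d : Fin D.size}
    (h : Disjoint (treeSide D.tree a b) (treeSide D.tree c d)) :
    Disjoint (D.sideEdges a b) (D.sideEdges c d) := by
  rw [Set.disjoint_left]
  rintro _ ⟨l, hl, rfl⟩ ⟨l', hl', h'⟩
  rw [D.edgeAt.injective h'] at hl'
  exact Set.disjoint_left.1 h hl hl'

/-- A tree edge cuts off a rooted binary tree: a leaf, or the two rooted trees behind the other two
edges at its end. -/
lemma carved_sideEdges [Finite W] {w : ℕ} (hD : D.WidthLE w) :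
    ∀ n a b, D.tree.Adj a b → (treeSide D.tree a b).ncard ≤ n →
      Carved (fun A => (edgeBoundary A).ncard ≤ w) (D.sideEdges a b) := by
  have hac := D.isTree.2
  intro n
  induction n with
  | zero =>
    intro a b _ h
    rw [Nat.le_zero, Set.ncard_eq_zero] at h
    exact absurd (self_mem_treeSide a b) (h ▸ Set.notMem_empty a)
  | succ n ih =>
    intro a b hab hn
    have hgood : (edgeBoundary (D.sideEdges a b)).ncard ≤ w :=
      (Set.ncard_le_ncard (D.edgeBoundary_sideEdges_subset a b)).trans (hD a b hab)
    have hb : b ∈ D.tree.neighborSet a := hab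
    have hsub : ∀ c, D.tree.Adj a c → c ≠ b → (treeSide D.tree c a).ncard ≤ n := by
      intro c hc hcb
      have : treeSide D.tree c a ⊂ treeSide D.tree a b := by
        refine (treeSide_subset hac hc hcb).ssubset_of_mem_notMem (self_mem_treeSide a b) ?_
        exact notMem_treeSide hac hc.symm
      have := Set.ncard_lt_ncard this
      omega
    rcases D.leaf_or_cubic a with h1 | h3
    · have hs : treeSide D.tree a b = {a} := by
        refine Set.Subset.antisymm ?_ (by simpa using self_mem_treeSide a b)
        refine (treeSide_subset_insert a b).trans (Set.union_subset subset_rfl ?_)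
        refine Set.iUnion₂_subset fun c hc => ?_
        exact absurd ((Set.ncard_le_one (Set.toFinite _)).1 h1 c hc.1 b hb) hc.2
      have : D.sideEdges a b = {D.edgeAt ⟨a, h1⟩} := by
        have : {l : {a : Fin D.size // (D.tree.neighborSet a).ncard ≤ 1} |
            l.1 ∈ treeSide D.tree a b} = {⟨a, h1⟩} := by
          ext l; rw [hs]; simp [Subtype.ext_iff]
        rw [sideEdges, this, Set.image_singleton]
      rw [this] at hgood ⊢
      exact .single _ hgood
    · have h2 : (D.tree.neighborSet a \ {b}).ncard = 2 := by
        rw [Set.ncard_sdiff_singleton_of_mem hb, h3]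
      obtain ⟨c, d, hcd, h2⟩ := Set.ncard_eq_two.1 h2
      have hc : c ∈ D.tree.neighborSet a \ {b} := h2 ▸ .inl rfl
      have hd : d ∈ D.tree.neighborSet a \ {b} := h2 ▸ .inr rfl
      have hdisj : Disjoint (treeSide D.tree c a) (treeSide D.tree d a) :=
        (disjoint_treeSide hac hc.1.symm).mono_right (treeSide_subset hac hd.1 hcd.symm)
      have heq : D.sideEdges a b = D.sideEdges c a ∪ D.sideEdges d a := by
        rw [sideEdges, sideEdges, sideEdges, ← Set.image_union]
        congr 1
        ext l
        constructor
        · intro hl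
          rcases treeSide_subset_insert a b hl with h | h
          · have := l.2
            rw [show l.1 = a from h, h3] at this
            omega
          · simp only [Set.mem_iUnion] at h
            obtain ⟨x, hx, h⟩ := h
            have : x ∈ D.tree.neighborSet a \ {b} := hx
            rw [h2] at this
            rcases this with rfl | rfl
            · exact .inl h
            · exact .inr h
        · rintro (h | h)
          · exact treeSide_subset hac hc.1 hc.2 h
          · exact treeSide_subset hac hd.1 hd.2 h
      rw [heq] at hgood ⊢
      exact .union _ _ (D.sideEdges_disjoint hdisj) (ih c a hc.1.symm (hsub c hc.1 hc.2))
        (ih d a hd.1.symm (hsub d hd.1 hd.2)) hgood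

/-- Any edge of the tree serves as the root of the carving. -/
lemma carved_univ [Finite W] {w : ℕ} (hD : D.WidthLE w) :
    Carved (fun A : Set H.edgeSet => (edgeBoundary A).ncard ≤ w) Set.univ := by
  have hempty : (edgeBoundary (Set.univ : Set H.edgeSet)).ncard ≤ w := by
    simp [edgeBoundary]
  have hne : Nonempty (Fin D.size) := D.isTree.1.nonempty
  obtain ⟨a⟩ := hne
  by_cases h : ∃ b, D.tree.Adj a b
  · obtain ⟨b, hab⟩ := h
    have hu : D.sideEdges a b ∪ D.sideEdges b a = Set.univ := by
      rw [sideEdges, sideEdges, ← Set.image_union]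
      have : {l : {a : Fin D.size // (D.tree.neighborSet a).ncard ≤ 1} |
            l.1 ∈ treeSide D.tree a b} ∪ {l | l.1 ∈ treeSide D.tree b a} = Set.univ := by
        ext l
        have := Set.mem_univ l.1
        rw [← treeSide_union D.isTree.1 a b] at this
        simpa using this
      rw [this, Set.image_univ, D.edgeAt.range_eq_univ]
    rw [← hu] at hempty ⊢
    exact .union _ _ (D.sideEdges_disjoint (disjoint_treeSide D.isTree.2 hab))
      (D.carved_sideEdges hD _ a b hab le_rfl) (D.carved_sideEdges hD _ b a hab.symm le_rfl)
      hempty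
  · have hall : ∀ x, x = a := by
      intro x
      have : x ∈ ({a} : Set _) := mem_of_reachable (T := D.tree) (fun y hy z hz => by
        rw [Set.mem_singleton_iff] at hy; subst hy; exact absurd ⟨z, hz⟩ h)
        (D.isTree.1.preconnected a x) rfl
      exact this
    have ha : (D.tree.neighborSet a).ncard ≤ 1 :=
      Set.ncard_le_one_iff_subsingleton.2 fun x _ y _ => (hall x).trans (hall y).symm
    have : (Set.univ : Set H.edgeSet) = {D.edgeAt ⟨a, ha⟩} := by
      refine Set.Subset.antisymm (fun e _ => ?_) (Set.subset_univ _)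
      obtain ⟨l, rfl⟩ := D.edgeAt.surjective e
      rw [Set.mem_singleton_iff]
      congr 1
      exact Subtype.ext (hall _)
    rw [this] at hempty ⊢
    exact .single _ hempty

end BranchDecomposition

/-! ### From carvings to branch decompositions -/

open Classical in
/-- A tree with a root `r` whose leaves are labelled by the elements of `A` and that becomes cubic
once a further edge is attached to the root.  For every tree edge, `g` holds for the set of
labels on the side that does not contain the root. -/
structure RootedTree {α : Type*} (g : Set α → Prop) (A : Set α) where
  /-- the nodes -/
  N : Type
  finite : Finite N
  /-- the tree -/
  T : SimpleGraph N
  /-- the root -/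
  r : N
  conn : T.Connected
  /-- the leaf of an element -/
  leaf : A → N
  leaf_injective : Function.Injective leaf
  degree : ∀ x, (T.neighborSet x).ncard + (if x = r then 1 else 0)
    = if x ∈ Set.range leaf then 1 else 3
  side : ∀ a b, T.Adj a b → ∃ U : Set N, r ∉ U ∧ (a ∈ U ↔ b ∉ U) ∧
    (∀ x ∈ U, ∀ y ∉ U, T.Adj x y → s(x, y) = s(a, b)) ∧ g {e | ∃ h : e ∈ A, leaf ⟨e, h⟩ ∈ U}

/-- Two disjoint graphs joined by an edge. -/
def edgeJoin {M N : Type*} (S : SimpleGraph M) (T : SimpleGraph N) (r : M) (r' : N) :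
    SimpleGraph (M ⊕ N) where
  Adj x y := match x, y with
    | .inl x, .inl y => S.Adj x y
    | .inr x, .inr y => T.Adj x y
    | .inl x, .inr y => x = r ∧ y = r'
    | .inr x, .inl y => y = r ∧ x = r'
  symm := ⟨by rintro (x | x) (y | y) h <;> first | exact h.symm | exact h⟩
  loopless := ⟨by rintro (x | x) <;> exact SimpleGraph.irrefl _⟩

section EdgeJoin

variable {M N : Type*} {S : SimpleGraph M} {T : SimpleGraph N} {r : M} {r' : N}

@[simp] lemma edgeJoin_inl_inl (x y : M) : (edgeJoin S T r r').Adj (.inl x) (.inl y) ↔ S.Adj x y :=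
  Iff.rfl
@[simp] lemma edgeJoin_inr_inr (x y : N) : (edgeJoin S T r r').Adj (.inr x) (.inr y) ↔ T.Adj x y :=
  Iff.rfl
@[simp] lemma edgeJoin_inl_inr (x : M) (y : N) :
    (edgeJoin S T r r').Adj (.inl x) (.inr y) ↔ x = r ∧ y = r' := Iff.rfl
@[simp] lemma edgeJoin_inr_inl (x : N) (y : M) :
    (edgeJoin S T r r').Adj (.inr x) (.inl y) ↔ y = r ∧ x = r' := Iff.rfl

lemma edgeJoin_connected (hS : S.Connected) (hT : T.Connected) :
    (edgeJoin S T r r').Connected := by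
  have hl : ∀ x, (edgeJoin S T r r').Reachable (.inl r) (.inl x) := fun x =>
    (hS.preconnected r x).map ⟨Sum.inl, by intro a b h; exact h⟩
  have hr : ∀ x, (edgeJoin S T r r').Reachable (.inr r') (.inr x) := fun x =>
    (hT.preconnected r' x).map ⟨Sum.inr, by intro a b h; exact h⟩
  have hm : (edgeJoin S T r r').Reachable (.inl r) (.inr r') :=
    SimpleGraph.Adj.reachable (by simp)
  have hall : ∀ x, (edgeJoin S T r r').Reachable (.inl r) x := by
    rintro (x | x)
    · exact hl x
    · exact hm.trans (hr x)
  have := hS.nonempty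
  exact ⟨fun x y => (hall x).symm.trans (hall y)⟩

lemma edgeJoin_ncard_inl [Finite M] [Finite N] (x : M) [Decidable (x = r)] :
    ((edgeJoin S T r r').neighborSet (.inl x)).ncard
      = (S.neighborSet x).ncard + if x = r then 1 else 0 := by
  have h : (edgeJoin S T r r').neighborSet (.inl x)
      = Sum.inl '' S.neighborSet x ∪ (if x = r then {Sum.inr r'} else ∅) := by
    ext (y | y) <;> by_cases hx : x = r <;> simp [hx, SimpleGraph.mem_neighborSet]
  rw [h, Set.ncard_union_eq ?_ (Set.toFinite _) (Set.toFinite _),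
    Set.ncard_image_of_injective _ Sum.inl_injective]
  · split_ifs <;> simp
  · split_ifs <;> simp

lemma edgeJoin_ncard_inr [Finite M] [Finite N] (x : N) [Decidable (x = r')] :
    ((edgeJoin S T r r').neighborSet (.inr x)).ncard
      = (T.neighborSet x).ncard + if x = r' then 1 else 0 := by
  have h : (edgeJoin S T r r').neighborSet (.inr x)
      = Sum.inr '' T.neighborSet x ∪ (if x = r' then {Sum.inl r} else ∅) := by
    ext (y | y) <;> by_cases hx : x = r' <;> simp [hx, SimpleGraph.mem_neighborSet]
  rw [h, Set.ncard_union_eq ?_ (Set.toFinite _) (Set.toFinite _),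
    Set.ncard_image_of_injective _ Sum.inr_injective]
  · split_ifs <;> simp
  · split_ifs <;> simp

/-- If every edge of `S` and every edge of `T` separates the graph, with `r` resp. `r'` on one
side, then so does every edge of the join. -/
lemma edgeJoin_side {a b : M ⊕ N} (hab : (edgeJoin S T r r').Adj a b)
    {P : Set (M ⊕ N) → Prop}
    (hS : ∀ a b, S.Adj a b → ∃ U : Set M, r ∉ U ∧ (a ∈ U ↔ b ∉ U) ∧
      (∀ x ∈ U, ∀ y ∉ U, S.Adj x y → s(x, y) = s(a, b)) ∧ P (Sum.inl '' U))
    (hT : ∀ a b, T.Adj a b → ∃ U : Set N, r' ∉ U ∧ (a ∈ U ↔ b ∉ U) ∧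
      (∀ x ∈ U, ∀ y ∉ U, T.Adj x y → s(x, y) = s(a, b)) ∧ P (Sum.inr '' U))
    (hP : P (Set.range Sum.inr)) :
    ∃ U : Set (M ⊕ N), Sum.inl r ∉ U ∧ (a ∈ U ↔ b ∉ U) ∧
      (∀ x ∈ U, ∀ y ∉ U, (edgeJoin S T r r').Adj x y → s(x, y) = s(a, b)) ∧ P U := by
  rcases a with a | a <;> rcases b with b | b
  · obtain ⟨U, h1, h2, h3, h4⟩ := hS a b hab
    refine ⟨_, by simpa using h1, by simpa using h2, ?_, h4⟩
    rintro _ ⟨x, hx, rfl⟩ (y | y) hy h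
    · have := h3 x hx y (by simpa using hy) h
      simpa using congrArg (Sym2.map (Sum.inl (β := N))) this
    · exact absurd (h.1 ▸ hx) h1
  · refine ⟨_, by simp, by simp, ?_, hP⟩
    rintro _ ⟨x, rfl⟩ (y | y) hy h
    · rw [h.1, h.2, hab.1, hab.2, Sym2.eq_swap]
    · simp at hy
  · refine ⟨_, by simp, by simp, ?_, hP⟩
    rintro _ ⟨x, rfl⟩ (y | y) hy h
    · rw [h.1, h.2, hab.1, hab.2]
    · simp at hy
  · obtain ⟨U, h1, h2, h3, h4⟩ := hT a b hab
    refine ⟨_, by simp, by simpa using h2, ?_, h4⟩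
    rintro _ ⟨x, hx, rfl⟩ (y | y) hy h
    · exact absurd (h.2 ▸ hx) h1
    · have := h3 x hx y (by simpa using hy) h
      simpa using congrArg (Sym2.map (Sum.inr (α := M))) this

end EdgeJoin

namespace RootedTree

variable {α : Type*} {g : Set α → Prop}

open Classical in
/-- Two rooted trees are merged by a new root that is joined to both roots. -/
lemma nonempty_of_carved {S : Set α} (h : Carved g S) : Nonempty (RootedTree g S) := by
  induction h with
  | single a h =>
    exact ⟨{
      N := Unit
      finite := inferInstance
      T := ⊥
      r := ()
      conn := ⟨fun _ _ => SimpleGraph.Reachable.refl _⟩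
      leaf := fun _ => ()
      leaf_injective := fun x y _ => Subtype.ext (x.2.trans y.2.symm)
      degree := by simp [SimpleGraph.neighborSet]
      side := fun _ _ h => h.elim }⟩
  | union A B hd hA hB h ihA ihB =>
    obtain ⟨t⟩ := ihA
    obtain ⟨t'⟩ := ihB
    have := t.finite
    have := t'.finite
    have hB' : ∀ e ∈ B, e ∉ A := fun e he he' => Set.disjoint_left.1 hd he' he
    let lf : ↥(A ∪ B) → (Unit ⊕ t.N) ⊕ t'.N := fun e =>
      if h : e.1 ∈ A then .inl (.inr (t.leaf ⟨e.1, h⟩))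
      else .inr (t'.leaf ⟨e.1, e.2.resolve_left h⟩)
    have lfA : ∀ e (h : e ∈ A), lf ⟨e, .inl h⟩ = .inl (.inr (t.leaf ⟨e, h⟩)) := by
      intro e h; simp [lf, h]
    have lfB : ∀ e (h : e ∈ B), lf ⟨e, .inr h⟩ = .inr (t'.leaf ⟨e, h⟩) := by
      intro e h; simp [lf, hB' e h]
    have hbot : (⊥ : SimpleGraph Unit).Connected := ⟨fun _ _ => SimpleGraph.Reachable.refl _⟩
    refine ⟨{
      N := (Unit ⊕ t.N) ⊕ t'.N
      finite := inferInstance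
      T := edgeJoin (edgeJoin ⊥ t.T () t.r) t'.T (.inl ()) t'.r
      r := .inl (.inl ())
      conn := edgeJoin_connected (edgeJoin_connected hbot t.conn) t'.conn
      leaf := lf
      leaf_injective := ?_
      degree := ?_
      side := ?_ }⟩
    · rintro ⟨x, hx | hx⟩ ⟨y, hy | hy⟩ hxy
      · rw [lfA x hx, lfA y hy] at hxy
        have := t.leaf_injective (by simpa using hxy)
        exact Subtype.ext (by simpa using this)
      · rw [lfA x hx, lfB y hy] at hxy
        cases hxy
      · rw [lfB x hx, lfA y hy] at hxy
        cases hxy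
      · rw [lfB x hx, lfB y hy] at hxy
        have := t'.leaf_injective (by simpa using hxy)
        exact Subtype.ext (by simpa using this)
    · have r1 : ∀ x, .inl (.inr x) ∈ Set.range lf ↔ x ∈ Set.range t.leaf := by
        intro x
        constructor
        · rintro ⟨⟨y, hy | hy⟩, h⟩
          · rw [lfA y hy] at h
            exact ⟨⟨y, hy⟩, by simpa using h⟩
          · rw [lfB y hy] at h
            cases h
        · rintro ⟨y, rfl⟩
          exact ⟨_, lfA y.1 y.2⟩
      have r2 : ∀ x, .inr x ∈ Set.range lf ↔ x ∈ Set.range t'.leaf := by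
        intro x
        constructor
        · rintro ⟨⟨y, hy | hy⟩, h⟩
          · rw [lfA y hy] at h
            cases h
          · rw [lfB y hy] at h
            exact ⟨⟨y, hy⟩, by simpa using h⟩
        · rintro ⟨y, rfl⟩
          exact ⟨_, lfB y.1 y.2⟩
      have r3 : .inl (.inl ()) ∉ Set.range lf := by
        rintro ⟨⟨y, hy | hy⟩, h⟩
        · rw [lfA y hy] at h
          cases h
        · rw [lfB y hy] at h
          cases h
      rintro ((⟨⟩ | x) | x)
      · rw [edgeJoin_ncard_inl, edgeJoin_ncard_inl]
        simp [r3, SimpleGraph.neighborSet]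
      · rw [edgeJoin_ncard_inl, edgeJoin_ncard_inr]
        simpa [r1] using t.degree x
      · rw [edgeJoin_ncard_inr]
        simpa [r2] using t'.degree x
    · intro a b hab
      have gA : ∀ V : Set t.N, {e | ∃ h : e ∈ A ∪ B, lf ⟨e, h⟩ ∈ Sum.inl '' (Sum.inr '' V)}
          = {e | ∃ h : e ∈ A, t.leaf ⟨e, h⟩ ∈ V} := by
        intro V
        ext e
        constructor
        · rintro ⟨h | h, h'⟩
          · rw [lfA e h] at h'
            exact ⟨h, by simpa using h'⟩
          · rw [lfB e h] at h'
            simp at h'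
        · rintro ⟨h, h'⟩
          exact ⟨.inl h, by rw [lfA e h]; simpa using h'⟩
      have gB : ∀ V : Set t'.N, {e | ∃ h : e ∈ A ∪ B, lf ⟨e, h⟩ ∈ Sum.inr '' V}
          = {e | ∃ h : e ∈ B, t'.leaf ⟨e, h⟩ ∈ V} := by
        intro V
        ext e
        constructor
        · rintro ⟨h | h, h'⟩
          · rw [lfA e h] at h'
            simp at h'
          · rw [lfB e h] at h'
            exact ⟨h, by simpa using h'⟩
        · rintro ⟨h, h'⟩
          exact ⟨.inr h, by rw [lfB e h]; simpa using h'⟩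
      refine edgeJoin_side (P := fun U => g {e | ∃ h : e ∈ A ∪ B, lf ⟨e, h⟩ ∈ U}) hab ?_ ?_ ?_
      · intro a b hab
        refine edgeJoin_side
          (P := fun U => g {e | ∃ h : e ∈ A ∪ B, lf ⟨e, h⟩ ∈ Sum.inl '' U}) hab ?_ ?_ ?_
        · intro a b hab
          exact hab.elim
        · intro a b hab
          obtain ⟨U, h1, h2, h3, h4⟩ := t.side a b hab
          exact ⟨U, h1, h2, h3, by rwa [gA]⟩
        · rw [← Set.image_univ, gA]
          simpa using hA.good
      · intro a b hab
        obtain ⟨U, h1, h2, h3, h4⟩ := t'.side a b hab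
        exact ⟨U, h1, h2, h3, by rwa [gB]⟩
      · rw [← Set.image_univ, gB]
        simpa using hB.good

end RootedTree

/-- A connected graph is a tree if every edge is the only one between the two parts of some
partition of the nodes. -/
lemma isTree_of_side {N : Type*} {T : SimpleGraph N} (hc : T.Connected)
    (h : ∀ a b, T.Adj a b → ∃ U : Set N, (a ∈ U ↔ b ∉ U) ∧
      ∀ x ∈ U, ∀ y ∉ U, T.Adj x y → s(x, y) = s(a, b)) : T.IsTree := by
  refine ⟨hc, SimpleGraph.isAcyclic_iff_forall_adj_isBridge.2 fun a b hab => ?_⟩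
  obtain ⟨U, h1, h2⟩ := h a b hab
  have key : ∀ x ∈ U, ∀ y, (T.deleteEdges {s(a, b)}).Adj x y → y ∈ U := by
    intro x hx y hxy
    rw [SimpleGraph.deleteEdges_adj] at hxy
    by_contra hy
    exact hxy.2 (h2 x hx y hy hxy.1)
  rw [SimpleGraph.isBridge_iff]
  intro hr
  by_cases ha : a ∈ U
  · exact h1.1 ha (mem_of_reachable key hr ha)
  · exact ha (mem_of_reachable key hr.symm (by tauto))

section Converse

variable {W : Type*} {H : SimpleGraph W} {w : ℕ}

/-- A tree on any finite node type with the structure of a branch decomposition gives one on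
`Fin n`. -/
lemma exists_branchDecomposition {N : Type} [Finite N] [Finite W] (T : SimpleGraph N)
    (hc : T.Connected) (leaf : H.edgeSet → N) (hl : Function.Injective leaf)
    (hd : ∀ x, ((T.neighborSet x).ncard ≤ 1 ∧ x ∈ Set.range leaf) ∨
      ((T.neighborSet x).ncard = 3 ∧ x ∉ Set.range leaf))
    (hs : ∀ a b, T.Adj a b → ∃ U : Set N, (a ∈ U ↔ b ∉ U) ∧
      (∀ x ∈ U, ∀ y ∉ U, T.Adj x y → s(x, y) = s(a, b)) ∧
      (edgeBoundary (leaf ⁻¹' U)).ncard ≤ w) :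
    ∃ D : BranchDecomposition H, D.WidthLE w := by
  classical
  obtain ⟨n, ⟨φ⟩⟩ := Finite.exists_equiv_fin N
  let T' := T.comap φ.symm
  have hiso : T' ≃g T := ⟨φ.symm, Iff.rfl⟩
  have hn : ∀ a, (T'.neighborSet a).ncard = (T.neighborSet (φ.symm a)).ncard := by
    intro a
    rw [← Set.ncard_image_of_injective (T'.neighborSet a) φ.symm.injective]
    congr 1
    ext x
    constructor
    · rintro ⟨y, hy, rfl⟩
      exact hy
    · intro hx
      exact ⟨φ x, by simpa [T', SimpleGraph.mem_neighborSet] using hx, by simp⟩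
  have htree : T.IsTree := isTree_of_side hc fun a b hab => by
    obtain ⟨U, h1, h2, -⟩ := hs a b hab
    exact ⟨U, h1, h2⟩
  have hleaf : ∀ e, (T'.neighborSet (φ (leaf e))).ncard ≤ 1 := by
    intro e
    rw [hn, φ.symm_apply_apply]
    rcases hd (leaf e) with h | h
    · exact h.1
    · exact absurd ⟨e, rfl⟩ h.2
  have hbij : Function.Bijective
      (fun e => (⟨φ (leaf e), hleaf e⟩ : {a : Fin n // (T'.neighborSet a).ncard ≤ 1})) := by
    refine ⟨fun e e' h => hl (φ.injective (by simpa using h)), ?_⟩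
    rintro ⟨a, ha⟩
    rw [hn] at ha
    rcases hd (φ.symm a) with h | h
    · obtain ⟨e, he⟩ := h.2
      exact ⟨e, by simp [he]⟩
    · omega
  let D : BranchDecomposition H :=
    { size := n
      tree := T'
      isTree := hiso.isTree_iff.2 htree
      leaf_or_cubic := fun a => by
        rw [hn]
        exact (hd (φ.symm a)).imp And.left And.left
      edgeAt := (Equiv.ofBijective _ hbij).symm }
  have hval : ∀ l, φ (leaf (D.edgeAt l)) = l.1 := fun l => by
    have := (Equiv.ofBijective _ hbij).apply_symm_apply l
    exact congrArg Subtype.val this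
  refine ⟨D, fun a b hab => ?_⟩
  obtain ⟨U, h1, h2, h3⟩ := hs (φ.symm a) (φ.symm b) hab
  have hU : ∀ x ∈ φ.symm ⁻¹' U, ∀ y, (T'.deleteEdges {s(a, b)}).Adj x y → y ∈ φ.symm ⁻¹' U := by
    intro x hx y hxy
    rw [SimpleGraph.deleteEdges_adj] at hxy
    by_contra hy
    have := congrArg (Sym2.map φ) (h2 _ hx _ hy hxy.1)
    simp only [Sym2.map_mk, Equiv.apply_symm_apply] at this
    exact hxy.2 this
  have hin : ∀ {p q}, s(p, q) = s(a, b) → φ.symm p ∈ U → ∀ v ∈ D.sideVertices p q,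
      ∃ e ∈ leaf ⁻¹' U, v ∈ (e : Sym2 W) := by
    rintro p q hpq hp v ⟨l, hr, hv⟩
    rw [hpq] at hr
    have := mem_of_reachable hU hr hp
    refine ⟨D.edgeAt l, ?_, hv⟩
    rw [Set.mem_preimage] at this ⊢
    rwa [← hval l, φ.symm_apply_apply] at this
  have hout : ∀ {p q}, s(p, q) = s(a, b) → φ.symm p ∉ U → ∀ v ∈ D.sideVertices p q,
      ∃ e ∉ leaf ⁻¹' U, v ∈ (e : Sym2 W) := by
    rintro p q hpq hp v ⟨l, hr, hv⟩
    rw [hpq] at hr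
    refine ⟨D.edgeAt l, fun h => hp ?_, hv⟩
    refine mem_of_reachable hU hr.symm ?_
    rw [Set.mem_preimage] at h ⊢
    rwa [← hval l, φ.symm_apply_apply]
  refine (Set.ncard_le_ncard ?_ (Set.toFinite _)).trans h3
  rintro v ⟨hva, hvb⟩
  by_cases ha : φ.symm a ∈ U
  · exact ⟨hin rfl ha v hva, hout Sym2.eq_swap (h1.1 ha) v hvb⟩
  · exact ⟨hin Sym2.eq_swap (by tauto) v hvb, hout rfl ha v hva⟩

open Classical in
/-- The first split of the carving has no node of its own: the roots of the trees of the two parts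
are joined by an edge, which gives both of them degree one or three. -/
lemma exists_branchDecomposition_of_carved [Finite W]
    (h : Carved (fun A : Set H.edgeSet => (edgeBoundary A).ncard ≤ w) Set.univ) :
    ∃ D : BranchDecomposition H, D.WidthLE w := by
  generalize hS : Set.univ = S at h
  cases h with
  | single a h =>
    refine exists_branchDecomposition (N := Unit) ⊥ ⟨fun _ _ => .refl _⟩ (fun _ => ()) ?_ ?_ ?_
    · intro x y _
      have hx : x ∈ (Set.univ : Set H.edgeSet) := trivial
      have hy : y ∈ (Set.univ : Set H.edgeSet) := trivial
      rw [hS] at hx hy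
      exact hx.trans hy.symm
    · intro x
      exact .inl ⟨by simp [SimpleGraph.neighborSet], a, rfl⟩
    · exact fun _ _ h => h.elim
  | union A B hd hA hB h =>
    obtain ⟨t⟩ := RootedTree.nonempty_of_carved hA
    obtain ⟨t'⟩ := RootedTree.nonempty_of_carved hB
    have := t.finite
    have := t'.finite
    have hB' : ∀ e ∈ B, e ∉ A := fun e he he' => Set.disjoint_left.1 hd he' he
    have hor : ∀ e : H.edgeSet, e ∈ A ∨ e ∈ B := fun e => by
      have : e ∈ (Set.univ : Set H.edgeSet) := trivial
      rwa [hS] at this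
    let lf : H.edgeSet → t.N ⊕ t'.N := fun e =>
      if h : e ∈ A then .inl (t.leaf ⟨e, h⟩) else .inr (t'.leaf ⟨e, (hor e).resolve_left h⟩)
    have lfA : ∀ e (h : e ∈ A), lf e = .inl (t.leaf ⟨e, h⟩) := by
      intro e h; simp [lf, h]
    have lfB : ∀ e (h : e ∈ B), lf e = .inr (t'.leaf ⟨e, h⟩) := by
      intro e h; simp [lf, hB' e h]
    have gA : ∀ V : Set t.N, lf ⁻¹' (Sum.inl '' V) = {e | ∃ h : e ∈ A, t.leaf ⟨e, h⟩ ∈ V} := by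
      intro V
      ext e
      rcases hor e with h | h
      · simp [lfA e h, h]
      · simp [lfB e h, hB' e h]
    have gB : ∀ V : Set t'.N, lf ⁻¹' (Sum.inr '' V) = {e | ∃ h : e ∈ B, t'.leaf ⟨e, h⟩ ∈ V} := by
      intro V
      ext e
      rcases hor e with h | h
      · simp [lfA e h, Set.disjoint_left.1 hd h]
      · simp [lfB e h, h]
    refine exists_branchDecomposition (edgeJoin t.T t'.T t.r t'.r)
      (edgeJoin_connected t.conn t'.conn) lf ?_ ?_ ?_
    · intro x y hxy
      rcases hor x with hx | hx <;> rcases hor y with hy | hy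
      · rw [lfA x hx, lfA y hy] at hxy
        have := t.leaf_injective (by simpa using hxy)
        simpa using this
      · rw [lfA x hx, lfB y hy] at hxy
        cases hxy
      · rw [lfB x hx, lfA y hy] at hxy
        cases hxy
      · rw [lfB x hx, lfB y hy] at hxy
        have := t'.leaf_injective (by simpa using hxy)
        simpa using this
    · rintro (x | x)
      · have r1 : .inl x ∈ Set.range lf ↔ x ∈ Set.range t.leaf := by
          constructor
          · rintro ⟨e, he⟩
            rcases hor e with h | h
            · rw [lfA e h] at he
              exact ⟨_, by simpa using he⟩
            · rw [lfB e h] at he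
              cases he
          · rintro ⟨y, rfl⟩
            exact ⟨_, lfA y.1 y.2⟩
        rw [edgeJoin_ncard_inl, t.degree x, r1]
        by_cases h : x ∈ Set.range t.leaf <;> simp only [h, if_true, if_false] <;> simp
      · have r2 : .inr x ∈ Set.range lf ↔ x ∈ Set.range t'.leaf := by
          constructor
          · rintro ⟨e, he⟩
            rcases hor e with h | h
            · rw [lfA e h] at he
              cases he
            · rw [lfB e h] at he
              exact ⟨_, by simpa using he⟩
          · rintro ⟨y, rfl⟩
            exact ⟨_, lfB y.1 y.2⟩
        rw [edgeJoin_ncard_inr, t'.degree x, r2]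
        by_cases h : x ∈ Set.range t'.leaf <;> simp only [h, if_true, if_false] <;> simp
    · intro a b hab
      obtain ⟨U, -, h2, h3, h4⟩ := edgeJoin_side
        (P := fun U => (edgeBoundary (lf ⁻¹' U)).ncard ≤ w) hab
        (fun a b hab => by
          obtain ⟨U, h1, h2, h3, h4⟩ := t.side a b hab
          exact ⟨U, h1, h2, h3, by rwa [gA]⟩)
        (fun a b hab => by
          obtain ⟨U, h1, h2, h3, h4⟩ := t'.side a b hab
          exact ⟨U, h1, h2, h3, by rwa [gB]⟩)
        (by
          rw [← Set.image_univ, gB]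
          simpa using hB.good)
      exact ⟨U, h2, h3, h4⟩

/-- Carvings of the edge set bound the branchwidth. -/
lemma branchwidth_le_of_carved [Finite W]
    (h : Carved (fun A : Set H.edgeSet => (edgeBoundary A).ncard ≤ w) Set.univ) :
    branchwidth H ≤ w :=
  Nat.sInf_le (exists_branchDecomposition_of_carved h)

/-- A graph with an edge has an optimal branch decomposition: some decomposition exists, as every
finite nonempty set is carved without regard to width, so that the infimum is attained. -/
lemma carved_branchwidth [Finite W] [Nonempty H.edgeSet] :
    Carved (fun A : Set H.edgeSet => (edgeBoundary A).ncard ≤ branchwidth H) Set.univ := by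
  have h : CarvedOrEmpty (fun A : Set H.edgeSet => (edgeBoundary A).ncard ≤ Nat.card W)
      Set.univ :=
    CarvedOrEmpty.of_forall_subset (Set.toFinite _) fun T _ => Set.ncard_le_card _
  have hne : {w | ∃ D : BranchDecomposition H, D.WidthLE w}.Nonempty :=
    ⟨_, exists_branchDecomposition_of_carved (h.carved Set.univ_nonempty)⟩
  obtain ⟨D, hD⟩ := Nat.sInf_mem hne
  exact D.carved_univ hD

end Converse

/-! ### Cuts in sphere maps -/

/-- The combinatorial data of a map on the sphere, from the point of view of its medial graph: the
medial graph has vertex set `Ω` and edge set `C`, an edge `c` has the end vertices `s c` and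
`t c`, and it separates the two regions `u c` and `φ c`, the regions being coloured with two
colours.  Every cut of the medial graph is a closed curve through the regions (`even_u`,
`even_φ`), and, as the surface is a sphere, every closed curve comes from a cut (`exact`). -/
structure SphereMap (Ω C U F : Type*) where
  /-- one end of an edge -/
  s : C → Ω
  /-- the other end of an edge -/
  t : C → Ω
  /-- the region of the first colour at an edge -/
  u : C → U
  /-- the region of the second colour at an edge -/
  φ : C → F
  conn : ∀ X : Set Ω, (∀ c, s c ∈ X ↔ t c ∈ X) → X = ∅ ∨ X = Set.univ
  even_u : ∀ (X : Set Ω) l, Even {c | ¬(s c ∈ X ↔ t c ∈ X) ∧ u c = l}.ncard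
  even_φ : ∀ (X : Set Ω) l, Even {c | ¬(s c ∈ X ↔ t c ∈ X) ∧ φ c = l}.ncard
  exact : ∀ D : Set C, (∀ l, Even {c | c ∈ D ∧ u c = l}.ncard) →
    (∀ l, Even {c | c ∈ D ∧ φ c = l}.ncard) → ∃ X : Set Ω, D = {c | ¬(s c ∈ X ↔ t c ∈ X)}

namespace SphereMap

variable {Ω C U F : Type*} (M : SphereMap Ω C U F)

/-- The edges of the medial graph with exactly one end in `X`. -/
def cut (X : Set Ω) : Set C := {c | ¬(M.s c ∈ X ↔ M.t c ∈ X)}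

/-- The number of edges of the medial graph that leave `X`. -/
noncomputable def width (X : Set Ω) : ℕ := (M.cut X).ncard

/-- The edge `c` joins `A` to `B`. -/
def Joins (c : C) (A B : Set Ω) : Prop := (M.s c ∈ A ∧ M.t c ∈ B) ∨ (M.t c ∈ A ∧ M.s c ∈ B)

/-- Connectedness in the medial graph. -/
def Conn (X : Set Ω) : Prop :=
  ∀ A ⊆ X, A.Nonempty → (X \ A).Nonempty → ∃ c, M.Joins c A (X \ A)

variable {M}

lemma Joins.symm {c : C} {A B : Set Ω} (h : M.Joins c A B) : M.Joins c B A :=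
  h.elim (fun h => .inr h.symm) (fun h => .inl h.symm)

lemma Joins.mono {c : C} {A B A' B' : Set Ω} (h : M.Joins c A B) (hA : A ⊆ A') (hB : B ⊆ B') :
    M.Joins c A' B' :=
  h.imp (And.imp (@hA _) (@hB _)) (And.imp (@hA _) (@hB _))

lemma Joins.mem_cut {c : C} {A B : Set Ω} (h : M.Joins c A B) (hd : Disjoint A B) :
    c ∈ M.cut A := by
  rcases h with ⟨h1, h2⟩ | ⟨h1, h2⟩ <;>
  · have := Set.disjoint_right.1 hd h2
    simp [cut, h1, this]

lemma mem_cut_iff_joins {c : C} {X : Set Ω} : c ∈ M.cut X ↔ M.Joins c X Xᶜ := by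
  simp only [cut, Joins, Set.mem_ofPred_eq, Set.mem_compl_iff]
  tauto

lemma cut_compl (X : Set Ω) : M.cut Xᶜ = M.cut X := by
  ext c
  simp only [cut, Set.mem_ofPred_eq, Set.mem_compl_iff]
  tauto

lemma width_compl (X : Set Ω) : M.width Xᶜ = M.width X := by
  rw [width, cut_compl, width]

lemma cut_nonempty {X : Set Ω} (h : X.Nonempty) (h' : Xᶜ.Nonempty) : (M.cut X).Nonempty := by
  by_contra hc
  rw [Set.not_nonempty_iff_eq_empty] at hc
  rcases M.conn X (fun c => by
    by_contra h
    exact (hc ▸ h : c ∈ (∅ : Set C))) with rfl | rfl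
  · exact Set.not_nonempty_empty h
  · simp at h'

open Classical in
lemma width_eq_sum [Fintype C] (X : Set Ω) :
    M.width X = ∑ c, if c ∈ M.cut X then 1 else 0 := by
  rw [width, Set.ncard_eq_toFinset_card', Finset.sum_boole]
  simp only [Nat.cast_id]
  congr 1
  ext c
  simp

section Finite

variable [Finite C]

lemma even_width (X : Set Ω) : Even (M.width X) := by
  classical
  have := Fintype.ofFinite C
  rw [width, Set.ncard_eq_toFinset_card', Finset.card_eq_sum_card_image M.u]
  refine Finset.even_sum _ fun l _ => ?_
  have h := M.even_u X l
  rw [Set.ncard_eq_toFinset_card'] at h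
  have heq : {c ∈ (M.cut X).toFinset | M.u c = l}
      = {c | ¬(M.s c ∈ X ↔ M.t c ∈ X) ∧ M.u c = l}.toFinset := by
    ext c
    simp only [Finset.mem_filter, Set.mem_toFinset]
    exact Iff.rfl
  rwa [heq]

lemma two_le_width {X : Set Ω} (h : X.Nonempty) (h' : Xᶜ.Nonempty) : 2 ≤ M.width X := by
  have h1 : 0 < M.width X := (Set.ncard_pos).2 (cut_nonempty h h')
  have h2 := M.even_width X
  obtain ⟨r, hr⟩ := h2
  omega

/-- Submodularity of the width. -/
lemma width_union_add_width_inter_le (A B : Set Ω) :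
    M.width (A ∪ B) + M.width (A ∩ B) ≤ M.width A + M.width B := by
  classical
  have := Fintype.ofFinite C
  simp only [width_eq_sum, ← Finset.sum_add_distrib]
  refine Finset.sum_le_sum fun c _ => ?_
  by_cases h1 : M.s c ∈ A <;> by_cases h2 : M.s c ∈ B <;> by_cases h3 : M.t c ∈ A <;>
    by_cases h4 : M.t c ∈ B <;> simp [cut, h1, h2, h3, h4]

lemma width_sdiff_add_width_sdiff_le (A B : Set Ω) :
    M.width (A \ B) + M.width (B \ A) ≤ M.width A + M.width B := by
  have h := M.width_union_add_width_inter_le A Bᶜ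
  rw [width_compl, ← width_compl (A ∪ Bᶜ)] at h
  rw [show (A ∪ Bᶜ)ᶜ = B \ A by ext; simp [and_comm]] at h
  rw [Set.sdiff_eq]
  omega

lemma width_union_add_two_le {A B : Set Ω} (hd : Disjoint A B) {c : C} (hc : M.Joins c A B) :
    M.width (A ∪ B) + 2 ≤ M.width A + M.width B := by
  classical
  have := Fintype.ofFinite C
  have h2 : (2 : ℕ) = ∑ c', if c' = c then 2 else 0 := by simp
  rw [h2]
  simp only [width_eq_sum, ← Finset.sum_add_distrib]
  refine Finset.sum_le_sum fun c' _ => ?_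
  rw [Set.disjoint_left] at hd
  have hs := @hd (M.s c')
  have ht := @hd (M.t c')
  by_cases hcc : c' = c
  · subst hcc
    by_cases h1 : M.s c' ∈ A <;> by_cases h2 : M.s c' ∈ B <;> by_cases h3 : M.t c' ∈ A <;>
      by_cases h4 : M.t c' ∈ B <;> simp_all [cut, Joins]
  · by_cases h1 : M.s c' ∈ A <;> by_cases h2 : M.s c' ∈ B <;> by_cases h3 : M.t c' ∈ A <;>
      by_cases h4 : M.t c' ∈ B <;> simp_all [cut]

lemma width_union_of_not_joins {A B : Set Ω} (hd : Disjoint A B) (hc : ∀ c, ¬ M.Joins c A B) :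
    M.width (A ∪ B) = M.width A + M.width B := by
  classical
  have := Fintype.ofFinite C
  simp only [width_eq_sum, ← Finset.sum_add_distrib]
  refine Finset.sum_congr rfl fun c' _ => ?_
  rw [Set.disjoint_left] at hd
  have hs := @hd (M.s c')
  have ht := @hd (M.t c')
  have hj := hc c'
  by_cases h1 : M.s c' ∈ A <;> by_cases h2 : M.s c' ∈ B <;> by_cases h3 : M.t c' ∈ A <;>
    by_cases h4 : M.t c' ∈ B <;> simp_all [cut, Joins]

/-- A set that is left by at most two edges is connected, since every proper part of the medial
graph is left by at least two. -/
lemma conn_of_width_le_two {K : Set Ω} (h : M.width K ≤ 2) : M.Conn K := by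
  intro A hA hne hne'
  by_contra hc
  push Not at hc
  have h1 := width_union_of_not_joins Set.disjoint_sdiff_right hc
  rw [Set.union_sdiff_cancel hA] at h1
  have h2 := two_le_width (M := M) hne (hne'.mono fun x hx => hx.2)
  have h3 := two_le_width (M := M) hne' (hne.mono fun x hx hx' => hx'.2 hx)
  omega

/-- Two edges that make up a cut lie at the same region of the first colour, by parity. -/
lemma u_eq_of_mem_cut {L : Set Ω} (hL : M.width L ≤ 2) {c c' : C} (hc : c ∈ M.cut L)
    (hc' : c' ∈ M.cut L) : M.u c = M.u c' := by
  by_contra hne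
  have h1 := M.even_u L (M.u c)
  have h2 := M.even_u L (M.u c')
  have p1 : 0 < {d | d ∈ M.cut L ∧ M.u d = M.u c}.ncard := (Set.ncard_pos).2 ⟨c, hc, rfl⟩
  have p2 : 0 < {d | d ∈ M.cut L ∧ M.u d = M.u c'}.ncard := (Set.ncard_pos).2 ⟨c', hc', rfl⟩
  have hd : Disjoint {d | d ∈ M.cut L ∧ M.u d = M.u c} {d | d ∈ M.cut L ∧ M.u d = M.u c'} := by
    rw [Set.disjoint_left]
    rintro d ⟨_, h⟩ ⟨_, h'⟩
    exact hne (h ▸ h')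
  have h3 := Set.ncard_union_eq hd
  have h4 : ({d | d ∈ M.cut L ∧ M.u d = M.u c} ∪ {d | d ∈ M.cut L ∧ M.u d = M.u c'}).ncard
      ≤ (M.cut L).ncard := Set.ncard_le_ncard (by rintro d (h | h) <;> exact h.1)
  change Even {d | d ∈ M.cut L ∧ M.u d = M.u c}.ncard at h1
  change Even {d | d ∈ M.cut L ∧ M.u d = M.u c'}.ncard at h2
  obtain ⟨r1, h1⟩ := h1
  obtain ⟨r2, h2⟩ := h2
  have : (M.cut L).ncard ≤ 2 := hL
  omega

end Finite

/-- A connected set lies on one side of a cut that has no edge inside the set. -/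
lemma Conn.subset_or_disjoint {L Z : Set Ω} (hL : M.Conn L)
    (h : ∀ c ∈ M.cut Z, ¬(M.s c ∈ L ∧ M.t c ∈ L)) : L ⊆ Z ∨ Disjoint L Z := by
  by_contra hcon
  push Not at hcon
  obtain ⟨x, hx, hxZ⟩ := Set.not_subset.1 hcon.1
  obtain ⟨y, hy, hyZ⟩ := Set.not_disjoint_iff.1 hcon.2
  obtain ⟨c, hc⟩ := hL (L ∩ Z) Set.inter_subset_left ⟨y, hy, hyZ⟩ ⟨x, hx, fun h => hxZ h.2⟩
  rcases hc with ⟨h1, h2⟩ | ⟨h1, h2⟩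
  · exact h c (fun h' => h2.2 ⟨h2.1, h'.1 h1.2⟩) ⟨h1.1, h2.1⟩
  · exact h c (fun h' => h2.2 ⟨h2.1, h'.2 h1.2⟩) ⟨h2.1, h1.1⟩

variable (M) in
/-- Adjacency in the medial graph of elements outside of `X`. -/
def OutsideAdj (X : Set Ω) (a b : ↥Xᶜ) : Prop := ∃ c, M.Joins c {a.1} {b.1}

variable (M) in
/-- The components of the complement of `X`. -/
def Outside (X : Set Ω) : Type _ := Quot (M.OutsideAdj X)

/-- The elements of a component of the complement of `X`. -/
def Outside.carrier {X : Set Ω} (q : M.Outside X) : Set Ω :=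
  {x | ∃ h : x ∈ Xᶜ, Quot.mk (M.OutsideAdj X) ⟨x, h⟩ = q}

lemma Outside.carrier_subset {X : Set Ω} (q : M.Outside X) : q.carrier ⊆ Xᶜ := fun _ h => h.1

lemma Outside.carrier_nonempty {X : Set Ω} (q : M.Outside X) : q.carrier.Nonempty := by
  obtain ⟨x, rfl⟩ := Quot.exists_rep q
  exact ⟨x.1, x.2, rfl⟩

lemma Outside.mem_of_joins {X : Set Ω} {q : M.Outside X} {c : C} {x y : Ω} (hx : x ∈ q.carrier)
    (hc : M.Joins c {x} {y}) (hy : y ∉ X) : y ∈ q.carrier := by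
  obtain ⟨hx, rfl⟩ := hx
  exact ⟨hy, (Quot.sound ⟨c, hc⟩).symm⟩

/-- A connected set that meets a component of the complement of `X` but not `X` is contained in
the component. -/
lemma Outside.subset_carrier {X L : Set Ω} (hL : M.Conn L) (hd : Disjoint L X)
    {q : M.Outside X} (h : (L ∩ q.carrier).Nonempty) : L ⊆ q.carrier := by
  refine (hL.subset_or_disjoint ?_).resolve_right (Set.not_disjoint_iff_nonempty_inter.2 h)
  intro c hc hcL
  rcases mem_cut_iff_joins.1 hc with ⟨h1, h2⟩ | ⟨h1, h2⟩
  · exact h2 (Outside.mem_of_joins h1 (.inl ⟨rfl, rfl⟩) (Set.disjoint_left.1 hd hcL.2))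
  · exact h2 (Outside.mem_of_joins h1 (.inr ⟨rfl, rfl⟩) (Set.disjoint_left.1 hd hcL.1))

lemma exists_outside {X : Set Ω} {c : C} (hc : c ∈ M.cut X) :
    ∃ q : M.Outside X, M.Joins c X q.carrier := by
  rcases mem_cut_iff_joins.1 hc with ⟨h1, h2⟩ | ⟨h1, h2⟩
  · exact ⟨Quot.mk _ ⟨_, h2⟩, .inl ⟨h1, h2, rfl⟩⟩
  · exact ⟨Quot.mk _ ⟨_, h2⟩, .inr ⟨h1, h2, rfl⟩⟩

/-- The component of the complement of `X` into which a cut edge leads. -/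
noncomputable def outside {X : Set Ω} (c : M.cut X) : M.Outside X :=
  (exists_outside c.2).choose

lemma joins_outside {X : Set Ω} (c : M.cut X) : M.Joins c X (outside c).carrier :=
  (exists_outside c.2).choose_spec

lemma outside_eq_iff {X : Set Ω} (c : M.cut X) (q : M.Outside X) :
    outside c = q ↔ c.1 ∈ M.cut q.carrier := by
  have h := joins_outside c
  constructor
  · rintro rfl
    exact h.symm.mem_cut (Set.disjoint_left.2 fun x hx => (outside c).carrier_subset hx)
  · intro hq
    have hq' := mem_cut_iff_joins.1 hq
    have hX : ∀ x, x ∈ X → x ∉ q.carrier := fun x hx hx' => hx'.1 hx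
    have key : ∀ x, x ∈ (outside c).carrier → x ∈ q.carrier → outside c = q := by
      rintro x ⟨h1, h2⟩ ⟨h3, h4⟩
      exact h2.symm.trans h4
    rcases h with ⟨h1, h2⟩ | ⟨h1, h2⟩ <;> rcases hq' with ⟨h3, h4⟩ | ⟨h3, h4⟩
    · exact absurd h3 (hX _ h1)
    · exact key _ h2 h3
    · exact key _ h2 h3
    · exact absurd h3 (hX _ h1)

section Euler

variable [Finite C]

lemma width_eq_sum_outside (X : Set Ω) [Fintype (M.Outside X)] :
    M.width X = ∑ q : M.Outside X, M.width q.carrier := by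
  classical
  have := Fintype.ofFinite C
  have h : M.width X = Fintype.card (M.cut X) := by
    rw [width, Set.ncard_eq_toFinset_card', Set.toFinset_card]
  rw [h, ← Finset.card_univ, Finset.card_eq_sum_card_fiberwise (f := outside)
    (t := Finset.univ) (by simp)]
  refine Finset.sum_congr rfl fun q _ => ?_
  rw [width, Set.ncard_eq_toFinset_card', ← Finset.card_map (Function.Embedding.subtype _)]
  congr 1
  ext c
  simp only [Finset.mem_map, Finset.mem_filter, Finset.mem_univ, true_and, outside_eq_iff,
    Function.Embedding.coe_subtype, Subtype.exists, Set.mem_toFinset]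
  constructor
  · rintro ⟨a, ha, h, rfl⟩
    exact h
  · intro hc
    refine ⟨c, ?_, hc, rfl⟩
    rw [mem_cut_iff_joins] at hc ⊢
    have key : ∀ x y, M.Joins c {x} {y} → x ∈ q.carrier → y ∉ q.carrier → y ∈ X := by
      intro x y h hx hy
      by_contra hyX
      exact hy (Outside.mem_of_joins hx h hyX)
    rcases hc with ⟨h1, h2⟩ | ⟨h1, h2⟩
    · exact .inr ⟨key _ _ (.inl ⟨rfl, rfl⟩) h1 h2, q.carrier_subset h1⟩
    · exact .inl ⟨key _ _ (.inr ⟨rfl, rfl⟩) h1 h2, q.carrier_subset h1⟩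

end Euler
end SphereMap

/-! ### Euler's formula for the complement of a connected set -/

namespace SphereMap

variable {Ω C U F : Type*} {M : SphereMap Ω C U F}

/-- A sum over `ZMod 2` counts the ones. -/
lemma sum_zmod_two_eq {ι : Type*} [Fintype ι] (y : ι → ZMod 2) (p : ι → Prop) [DecidablePred p] :
    ∑ i, (if p i then y i else 0) = (({i | y i = 1 ∧ p i}.ncard : ℕ) : ZMod 2) := by
  classical
  rw [Set.ncard_eq_toFinset_card', Finset.card_eq_sum_ones, Nat.cast_sum, Set.toFinset_ofPred,
    Finset.sum_filter]
  refine Finset.sum_congr rfl fun i _ => ?_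
  have : y i = 0 ∨ y i = 1 := by generalize y i = z; revert z; decide
  rcases this with h | h <;> by_cases hp : p i <;> simp [h, hp]

section Euler

variable [Finite Ω] [Finite C]

/-- Euler's formula for the closed curves that bound a connected set `X`: the even subsets of the
cut of `X` are the cuts of the unions of components of the complement of `X`. -/
lemma Conn.width_le {X : Set Ω} (hX : M.Conn X) :
    M.width X ≤ (M.u '' M.cut X).ncard + (M.φ '' M.cut X).ncard + Nat.card (M.Outside X) := by
  classical
  have := Fintype.ofFinite (M.cut X)
  have : Finite (M.Outside X) := inferInstanceAs (Finite (Quot _))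
  have := Fintype.ofFinite (M.Outside X)
  have := Fintype.ofFinite (M.u '' M.cut X)
  have := Fintype.ofFinite (M.φ '' M.cut X)
  let δu : (M.cut X → ZMod 2) →ₗ[ZMod 2] (M.u '' M.cut X → ZMod 2) :=
    { toFun := fun y l => ∑ c, if M.u c.1 = l then y c else 0
      map_add' := fun y z => by
        ext l; simp only [Pi.add_apply, ← Finset.sum_add_distrib]
        exact Finset.sum_congr rfl fun c _ => by split_ifs <;> simp
      map_smul' := fun a z => by
        ext l; simp [Finset.mul_sum] }
  let δφ : (M.cut X → ZMod 2) →ₗ[ZMod 2] (M.φ '' M.cut X → ZMod 2) :=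
    { toFun := fun y l => ∑ c, if M.φ c.1 = l then y c else 0
      map_add' := fun y z => by
        ext l; simp only [Pi.add_apply, ← Finset.sum_add_distrib]
        exact Finset.sum_congr rfl fun c _ => by split_ifs <;> simp
      map_smul' := fun a z => by
        ext l; simp [Finset.mul_sum] }
  -- a subset of the cut lies in the kernel of `δ` if it is even at every region
  let δ := δu.prod δφ
  let Ψ : (M.Outside X → ZMod 2) →ₗ[ZMod 2] (M.cut X → ZMod 2) :=
    LinearMap.funLeft (ZMod 2) (ZMod 2) outside
  have hker : LinearMap.ker δ ≤ LinearMap.range Ψ := by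
    intro y hy
    have hy' : δu y = 0 ∧ δφ y = 0 := by
      simpa [δ, LinearMap.ker_prod] using hy
    let D : Set C := {c | ∃ h : c ∈ M.cut X, y ⟨c, h⟩ = 1}
    have himg : ∀ p : C → Prop,
        {c | c ∈ D ∧ p c} = Subtype.val '' {c : M.cut X | y c = 1 ∧ p c.1} := by
      intro p
      ext c
      simp only [D, Set.mem_ofPred_eq, Set.mem_image, Subtype.exists, exists_and_right,
        exists_eq_right]
    have hDu : ∀ l, Even {c | c ∈ D ∧ M.u c = l}.ncard := by
      intro l
      by_cases hl : l ∈ M.u '' M.cut X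
      · have h1 : ∑ c : M.cut X, (if M.u c.1 = l then y c else 0) = 0 := congrFun hy'.1 ⟨l, hl⟩
        rw [sum_zmod_two_eq, ZMod.natCast_eq_zero_iff_even] at h1
        rwa [himg (fun c => _ = l), Set.ncard_image_of_injective _ Subtype.val_injective]
      · have : {c | c ∈ D ∧ M.u c = l} = ∅ := by
          ext c
          simp only [Set.mem_ofPred_eq, Set.mem_empty_iff_false, iff_false]
          rintro ⟨⟨h, _⟩, rfl⟩
          exact hl ⟨c, h, rfl⟩
        simp [this]
    have hDφ : ∀ l, Even {c | c ∈ D ∧ M.φ c = l}.ncard := by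
      intro l
      by_cases hl : l ∈ M.φ '' M.cut X
      · have h1 : ∑ c : M.cut X, (if M.φ c.1 = l then y c else 0) = 0 := congrFun hy'.2 ⟨l, hl⟩
        rw [sum_zmod_two_eq, ZMod.natCast_eq_zero_iff_even] at h1
        rwa [himg (fun c => _ = l), Set.ncard_image_of_injective _ Subtype.val_injective]
      · have : {c | c ∈ D ∧ M.φ c = l} = ∅ := by
          ext c
          simp only [Set.mem_ofPred_eq, Set.mem_empty_iff_false, iff_false]
          rintro ⟨⟨h, _⟩, rfl⟩
          exact hl ⟨c, h, rfl⟩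
        simp [this]
    obtain ⟨Z, hZ⟩ : ∃ Z : Set Ω, D = M.cut Z ∧ Disjoint X Z := by
      obtain ⟨Z, hZ⟩ := M.exact D hDu hDφ
      have hZ : D = M.cut Z := hZ
      have hsub : ∀ c ∈ M.cut Z, ¬(M.s c ∈ X ∧ M.t c ∈ X) := by
        intro c hc hcX
        rw [← hZ] at hc
        obtain ⟨h, _⟩ := hc
        exact h (by simp [hcX.1, hcX.2])
      rcases hX.subset_or_disjoint hsub with h | h
      · exact ⟨Zᶜ, by rw [cut_compl, hZ], Set.disjoint_compl_right_iff_subset.2 h⟩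
      · exact ⟨Z, hZ, h⟩
    let x : M.Outside X → ZMod 2 := Quot.lift (fun a => if a.1 ∈ Z then 1 else 0) (by
      rintro a b ⟨c, hc⟩
      have hcX : c ∉ M.cut X := by
        rcases hc with ⟨h1, h2⟩ | ⟨h1, h2⟩
        · have ha := a.2; have hb := b.2
          rw [← h1] at ha; rw [← h2] at hb
          simp only [Set.mem_compl_iff] at ha hb
          simp [cut, ha, hb]
        · have ha := a.2; have hb := b.2
          rw [← h1] at ha; rw [← h2] at hb
          simp only [Set.mem_compl_iff] at ha hb
          simp [cut, ha, hb]
      have hcD : c ∉ M.cut Z := by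
        rw [← hZ.1]
        rintro ⟨h, _⟩
        exact hcX h
      have : M.s c ∈ Z ↔ M.t c ∈ Z := by
        by_contra h; exact hcD h
      rcases hc with ⟨h1, h2⟩ | ⟨h1, h2⟩
      · rw [h1, h2] at this; simp only [this]
      · rw [h1, h2] at this; simp only [this])
    refine ⟨x, ?_⟩
    ext c
    have hx : ∀ z ∈ (outside c).carrier, x (outside c) = if z ∈ Z then 1 else 0 := by
      rintro z ⟨hz, h⟩
      rw [← h]
    change x (outside c) = y c
    have hc : c.1 ∈ M.cut Z ↔ y c = 1 := by
      rw [← hZ.1]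
      exact ⟨fun ⟨_, h⟩ => h, fun h => ⟨c.2, h⟩⟩
    have hy01 : y c = 0 ∨ y c = 1 := by generalize y c = z; revert z; decide
    have hXZ := Set.disjoint_left.1 hZ.2
    rcases joins_outside c with ⟨h1, h2⟩ | ⟨h1, h2⟩
    · rw [hx _ h2]
      have := hXZ h1
      by_cases h : M.t c ∈ Z
      · rw [if_pos h, eq_comm, ← hc]; simp [cut, this, h]
      · have h' : c.1 ∉ M.cut Z := by simp [cut, this, h]
        rw [hc] at h'
        rw [if_neg h, eq_comm]; exact hy01.resolve_right h'
    · rw [hx _ h2]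
      have := hXZ h1
      by_cases h : M.s c ∈ Z
      · rw [if_pos h, eq_comm, ← hc]; simp [cut, this, h]
      · have h' : c.1 ∉ M.cut Z := by simp [cut, this, h]
        rw [hc] at h'
        rw [if_neg h, eq_comm]; exact hy01.resolve_right h'
  have h1 := LinearMap.finrank_range_add_finrank_ker δ
  have h2 : Module.finrank (ZMod 2) (LinearMap.range δ)
      ≤ (M.u '' M.cut X).ncard + (M.φ '' M.cut X).ncard := by
    refine (Submodule.finrank_le _).trans ?_
    rw [Module.finrank_prod, Module.finrank_fintype_fun_eq_card,
      Module.finrank_fintype_fun_eq_card, ← Nat.card_eq_fintype_card,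
      ← Nat.card_eq_fintype_card]
    simp [Set.ncard]
  have h3 : Module.finrank (ZMod 2) (LinearMap.ker δ) ≤ Nat.card (M.Outside X) := by
    refine (Submodule.finrank_mono hker).trans ((LinearMap.finrank_range_le _).trans ?_)
    rw [Module.finrank_fintype_fun_eq_card, Nat.card_eq_fintype_card]
  rw [Module.finrank_fintype_fun_eq_card, ← Nat.card_eq_fintype_card] at h1
  have h4 : M.width X = Nat.card (M.cut X) := rfl
  omega

lemma two_mul_ncard_image_le {L : Type*} (f : C → L) (D : Set C)
    (h : ∀ l, Even {c | c ∈ D ∧ f c = l}.ncard) : 2 * (f '' D).ncard ≤ D.ncard := by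
  classical
  have := Fintype.ofFinite C
  have h1 : (f '' D).ncard = (D.toFinset.image f).card := by
    rw [← Set.ncard_coe_finset]; simp
  rw [h1, Set.ncard_eq_toFinset_card' D, Finset.card_eq_sum_card_image f, mul_comm,
    ← smul_eq_mul]
  refine Finset.card_nsmul_le_sum _ _ _ fun l hl => ?_
  have h2 := h l
  rw [Set.ncard_eq_toFinset_card'] at h2
  have h3 : {c | c ∈ D ∧ f c = l}.toFinset = {c ∈ D.toFinset | f c = l} := by
    ext c; simp
  rw [h3] at h2
  have h4 : 0 < (Finset.filter (fun c => f c = l) D.toFinset).card := by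
    rw [Finset.mem_image] at hl
    obtain ⟨c, hc, rfl⟩ := hl
    exact Finset.card_pos.2 ⟨c, by simpa using hc⟩
  obtain ⟨r, hr⟩ := h2
  omega

/-- A connected set is left by few edges if it sees few regions of the first colour and at most one
component of its complement is cut off by two edges. -/
lemma Conn.width_le_of_unique {X : Set Ω} (hX : M.Conn X) (hne : X.Nonempty)
    (huniq : ∀ q q' : M.Outside X, M.width q.carrier ≤ 2 → M.width q'.carrier ≤ 2 → q = q') :
    M.width X ≤ 4 * (M.u '' M.cut X).ncard + 2 := by
  classical
  have : Finite (M.Outside X) := inferInstanceAs (Finite (Quot _))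
  have := Fintype.ofFinite (M.Outside X)
  have h1 := hX.width_le
  have h2 : 2 * (M.φ '' M.cut X).ncard ≤ M.width X :=
    two_mul_ncard_image_le M.φ (M.cut X) (M.even_φ X)
  have h3 : 4 * Nat.card (M.Outside X) ≤ M.width X + 2 := by
    have h4 : ∀ q : M.Outside X,
        4 ≤ M.width q.carrier + if M.width q.carrier ≤ 2 then 2 else 0 := by
      intro q
      have := two_le_width (M := M) q.carrier_nonempty
        (hne.mono fun x hx hx' => q.carrier_subset hx' hx)
      obtain ⟨r, hr⟩ := M.even_width q.carrier
      split_ifs <;> omega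
    have h5 : ∑ q : M.Outside X, (if M.width q.carrier ≤ 2 then 2 else 0) ≤ 2 := by
      rw [← Finset.sum_filter, Finset.sum_const, smul_eq_mul]
      have : (Finset.univ.filter fun q : M.Outside X => M.width q.carrier ≤ 2).card ≤ 1 := by
        refine Finset.card_le_one.2 fun q hq q' hq' => huniq q q' ?_ ?_
        · simpa using hq
        · simpa using hq'
      omega
    have h6 := Finset.sum_le_sum fun (q : M.Outside X) (_ : q ∈ Finset.univ) => h4 q
    rw [Finset.sum_add_distrib, ← width_eq_sum_outside, Finset.sum_const, Finset.card_univ,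
      smul_eq_mul, ← Nat.card_eq_fintype_card] at h6
    omega
  omega

end Euler
end SphereMap

/-! ### Carving into connected pieces -/

section Growth

variable {α : Type*} {adj : α → α → Prop}

/-- Connectedness with respect to a relation. -/
def RelConn (adj : α → α → Prop) (T : Set α) : Prop :=
  ∀ A ⊆ T, A.Nonempty → (T \ A).Nonempty → ∃ a ∈ A, ∃ b ∈ T \ A, adj a b

/-- `T` is a union of components of `A`. -/
def RelClosed (adj : α → α → Prop) (T A : Set α) : Prop :=
  T ⊆ A ∧ ∀ a ∈ T, ∀ b ∈ A \ T, ¬ adj a b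

lemma RelConn.subset_of_closed {T P A : Set α} (hT : RelConn adj T) (hTA : T ⊆ A)
    (hP : RelClosed adj P A) (hne : (T ∩ P).Nonempty) : T ⊆ P := by
  by_contra h
  obtain ⟨x, hx, hxP⟩ := Set.not_subset.1 h
  obtain ⟨a, ha, b, hb, hab⟩ := hT (T ∩ P) Set.inter_subset_left hne
    ⟨x, hx, fun h => hxP h.2⟩
  exact hP.2 a ha.2 b ⟨hTA hb.1, fun h => hb.2 ⟨hb.1, h⟩⟩ hab

lemma exists_component (hs : ∀ {a b}, adj a b → adj b a) {A : Set α} {y : α} (hy : y ∈ A) :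
    ∃ P, y ∈ P ∧ RelClosed adj P A ∧ RelConn adj P := by
  let r : α → α → Prop := fun a b => adj a b ∧ b ∈ A
  let P : Set α := {z | Relation.ReflTransGen r y z}
  have hPA : P ⊆ A := by
    intro z hz
    cases hz with
    | refl => exact hy
    | tail _ h => exact h.2
  refine ⟨P, .refl, ⟨hPA, fun a ha b hb hab => hb.2 (.tail ha ⟨hab, hb.1⟩)⟩, ?_⟩
  intro Q hQ hne hne'
  by_contra hcon
  push Not at hcon
  -- the part of `P` that contains `y` is everything
  have key : ∀ R ⊆ P, y ∈ R → (∀ a ∈ R, ∀ b ∈ P \ R, ¬ adj a b) → P ⊆ R := by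
    intro R _ hyR hcl z hz
    have hz' : Relation.ReflTransGen r y z := hz
    clear hz
    induction hz' with
    | refl => exact hyR
    | @tail b c hb hbc ih =>
      by_contra hc
      exact hcl b ih c ⟨.tail hb hbc, hc⟩ hbc.1
  by_cases hyQ : y ∈ Q
  · obtain ⟨z, hz, hzQ⟩ := hne'
    exact hzQ (key Q hQ hyQ hcon hz)
  · obtain ⟨z, hz⟩ := hne
    refine (key (P \ Q) Set.sdiff_subset ⟨.refl, hyQ⟩ ?_ (hQ hz)).2 hz
    rintro a ha b ⟨hb, hbQ⟩ hab
    have hb' : b ∈ Q := by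
      by_contra h
      exact hbQ ⟨hb, h⟩
    exact hcon b hb' a ha (hs hab)

lemma RelConn.union (hs : ∀ {a b}, adj a b → adj b a) {T P : Set α} (hT : RelConn adj T)
    (hP : RelConn adj P) {a b : α} (ha : a ∈ T) (hb : b ∈ P) (hab : adj a b) : RelConn adj (T ∪ P) := by
  intro Q hQ hne hne'
  by_contra hcon
  push Not at hcon
  have hcl : RelClosed adj Q (T ∪ P) := ⟨hQ, hcon⟩
  have hcl' : RelClosed adj ((T ∪ P) \ Q) (T ∪ P) := by
    refine ⟨Set.sdiff_subset, fun x hx y hy hxy => ?_⟩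
    have hyQ : y ∈ Q := by
      by_contra h; exact hy.2 ⟨hy.1, h⟩
    exact hcon y hyQ x hx (hs hxy)
  have key : ∀ R, RelClosed adj R (T ∪ P) → a ∈ R → T ∪ P ⊆ R := by
    intro R hR haR
    have hTR := hT.subset_of_closed Set.subset_union_left hR ⟨a, ha, haR⟩
    have hbR : b ∈ R := by
      by_contra h
      exact hR.2 a haR b ⟨.inr hb, h⟩ hab
    exact Set.union_subset hTR (hP.subset_of_closed Set.subset_union_right hR ⟨b, hb, hbR⟩)
  by_cases haQ : a ∈ Q
  · obtain ⟨x, hx, hxQ⟩ := hne'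
    exact hxQ (key Q hcl haQ hx)
  · obtain ⟨x, hx⟩ := hne
    exact (key _ hcl' ⟨.inl ha, haQ⟩ (hQ hx)).2 hx

/-- Turn a carving into one with connected sets: if `A ∪ B` is split into `A` and `B`, then a
component of `A ∪ B` is put together from components of `A` and of `B`, one after another, in
such an order that it stays connected. -/
lemma good_of_carved [Finite α] (hs : ∀ {a b}, adj a b → adj b a) {Y : Set α}
    {q good : Set α → Prop}
    (hsingle : ∀ y ∈ Y, good {y})
    (hunion : ∀ T P A B, Disjoint T P → good T → good P → q A → q B → T ∪ P ⊆ A ∪ B →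
      T ∪ P ⊆ Y → RelConn adj (T ∪ P) → RelClosed adj ((T ∪ P) ∩ A) (A ∩ Y) →
      RelClosed adj ((T ∪ P) ∩ B) (B ∩ Y) → good (T ∪ P))
    {S : Set α} (h : Carved q S) :
    ∀ T, T.Nonempty → RelConn adj T → RelClosed adj T (S ∩ Y) → good T := by
  induction h with
  | single a _ =>
    rintro T ⟨x, hx⟩ _ ⟨hT, _⟩
    have hxa : x = a := (hT hx).1
    subst hxa
    have : T = {x} := Set.Subset.antisymm (fun z hz => (hT hz).1) (by simpa using hx)
    rw [this]
    exact hsingle x (hT hx).2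
  | union A B hAB hA hB _ ihA ihB =>
    intro T hne hT hcl
    -- unions of components of `A` and `B` that are known to be good
    let Q : Set (Set α) := {X | X ⊆ T ∧ X.Nonempty ∧ RelConn adj X ∧ good X ∧
      RelClosed adj (X ∩ A) (A ∩ Y) ∧ RelClosed adj (X ∩ B) (B ∩ Y)}
    have hpiece : ∀ y ∈ T, ∃ P, y ∈ P ∧ P ⊆ T ∧ RelConn adj P ∧ good P ∧
        ((P ⊆ A ∧ RelClosed adj P (A ∩ Y)) ∨ (P ⊆ B ∧ RelClosed adj P (B ∩ Y))) := by
      intro y hy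
      have hsub : ∀ {D : Set α} {P : Set α}, D ⊆ A ∪ B → y ∈ P → RelClosed adj P (D ∩ Y) →
          RelConn adj P → P ⊆ T := fun hD hyP hP hPc =>
        hPc.subset_of_closed (hP.1.trans (Set.inter_subset_inter_left _ hD)) hcl ⟨y, hyP, hy⟩
      rcases (hcl.1 hy).1 with hyA | hyB
      · obtain ⟨P, h1, h2, h3⟩ := exists_component hs (A := A ∩ Y) ⟨hyA, (hcl.1 hy).2⟩
        exact ⟨P, h1, hsub Set.subset_union_left h1 h2 h3, h3, ihA P ⟨y, h1⟩ h3 h2,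
          .inl ⟨fun x hx => (h2.1 hx).1, h2⟩⟩
      · obtain ⟨P, h1, h2, h3⟩ := exists_component hs (A := B ∩ Y) ⟨hyB, (hcl.1 hy).2⟩
        exact ⟨P, h1, hsub Set.subset_union_right h1 h2 h3, h3, ihB P ⟨y, h1⟩ h3 h2,
          .inr ⟨fun x hx => (h2.1 hx).1, h2⟩⟩
    have hempty : ∀ D : Set α, RelClosed adj ∅ D := fun D => ⟨Set.empty_subset _, by simp⟩
    have hpiece' : ∀ P : Set α,
        ((P ⊆ A ∧ RelClosed adj P (A ∩ Y)) ∨ (P ⊆ B ∧ RelClosed adj P (B ∩ Y))) →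
        RelClosed adj (P ∩ A) (A ∩ Y) ∧ RelClosed adj (P ∩ B) (B ∩ Y) := by
      rintro P (⟨h1, h2⟩ | ⟨h1, h2⟩)
      · rw [Set.inter_eq_left.2 h1, (hAB.mono_left h1).inter_eq]
        exact ⟨h2, hempty _⟩
      · rw [Set.inter_eq_left.2 h1, (hAB.symm.mono_left h1).inter_eq]
        exact ⟨hempty _, h2⟩
    have hclu : ∀ X P D : Set α, RelClosed adj X D → RelClosed adj P D →
        RelClosed adj (X ∪ P) D := by
      intro X P D hX hP
      refine ⟨Set.union_subset hX.1 hP.1, ?_⟩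
      rintro a (ha | ha) b ⟨hb, hb'⟩
      · exact hX.2 a ha b ⟨hb, fun h => hb' (.inl h)⟩
      · exact hP.2 a ha b ⟨hb, fun h => hb' (.inr h)⟩
    have hQne : Q.Nonempty := by
      obtain ⟨y, hy⟩ := hne
      obtain ⟨P, h1, h2, h3, h4, h5⟩ := hpiece y hy
      exact ⟨P, h2, ⟨y, h1⟩, h3, h4, hpiece' P h5⟩
    obtain ⟨X, hX⟩ := (Set.toFinite Q).exists_maximal hQne
    obtain ⟨hXT, hXne, hXc, hXg, hXA, hXB⟩ := hX.1
    by_cases hTX : T ⊆ X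
    · rwa [Set.Subset.antisymm hTX hXT]
    exfalso
    obtain ⟨z, hz, hzX⟩ := Set.not_subset.1 hTX
    obtain ⟨a, ha, b, hb, hab⟩ := hT X hXT hXne ⟨z, hz, hzX⟩
    obtain ⟨P, h1, h2, h3, h4, h5⟩ := hpiece b hb.1
    have h6 := hpiece' P h5
    have hdisj : Disjoint X P := by
      rw [Set.disjoint_iff_inter_eq_empty, ← Set.not_nonempty_iff_eq_empty]
      rintro ⟨x, hx, hxP⟩
      rcases h5 with ⟨h5, h7⟩ | ⟨h5, h7⟩
      · exact hb.2 (h3.subset_of_closed h7.1 hXA ⟨x, hxP, hx, h5 hxP⟩ h1).1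
      · exact hb.2 (h3.subset_of_closed h7.1 hXB ⟨x, hxP, hx, h5 hxP⟩ h1).1
    have h7 : RelConn adj (X ∪ P) := hXc.union hs h3 ha h1 hab
    have h8 : X ∪ P ⊆ T := Set.union_subset hXT h2
    have h9 : RelClosed adj ((X ∪ P) ∩ A) (A ∩ Y) := by
      rw [Set.union_inter_distrib_right]; exact hclu _ _ _ hXA h6.1
    have h10 : RelClosed adj ((X ∪ P) ∩ B) (B ∩ Y) := by
      rw [Set.union_inter_distrib_right]; exact hclu _ _ _ hXB h6.2
    have h11 : X ∪ P ∈ Q := by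
      refine ⟨h8, hXne.mono Set.subset_union_left, h7, ?_, h9, h10⟩
      exact hunion X P A B hdisj hXg h4 hA.good hB.good
        (fun x hx => (hcl.1 (h8 hx)).1) (fun x hx => (hcl.1 (h8 hx)).2) h7 h9 h10
    exact hb.2 (hX.2 h11 Set.subset_union_left (.inr h1))

end Growth

namespace SphereMap

/-! ### Carving the medial graph -/

variable {Ω C U F : Type*} (M : SphereMap Ω C U F)

/-- The element `x` of the medial graph lies at the region `l` of the first colour. -/
def Incident (x : Ω) (l : U) : Prop := ∃ c, M.u c = l ∧ (M.s c = x ∨ M.t c = x)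

/-- The regions in `R` that lie both at an element of `S` and at an element outside of `S`. -/
def regionBoundary (R : Set U) (S : Set Ω) : Set U :=
  {l | l ∈ R ∧ (∃ a ∈ S, M.Incident a l) ∧ ∃ b ∉ S, M.Incident b l}

/-- A lobe of `K` is a maximal proper nonempty subset that is left by at most two edges of the
medial graph. -/
def IsLobe (K L : Set Ω) : Prop :=
  Maximal (fun L => L ⊂ K ∧ L.Nonempty ∧ M.width L ≤ 2) L

variable {M}

lemma exists_isLobe [Finite Ω] {K Z : Set Ω} (hZ : Z ⊂ K) (hne : Z.Nonempty)
    (h : M.width Z ≤ 2) : ∃ L, M.IsLobe K L ∧ Z ⊆ L := by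
  obtain ⟨L, hL, hL'⟩ := (Set.toFinite {L | L ⊂ K ∧ L.Nonempty ∧ M.width L ≤ 2}).exists_le_maximal
    (a := Z) ⟨hZ, hne, h⟩
  exact ⟨L, hL', hL⟩

/-- Unless `K` is the disjoint union of two sets that are left by two edges, its lobes are
disjoint and not adjacent. -/
lemma IsLobe.eq_or_disjoint [Finite C] {K : Set Ω}
    (hK : ¬ ∃ A B, Disjoint A B ∧ A ∪ B = K ∧ A.Nonempty ∧ B.Nonempty ∧ M.width A ≤ 2 ∧
      M.width B ≤ 2)
    {L L' : Set Ω} (h : M.IsLobe K L) (h' : M.IsLobe K L') :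
    L = L' ∨ (Disjoint L L' ∧ ∀ c, ¬ M.Joins c L L') := by
  by_cases heq : L = L'
  · exact .inl heq
  right
  obtain ⟨⟨hLK, hLn, hLw⟩, hmax⟩ := h
  obtain ⟨⟨hLK', hLn', hLw'⟩, hmax'⟩ := h'
  have hnot : ¬ L ⊆ L' := fun hs => heq (Set.Subset.antisymm hs (hmax ⟨hLK', hLn', hLw'⟩ hs))
  have hnot' : ¬ L' ⊆ L := fun hs => heq (Set.Subset.antisymm (hmax' ⟨hLK, hLn, hLw⟩ hs) hs)
  have hun : L ∪ L' ⊆ K := Set.union_subset hLK.1 hLK'.1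
  -- the union is not left by two edges only
  have hunion : M.width (L ∪ L') ≤ 2 → L ∪ L' = K := by
    intro hw
    by_contra hne
    exact hnot' (Set.subset_union_right.trans
      (hmax ⟨hun.ssubset_of_ne hne, hLn.mono Set.subset_union_left, hw⟩ Set.subset_union_left))
  have hdisj : Disjoint L L' := by
    by_contra hd
    have hin : (L ∩ L').Nonempty := Set.not_disjoint_iff_nonempty_inter.1 hd
    have hKc : ∀ Z, Z ⊂ K → Zᶜ.Nonempty := by
      intro Z hZ
      obtain ⟨x, _, hx⟩ := Set.exists_of_ssubset hZ
      exact ⟨x, hx⟩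
    have h1 := M.width_union_add_width_inter_le L L'
    have h2 := two_le_width (M := M) hin ((hKc L hLK).mono
      (Set.compl_subset_compl.2 Set.inter_subset_left))
    have h3 := hunion (by omega)
    have h4 := M.width_sdiff_add_width_sdiff_le L L'
    have h5 : (L \ L').Nonempty := Set.sdiff_nonempty.2 hnot
    have h6 : (L' \ L).Nonempty := Set.sdiff_nonempty.2 hnot'
    have h7 := two_le_width (M := M) h5 ((hKc L hLK).mono
      (Set.compl_subset_compl.2 Set.sdiff_subset))
    refine hK ⟨L, L' \ L, Set.disjoint_sdiff_right, ?_, hLn, h6, hLw, by omega⟩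
    rw [Set.union_sdiff_self, h3]
  refine ⟨hdisj, fun c hc => ?_⟩
  have h1 := M.width_union_add_two_le hdisj hc
  exact hK ⟨L, L', hdisj, hunion (by omega), hLn, hLn', hLw, hLw'⟩

/-- Every lobe is adjacent to an element of `K` that is in no lobe. -/
lemma IsLobe.exists_joins [Finite C] {K : Set Ω} (hw : M.width K ≤ 2)
    (hK : ¬ ∃ A B, Disjoint A B ∧ A ∪ B = K ∧ A.Nonempty ∧ B.Nonempty ∧ M.width A ≤ 2 ∧
      M.width B ≤ 2)
    {L : Set Ω} (h : M.IsLobe K L) :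
    ∃ y ∈ K, (∀ L', M.IsLobe K L' → y ∉ L') ∧ ∃ c, M.Joins c L {y} := by
  obtain ⟨x, hx, hxL⟩ := Set.exists_of_ssubset h.1.1
  obtain ⟨c, hc⟩ := conn_of_width_le_two hw L h.1.1.1 h.1.2.1 ⟨x, hx, hxL⟩
  have key : ∀ y, M.Joins c L {y} → y ∈ K \ L →
      ∃ y ∈ K, (∀ L', M.IsLobe K L' → y ∉ L') ∧ ∃ c, M.Joins c L {y} := by
    intro y hy hyK
    refine ⟨y, hyK.1, fun L' hL' hyL' => ?_, c, hy⟩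
    rcases h.eq_or_disjoint hK hL' with rfl | h'
    · exact hyK.2 hyL'
    · exact h'.2 c (hy.mono subset_rfl (by simpa using hyL'))
  rcases hc with ⟨h1, h2⟩ | ⟨h1, h2⟩
  · exact key _ (.inl ⟨h1, rfl⟩) h2
  · exact key _ (.inr ⟨h1, rfl⟩) h2

lemma even_ncard_pair {L : Type*} {f : C → L} {c c' : C} (hne : c ≠ c') (hf : f c = f c') (l : L) :
    Even {d | d ∈ ({c, c'} : Set C) ∧ f d = l}.ncard := by
  by_cases hl : f c = l
  · have : {d | d ∈ ({c, c'} : Set C) ∧ f d = l} = {c, c'} := by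
      ext d
      simp only [Set.mem_ofPred_eq, and_iff_left_iff_imp]
      rintro (rfl | rfl)
      · exact hl
      · exact hf ▸ hl
    rw [this, Set.ncard_pair hne]
    exact even_two
  · have : {d | d ∈ ({c, c'} : Set C) ∧ f d = l} = ∅ := by
      ext d
      simp only [Set.mem_ofPred_eq, Set.mem_empty_iff_false, iff_false, not_and]
      rintro (rfl | rfl)
      · exact hl
      · rwa [← hf]
    rw [this, Set.ncard_empty]
    exact Even.zero

section Retraction

/-- A retraction of `K` that moves every lobe to a neighbour of it that is in no lobe. -/
structure LobeRetraction (M : SphereMap Ω C U F) (K : Set Ω) where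
  /-- the retraction -/
  ρ : Ω → Ω
  width_le : M.width K ≤ 2
  mem : ∀ x ∈ K, ρ x ∈ K ∧ ∀ L, M.IsLobe K L → ρ x ∉ L
  fixed : ∀ x, (∀ L, M.IsLobe K L → x ∉ L) → ρ x = x
  lobe : ∀ L, M.IsLobe K L → ∃ y, (∀ x ∈ L, ρ x = y) ∧ ∃ c, M.Joins c L {y}

open Classical in
lemma exists_lobeRetraction [Finite C] {K : Set Ω} (hw : M.width K ≤ 2)
    (hK : ¬ ∃ A B, Disjoint A B ∧ A ∪ B = K ∧ A.Nonempty ∧ B.Nonempty ∧ M.width A ≤ 2 ∧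
      M.width B ≤ 2) : Nonempty (LobeRetraction M K) := by
  have hex : ∀ L : {L // M.IsLobe K L}, ∃ y ∈ K, (∀ L', M.IsLobe K L' → y ∉ L') ∧
      ∃ c, M.Joins c L.1 {y} := fun L => L.2.exists_joins hw hK
  choose σ h1 h2 h3 using hex
  let ρ : Ω → Ω := fun x => if h : ∃ L, M.IsLobe K L ∧ x ∈ L then σ ⟨h.choose, h.choose_spec.1⟩
    else x
  have hlobe : ∀ L (hL : M.IsLobe K L), ∀ x ∈ L, ρ x = σ ⟨L, hL⟩ := by
    intro L hL x hx
    have h : ∃ L, M.IsLobe K L ∧ x ∈ L := ⟨L, hL, hx⟩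
    have heq : h.choose = L := (h.choose_spec.1.eq_or_disjoint hK hL).resolve_right fun h' =>
      Set.disjoint_left.1 h'.1 h.choose_spec.2 hx
    simp only [ρ, dif_pos h]
    congr 1
    exact Subtype.ext heq
  have hfix : ∀ x, (∀ L, M.IsLobe K L → x ∉ L) → ρ x = x := by
    intro x hx
    exact dif_neg fun ⟨L, hL, hxL⟩ => hx L hL hxL
  refine ⟨⟨ρ, hw, fun x hx => ?_, hfix, fun L hL => ⟨_, hlobe L hL, h3 ⟨L, hL⟩⟩⟩⟩
  by_cases h : ∃ L, M.IsLobe K L ∧ x ∈ L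
  · obtain ⟨L, hL, hxL⟩ := h
    rw [hlobe L hL x hxL]
    exact ⟨h1 _, h2 _⟩
  · have hx' : ∀ L, M.IsLobe K L → x ∉ L := fun L hL hxL => h ⟨L, hL, hxL⟩
    rw [hfix x hx']
    exact ⟨hx, hx'⟩

namespace LobeRetraction

variable {K : Set Ω} (r : LobeRetraction M K)

/-- The elements of `K` that are in no lobe. -/
def core (_ : LobeRetraction M K) : Set Ω := {y | y ∈ K ∧ ∀ L, M.IsLobe K L → y ∉ L}

/-- The elements of `T` together with the lobes attached to them. -/
def fill (T : Set Ω) : Set Ω := {x | x ∈ K ∧ r.ρ x ∈ T}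

lemma fixed_of_mem_core {y : Ω} (hy : y ∈ r.core) : r.ρ y = y := r.fixed y hy.2

lemma ρ_mem_core {x : Ω} (hx : x ∈ K) : r.ρ x ∈ r.core := r.mem x hx

lemma ρ_const {L : Set Ω} (hL : M.IsLobe K L) {x y : Ω} (hx : x ∈ L) (hy : y ∈ L) :
    r.ρ x = r.ρ y := by
  obtain ⟨z, hz, -⟩ := r.lobe L hL
  rw [hz x hx, hz y hy]

lemma fill_subset (T : Set Ω) : r.fill T ⊆ K := fun _ h => h.1

lemma fill_union (T T' : Set Ω) : r.fill (T ∪ T') = r.fill T ∪ r.fill T' := by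
  ext x
  simp only [fill, Set.mem_ofPred_eq, Set.mem_union]
  tauto

lemma fill_disjoint {T T' : Set Ω} (h : Disjoint T T') : Disjoint (r.fill T) (r.fill T') :=
  Set.disjoint_left.2 fun _ hx hx' => Set.disjoint_left.1 h hx.2 hx'.2

lemma fill_core : r.fill r.core = K :=
  Set.Subset.antisymm (r.fill_subset _) fun _ hx => ⟨hx, r.ρ_mem_core hx⟩

lemma mem_fill_of_mem {T : Set Ω} (hT : T ⊆ r.core) {y : Ω} (hy : y ∈ T) : y ∈ r.fill T :=
  ⟨(hT hy).1, by rwa [r.fixed_of_mem_core (hT hy)]⟩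

/-- What is filled in with `y` is `y` itself or lies in a lobe that is attached to `y`. -/
lemma eq_or_mem_lobe {y x : Ω} (hx : x ∈ r.fill {y}) :
    x = y ∨ ∃ L, M.IsLobe K L ∧ x ∈ L ∧ L ⊆ r.fill {y} ∧ ∃ c, M.Joins c L {y} := by
  by_cases h : ∃ L, M.IsLobe K L ∧ x ∈ L
  · obtain ⟨L, hL, hxL⟩ := h
    obtain ⟨z, hz, c, hc⟩ := r.lobe L hL
    have hzy : z = y := (hz x hxL).symm.trans hx.2
    subst hzy
    exact .inr ⟨L, hL, hxL, fun x' hx' => ⟨hL.1.1.1 hx', hz x' hx'⟩, c, hc⟩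
  · left
    rw [← r.fixed x fun L hL hxL => h ⟨L, hL, hxL⟩]
    exact hx.2

variable (M) in
/-- Adjacency of elements of the core after the lobes have been attached. -/
def Adj (y y' : Ω) : Prop := ∃ c, M.Joins c (r.fill {y}) (r.fill {y'})

lemma Adj.symm {y y' : Ω} (h : r.Adj M y y') : r.Adj M y' y := h.imp fun _ h => h.symm

lemma singleton_subset_fill {x : Ω} (hx : x ∈ K) : {x} ⊆ r.fill {r.ρ x} := by
  rintro _ rfl
  exact ⟨hx, rfl⟩

variable [Finite C]

lemma conn_fill_singleton {y : Ω} : M.Conn (r.fill {y}) := by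
  have key : ∀ A ⊆ r.fill {y}, y ∈ A → (r.fill {y} \ A).Nonempty →
      ∃ c, M.Joins c A (r.fill {y} \ A) := by
    intro A hA hyA ⟨x, hx, hxA⟩
    rcases r.eq_or_mem_lobe hx with rfl | ⟨L, hL, hxL, hLs, c, hc⟩
    · exact absurd hyA hxA
    · by_cases hd : (L ∩ A).Nonempty
      · obtain ⟨c, hc⟩ := conn_of_width_le_two hL.1.2.2 (L ∩ A) Set.inter_subset_left hd
          ⟨x, hxL, fun h => hxA h.2⟩
        exact ⟨c, hc.mono Set.inter_subset_right fun z hz =>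
          ⟨hLs hz.1, fun h => hz.2 ⟨hz.1, h⟩⟩⟩
      · exact ⟨c, hc.symm.mono (by simpa using hyA) fun z hz =>
          ⟨hLs hz, fun h => hd ⟨z, hz, h⟩⟩⟩
  intro A hA hne hne'
  by_cases hyA : y ∈ A
  · exact key A hA hyA hne'
  · obtain ⟨x, hx⟩ := hne
    -- if `y` is missing from `A`, exchange `A` with its complement
    by_cases hy : y ∈ r.fill {y}
    · obtain ⟨c, hc⟩ := key (r.fill {y} \ A) Set.sdiff_subset ⟨hy, hyA⟩
        ⟨x, hA hx, fun h => h.2 hx⟩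
      refine ⟨c, hc.symm.mono (fun z hz => ?_) subset_rfl⟩
      by_contra h
      exact hz.2 ⟨hz.1, h⟩
    · exfalso
      have h1 := r.ρ_mem_core (hA hx).1
      rw [show r.ρ x = y from (hA hx).2] at h1
      exact hy ⟨h1.1, r.fixed_of_mem_core h1⟩

lemma conn_fill {T : Set Ω} (hT : RelConn (r.Adj M) T) : M.Conn (r.fill T) := by
  intro A hA hne hne'
  by_cases h : ∃ y ∈ T, (r.fill {y} ∩ A).Nonempty ∧ (r.fill {y} \ A).Nonempty
  · obtain ⟨y, hy, h1, h2⟩ := h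
    obtain ⟨c, hc⟩ := r.conn_fill_singleton (r.fill {y} ∩ A) Set.inter_subset_left h1
      (h2.mono fun x hx => ⟨hx.1, fun h => hx.2 h.2⟩)
    refine ⟨c, hc.mono Set.inter_subset_right fun x hx => ⟨⟨hx.1.1, ?_⟩,
      fun h => hx.2 ⟨hx.1, h⟩⟩⟩
    rw [show r.ρ x = y from hx.1.2]
    exact hy
  · have h' : ∀ y ∈ T, (r.fill {y} ∩ A).Nonempty → r.fill {y} ⊆ A := by
      intro y hy hne x hx
      by_contra hxA
      exact h ⟨y, hy, hne, x, hx, hxA⟩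
    obtain ⟨x, hx⟩ := hne
    obtain ⟨x', hx', hxA'⟩ := hne'
    obtain ⟨a, ha, b, hb, c, hc⟩ := hT {y | y ∈ T ∧ (r.fill {y} ∩ A).Nonempty} (fun y hy => hy.1)
      ⟨r.ρ x, (hA hx).2, x, ⟨(hA hx).1, rfl⟩, hx⟩
      ⟨r.ρ x', hx'.2, fun h => hxA' (h' _ hx'.2 h.2 ⟨hx'.1, rfl⟩)⟩
    refine ⟨c, hc.mono (h' a ha.1 ha.2) fun z hz => ⟨⟨hz.1, ?_⟩, fun hzA => ?_⟩⟩
    · rw [show r.ρ z = b from hz.2]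
      exact hb.1
    · exact hb.2 ⟨hb.1, z, hz, hzA⟩

/-- If an edge joins elements that are attached to different elements of the core, then these
elements of the core lie at the region of the edge. -/
lemma incident_ρ {c : C} {a b : Ω} (hc : M.Joins c {a} {b}) (ha : a ∈ K)
    (hne : r.ρ a ≠ r.ρ b) : M.Incident (r.ρ a) (M.u c) := by
  by_cases h : ∃ L, M.IsLobe K L ∧ a ∈ L
  · obtain ⟨L, hL, haL⟩ := h
    have hbL : b ∉ L := fun hbL => hne (r.ρ_const hL haL hbL)
    obtain ⟨z, hz, c', hc'⟩ := r.lobe L hL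
    have hzL : z ∉ L := by
      rw [← hz a haL]
      exact (r.mem a ha).2 L hL
    have h1 : c ∈ M.cut L :=
      (hc.mono (B' := {b}) (by simpa using haL) subset_rfl).mem_cut (by simpa using hbL)
    have h2 : c' ∈ M.cut L := hc'.mem_cut (by simpa using hzL)
    rw [u_eq_of_mem_cut hL.1.2.2 h1 h2, hz a haL]
    rcases hc' with ⟨_, h⟩ | ⟨_, h⟩
    · exact ⟨c', rfl, .inr h⟩
    · exact ⟨c', rfl, .inl h⟩
  · rw [r.fixed a fun L hL haL => h ⟨L, hL, haL⟩]
    rcases hc with ⟨h, _⟩ | ⟨h, _⟩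
    · exact ⟨c, rfl, .inl h⟩
    · exact ⟨c, rfl, .inr h⟩

variable [Finite Ω]

/-- The components of the complement of a connected union of filled elements: only the one outside
of `K` can be cut off by two edges, since a lobe is filled in along with its neighbour. -/
lemma width_fill_le {T : Set Ω} (hT : RelConn (r.Adj M) T) (hne : T.Nonempty)
    (hTc : T ⊆ r.core) :
    M.width (r.fill T) ≤ 4 * (M.u '' M.cut (r.fill T)).ncard + 2 := by
  refine (r.conn_fill hT).width_le_of_unique
    (hne.mono fun y hy => r.mem_fill_of_mem hTc hy) ?_
  have hKc : M.Conn Kᶜ := conn_of_width_le_two (by rw [width_compl]; exact r.width_le)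
  have hdc : Disjoint Kᶜ (r.fill T) :=
    Set.disjoint_left.2 fun x hx hx' => hx (r.fill_subset T hx')
  have key : ∀ q : M.Outside (r.fill T), M.width q.carrier ≤ 2 → (Kᶜ ∩ q.carrier).Nonempty := by
    intro q hq
    by_contra hcon
    have hqK : q.carrier ⊆ K := by
      intro x hx
      by_contra hxK
      exact hcon ⟨x, hxK, hx⟩
    obtain ⟨y, hy⟩ := hne
    have hyf := r.mem_fill_of_mem hTc hy
    have hss : q.carrier ⊂ K :=
      hqK.ssubset_of_mem_notMem (hTc hy).1 fun h => q.carrier_subset h hyf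
    obtain ⟨L, hL, hqL⟩ := exists_isLobe hss q.carrier_nonempty hq
    obtain ⟨x, hx⟩ := q.carrier_nonempty
    have hLd : Disjoint L (r.fill T) := by
      rw [Set.disjoint_left]
      intro z hz hzf
      refine q.carrier_subset hx ⟨hqK hx, ?_⟩
      rw [r.ρ_const hL (hqL hx) hz]
      exact hzf.2
    have hLq : L ⊆ q.carrier :=
      Outside.subset_carrier (conn_of_width_le_two hL.1.2.2) hLd ⟨x, hqL hx, hx⟩
    obtain ⟨z, hz, c, hc⟩ := r.lobe L hL
    have hzL : z ∉ L := by
      rw [← hz x (hqL hx)]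
      exact (r.mem x (hqK hx)).2 L hL
    have hzT : z ∈ r.fill T := by
      by_contra hzf
      rcases hc with ⟨h1, h2⟩ | ⟨h1, h2⟩
      · exact hzL (hqL (Outside.mem_of_joins (c := c) (hLq h1) (.inl ⟨rfl, h2⟩) hzf))
      · exact hzL (hqL (Outside.mem_of_joins (c := c) (hLq h1) (.inr ⟨rfl, h2⟩) hzf))
    have hzT' := hzT.2
    rw [show r.ρ z = z by
      rw [← hz x (hqL hx)]; exact r.fixed_of_mem_core (r.ρ_mem_core (hqK hx))] at hzT'
    exact Set.disjoint_left.1 hLd (hqL hx) ⟨hqK hx, by rwa [hz x (hqL hx)]⟩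
  intro q q' hq hq'
  have h1 := Outside.subset_carrier hKc hdc (key q hq)
  obtain ⟨x, hx, hx'⟩ := key q' hq'
  obtain ⟨_, h2⟩ := h1 hx
  obtain ⟨_, h3⟩ := hx'
  exact h2.symm.trans h3

/-- No two edges that leave a filled set form a cut, unless they leave `K`. -/
lemma mem_cut_of_pair {T : Set Ω} {c c' : C}
    (hc : c ∈ M.cut (r.fill T)) (hc' : c' ∈ M.cut (r.fill T)) {Z : Set Ω}
    (hZ : M.cut Z = {c, c'}) : c ∈ M.cut K ∨ c' ∈ M.cut K := by
  by_contra hcon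
  push Not at hcon
  have hKc : M.Conn Kᶜ := conn_of_width_le_two (by rw [width_compl]; exact r.width_le)
  have hends : ∀ c ∈ M.cut (r.fill T), c ∉ M.cut K → M.s c ∈ K ∧ M.t c ∈ K := by
    intro c hc hcK
    have hcK : M.s c ∈ K ↔ M.t c ∈ K := by
      by_contra h; exact hcK h
    rcases mem_cut_iff_joins.1 hc with ⟨h, _⟩ | ⟨h, _⟩
    · exact ⟨h.1, hcK.1 h.1⟩
    · exact ⟨hcK.2 h.1, h.1⟩
  have hcZ : c ∈ M.cut Z := hZ ▸ .inl rfl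
  have hwZ : M.width Z ≤ 2 := by
    rw [width, hZ]
    exact (Set.ncard_insert_le _ _).trans (by simp)
  obtain ⟨Z, hZ, hZK, hwZ⟩ : ∃ Z, M.cut Z = {c, c'} ∧ Z ⊆ K ∧ M.width Z ≤ 2 := by
    have hsub : ∀ d ∈ M.cut Z, ¬(M.s d ∈ Kᶜ ∧ M.t d ∈ Kᶜ) := by
      intro d hd hdK
      rw [hZ] at hd
      rcases hd with rfl | rfl
      · exact hdK.1 (hends _ hc hcon.1).1
      · exact hdK.1 (hends _ hc' hcon.2).1
    rcases hKc.subset_or_disjoint hsub with h | h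
    · exact ⟨Zᶜ, by rw [cut_compl, hZ], Set.compl_subset_comm.1 h, by rwa [width_compl]⟩
    · exact ⟨Z, hZ, fun x hx => by
        by_contra hxK; exact Set.disjoint_left.1 h hxK hx, hwZ⟩
  have hcZ : c ∈ M.cut Z := hZ ▸ .inl rfl
  have hcZ' : c' ∈ M.cut Z := hZ ▸ .inr rfl
  have hne : Z.Nonempty := by
    rcases mem_cut_iff_joins.1 hcZ with ⟨h, _⟩ | ⟨h, _⟩ <;> exact ⟨_, h⟩
  have hss : Z ⊂ K := hZK.ssubset_of_ne (by rintro rfl; exact hcon.1 hcZ)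
  obtain ⟨L, hL, hZL⟩ := exists_isLobe hss hne hwZ
  have hcL : ∀ d ∈ M.cut (r.fill T), d ∈ M.cut Z → M.s d ∈ K ∧ M.t d ∈ K → d ∈ M.cut L := by
    intro d hd hdZ hdK
    by_contra hdL
    have hdL : M.s d ∈ L ↔ M.t d ∈ L := by
      by_contra h; exact hdL h
    have hboth : M.s d ∈ L ∧ M.t d ∈ L := by
      rcases mem_cut_iff_joins.1 hdZ with ⟨h, _⟩ | ⟨h, _⟩
      · exact ⟨hZL h, hdL.1 (hZL h)⟩
      · exact ⟨hdL.2 (hZL h), hZL h⟩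
    have heq := r.ρ_const hL hboth.1 hboth.2
    exact hd (by simp [fill, hdK, heq])
  have h1 := hcL c hc hcZ (hends _ hc hcon.1)
  have h2 := hcL c' hc' hcZ' (hends _ hc' hcon.2)
  have hsub : M.cut Z ⊆ M.cut L := by
    rw [hZ]; rintro d (rfl | rfl)
    · exact h1
    · exact h2
  have heven : 2 ≤ M.width Z := two_le_width hne
    (by obtain ⟨x, _, hx⟩ := Set.exists_of_ssubset hss; exact ⟨x, hx⟩)
  have heq : M.cut Z = M.cut L :=
    Set.eq_of_subset_of_ncard_le hsub (hL.1.2.2.trans heven)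
  obtain ⟨x, hx⟩ := hL.1.2.1
  obtain ⟨z, hz, d, hd⟩ := r.lobe L hL
  have hzL : z ∉ L := by
    rw [← hz x hx]
    exact (r.mem x (hL.1.1.1 hx)).2 L hL
  have hzc : z ∈ r.core := by
    rw [← hz x hx]; exact r.ρ_mem_core (hL.1.1.1 hx)
  have hdL : d ∈ M.cut L := hd.mem_cut (by simpa using hzL)
  rw [← heq, hZ] at hdL
  have hdT : d ∈ M.cut (r.fill T) := by
    rcases hdL with rfl | rfl
    · exact hc
    · exact hc'
  -- both ends of `d` are attached to `z`
  have hin : ∀ y ∈ L, y ∈ K ∧ r.ρ y = z := fun y hy => ⟨hL.1.1.1 hy, hz y hy⟩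
  have hzz : z ∈ K ∧ r.ρ z = z := ⟨hzc.1, r.fixed_of_mem_core hzc⟩
  apply hdT
  rcases hd with ⟨h3, h4⟩ | ⟨h3, h4⟩
  · rw [Set.mem_singleton_iff] at h4
    simp [fill, hin _ h3, h4, hzz]
  · rw [Set.mem_singleton_iff] at h4
    simp [fill, hin _ h3, h4, hzz]

/-- The regions at the boundary of a connected piece lie at the boundary of one of the parts of
which it is composed, apart from the one at the boundary of `K`. -/
lemma image_cut_fill_subset {R : Set U}
    (hR : ∀ c c', M.u c = M.u c' → M.u c ∉ R → M.φ c = M.φ c') {T A B : Set Ω}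
    (hTAB : T ⊆ A ∪ B)
    (hA : RelClosed (r.Adj M) (T ∩ A) (A ∩ r.core))
    (hB : RelClosed (r.Adj M) (T ∩ B) (B ∩ r.core)) :
    M.u '' M.cut (r.fill T) ⊆
      M.regionBoundary R A ∪ M.regionBoundary R B ∪ M.u '' M.cut K := by
  rintro _ ⟨c, hc, rfl⟩
  by_cases hcK : c ∈ M.cut K
  · exact .inr ⟨c, hcK, rfl⟩
  by_cases hcR : M.u c ∈ R
  · left
    obtain ⟨a, b, hab, ha, hb⟩ : ∃ a b, M.Joins c {a} {b} ∧ a ∈ r.fill T ∧ b ∉ r.fill T := by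
      rcases mem_cut_iff_joins.1 hc with ⟨h1, h2⟩ | ⟨h1, h2⟩
      · exact ⟨_, _, .inl ⟨rfl, rfl⟩, h1, h2⟩
      · exact ⟨_, _, .inr ⟨rfl, rfl⟩, h1, h2⟩
    have hbK : b ∈ K := by
      by_contra hbK
      exact hcK ((hab.mono (by simpa using ha.1) subset_rfl).mem_cut (by simpa using hbK))
    have hbT : r.ρ b ∉ T := fun h => hb ⟨hbK, h⟩
    have hne : r.ρ a ≠ r.ρ b := fun h => hbT (h ▸ ha.2)
    have h1 := r.incident_ρ hab ha.1 hne
    have h2 := r.incident_ρ hab.symm hbK hne.symm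
    have hadj : r.Adj M (r.ρ a) (r.ρ b) := ⟨c, hab.mono
      (r.singleton_subset_fill ha.1) (r.singleton_subset_fill hbK)⟩
    have key : ∀ D : Set Ω, RelClosed (r.Adj M) (T ∩ D) (D ∩ r.core) → r.ρ a ∈ D →
        M.u c ∈ M.regionBoundary R D := by
      intro D hD haD
      refine ⟨hcR, ⟨_, haD, h1⟩, _, fun hbD => ?_, h2⟩
      exact hD.2 _ ⟨ha.2, haD⟩ _ ⟨⟨hbD, r.ρ_mem_core hbK⟩, fun h => hbT h.1⟩ hadj
    exact (hTAB ha.2).imp (key A hA) (key B hB)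
  · right
    -- by parity there is a second edge at the same extra region, and the two form a cut
    have heven := M.even_u (r.fill T) (M.u c)
    obtain ⟨c', hc', hne⟩ : ∃ c', (c' ∈ M.cut (r.fill T) ∧ M.u c' = M.u c) ∧ c' ≠ c := by
      by_contra hcon
      push Not at hcon
      have : {d | ¬(M.s d ∈ r.fill T ↔ M.t d ∈ r.fill T) ∧ M.u d = M.u c} = {c} := by
        refine Set.Subset.antisymm (fun d hd => hcon d hd) ?_
        rintro d rfl
        exact ⟨hc, rfl⟩
      rw [this, Set.ncard_singleton] at heven
      exact absurd heven (by decide)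
    obtain ⟨Z, hZ⟩ := M.exact {c, c'} (even_ncard_pair hne.symm hc'.2.symm)
      (even_ncard_pair hne.symm (hR c c' hc'.2.symm hcR))
    rcases r.mem_cut_of_pair hc hc'.1 (Z := Z) hZ.symm with h | h
    · exact ⟨c, h, rfl⟩
    · exact ⟨c', h, hc'.2⟩

end LobeRetraction

variable [Finite Ω] [Finite C]

/-- A set `K` that is left by at most two edges of the medial graph is carved with small width by
means of a carving of the whole that sees few regions.  The induction reduces this to the lobes
of `K`; after each lobe has been attached to a neighbour, the pieces of the given carving are
divided into connected components. -/
theorem carved_of_width_le_two [Finite U] {R : Set U} {w : ℕ}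
    (hR : ∀ c c', M.u c = M.u c' → M.u c ∉ R → M.φ c = M.φ c')
    (hbase : ∀ x, M.width {x} ≤ 8)
    (h : Carved (fun S => (M.regionBoundary R S).ncard ≤ w) Set.univ) :
    ∀ n, ∀ K : Set Ω, K.ncard ≤ n → K.Nonempty → M.width K ≤ 2 →
      Carved (fun X => M.width X ≤ 8 * w + 8) K := by
  intro n
  induction n with
  | zero =>
    intro K hn hne
    rw [Nat.le_zero, Set.ncard_eq_zero] at hn
    exact absurd hn hne.ne_empty
  | succ n ih =>
    intro K hn hne hw
    by_cases hsplit : ∃ A B, Disjoint A B ∧ A ∪ B = K ∧ A.Nonempty ∧ B.Nonempty ∧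
        M.width A ≤ 2 ∧ M.width B ≤ 2
    · obtain ⟨A, B, hd, rfl, hA, hB, hwA, hwB⟩ := hsplit
      rw [Set.ncard_union_eq hd] at hn
      have h1 : 0 < A.ncard := (Set.ncard_pos).2 hA
      have h2 : 0 < B.ncard := (Set.ncard_pos).2 hB
      exact .union A B hd (ih A (by omega) hA hwA) (ih B (by omega) hB hwB) (by omega)
    obtain ⟨r⟩ := exists_lobeRetraction hw hsplit
    have hlobe : ∀ L, M.IsLobe K L → Carved (fun X => M.width X ≤ 8 * w + 8) L := by
      intro L hL
      have := Set.ncard_lt_ncard hL.1.1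
      exact ih L (by omega) hL.1.2.1 hL.1.2.2
    -- attach to `y` its lobes, which does not increase the width
    have hsingle : ∀ y ∈ r.core, Carved (fun X => M.width X ≤ 8 * w + 8) (r.fill {y}) := by
      intro y hy
      have key : ∀ 𝓛 : Set (Set Ω), 𝓛.Finite →
          (∀ L ∈ 𝓛, M.IsLobe K L ∧ ∃ c, M.Joins c L {y}) →
          M.width ({y} ∪ ⋃₀ 𝓛) ≤ 8 ∧
            Carved (fun X => M.width X ≤ 8 * w + 8) ({y} ∪ ⋃₀ 𝓛) := by
        intro 𝓛 hfin
        induction 𝓛, hfin using Set.Finite.induction_on with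
        | empty =>
          intro _
          simp only [Set.sUnion_empty, Set.union_empty]
          exact ⟨hbase y, .single y ((hbase y).trans (by omega))⟩
        | @insert L 𝓛 hL𝓛 _ ih𝓛 =>
          intro h𝓛
          obtain ⟨h1, h2⟩ := ih𝓛 fun L' hL' => h𝓛 L' (.inr hL')
          obtain ⟨hL, c, hc⟩ := h𝓛 L (.inl rfl)
          have hd : Disjoint ({y} ∪ ⋃₀ 𝓛) L := by
            rw [Set.disjoint_union_left, Set.disjoint_singleton_left,
              Set.disjoint_sUnion_left]
            refine ⟨hy.2 L hL, fun L' hL' => ?_⟩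
            rcases (h𝓛 L' (.inr hL')).1.eq_or_disjoint hsplit hL with rfl | h
            · exact absurd hL' hL𝓛
            · exact h.1
          have h3 := M.width_union_add_two_le hd
            (hc.symm.mono Set.subset_union_left subset_rfl)
          have h4 := hL.1.2.2
          have heq : {y} ∪ ⋃₀ (insert L 𝓛) = ({y} ∪ ⋃₀ 𝓛) ∪ L := by
            rw [Set.sUnion_insert, Set.union_assoc, Set.union_comm L]
          rw [heq]
          exact ⟨by omega, .union _ _ hd h2 (hlobe L hL) (by omega)⟩
      have h1 := (key {L | (M.IsLobe K L ∧ ∃ c, M.Joins c L {y}) ∧ L ⊆ r.fill {y}}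
        (Set.toFinite _) fun L hL => hL.1).2
      convert h1 using 1
      refine Set.Subset.antisymm ?_ ?_
      · intro x hx
        rcases r.eq_or_mem_lobe hx with rfl | ⟨L, hL, hxL, hLs, hc⟩
        · exact .inl rfl
        · exact .inr ⟨L, ⟨⟨hL, hc⟩, hLs⟩, hxL⟩
      · refine Set.union_subset ?_ (Set.sUnion_subset fun L hL => hL.2)
        rw [Set.singleton_subset_iff]
        exact r.mem_fill_of_mem (by simpa using hy) rfl
    have hgrow := good_of_carved (adj := r.Adj M) (fun h => LobeRetraction.Adj.symm r h)
      (Y := r.core) (good := fun T => Carved (fun X => M.width X ≤ 8 * w + 8) (r.fill T))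
      hsingle (fun T P A B hd hT hP hA hB hAB hc hconn hclA hclB => by
        have hne' : (T ∪ P).Nonempty := by
          obtain ⟨x, hx⟩ := hT.nonempty
          exact ⟨_, .inl hx.2⟩
        have h1 := r.width_fill_le hconn hne' hc
        have h2 := Set.ncard_le_ncard (r.image_cut_fill_subset hR hAB hclA hclB)
        have h3 := Set.ncard_union_le (M.regionBoundary R A ∪ M.regionBoundary R B)
          (M.u '' M.cut K)
        have h4 := Set.ncard_union_le (M.regionBoundary R A) (M.regionBoundary R B)
        have h5 : (M.u '' M.cut K).ncard ≤ 1 := by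
          rw [Set.ncard_le_one (Set.toFinite _)]
          rintro _ ⟨c, hc, rfl⟩ _ ⟨c', hc', rfl⟩
          exact u_eq_of_mem_cut hw hc hc'
        rw [r.fill_union] at h1 h2 ⊢
        exact .union _ _ (r.fill_disjoint hd) hT hP (by omega)) h
    have hfinal := hgrow r.core ?_ ?_ ?_
    · rwa [r.fill_core] at hfinal
    · obtain ⟨x, hx⟩ := hne
      exact ⟨_, r.ρ_mem_core hx⟩
    · intro A hA hneA hneB
      have hKc := conn_of_width_le_two hw
      obtain ⟨c, hc⟩ := hKc (r.fill A) (r.fill_subset A)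
        (hneA.mono fun y hy => r.mem_fill_of_mem hA hy)
        (by
          obtain ⟨y, hy, hyA⟩ := hneB
          refine ⟨y, hy.1, fun h => hyA ?_⟩
          rw [← r.fixed_of_mem_core hy]
          exact h.2)
      have key : ∀ a b, M.Joins c {a} {b} → a ∈ r.fill A → b ∈ K \ r.fill A →
          ∃ a ∈ A, ∃ b ∈ r.core \ A, r.Adj M a b := by
        intro a b hab ha hb
        refine ⟨_, ha.2, r.ρ b, ⟨r.ρ_mem_core hb.1, fun h => hb.2 ⟨hb.1, h⟩⟩, c, hab.mono
          (r.singleton_subset_fill ha.1) (r.singleton_subset_fill hb.1)⟩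
      rcases hc with ⟨h1, h2⟩ | ⟨h1, h2⟩
      · exact key _ _ (.inl ⟨rfl, rfl⟩) h1 h2
      · exact key _ _ (.inr ⟨rfl, rfl⟩) h1 h2
    · rw [Set.univ_inter]
      exact ⟨subset_rfl, by simp⟩

/-- The medial graph of a sphere map is carved with small width by means of a carving that sees
few regions of the first colour. -/
theorem carved_width [Finite U] {R : Set U} {w : ℕ}
    (hR : ∀ c c', M.u c = M.u c' → M.u c ∉ R → M.φ c = M.φ c')
    (hbase : ∀ x, M.width {x} ≤ 8)
    (h : Carved (fun S => (M.regionBoundary R S).ncard ≤ w) Set.univ) :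
    Carved (fun X => M.width X ≤ 8 * w + 8) Set.univ :=
  carved_of_width_le_two hR hbase h _ Set.univ le_rfl h.nonempty (by simp [width, cut])

end Retraction
end SphereMap

/-! ### Closed curves on the sphere are cuts -/

/-- A permutation changes sides an even number of times. -/
lemma even_ncard_perm {α : Type*} [Finite α] (σ : Equiv.Perm α) (p Q : α → Prop)
    (hQ : ∀ c, Q (σ c) ↔ Q c) : Even {c | ¬(p c ↔ p (σ c)) ∧ Q c}.ncard := by
  let A : Set α := {c | Q c ∧ p c}
  let B : Set α := {c | Q c ∧ p (σ c)}
  have h1 : A.ncard = B.ncard := by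
    have : σ '' B = A := by
      ext c
      constructor
      · rintro ⟨d, hd, rfl⟩
        exact ⟨(hQ d).2 hd.1, hd.2⟩
      · intro hc
        refine ⟨σ.symm c, ⟨(hQ _).1 ?_, ?_⟩, by simp⟩
        · simpa using hc.1
        · simpa using hc.2
    rw [← this, Set.ncard_image_of_injective _ σ.injective]
  have h2 : {c | ¬(p c ↔ p (σ c)) ∧ Q c} = (A \ B) ∪ (B \ A) := by
    ext c
    simp only [A, B, Set.mem_ofPred_eq, Set.mem_union, Set.mem_sdiff]
    tauto
  have h3 : Disjoint (A \ B) (B \ A) := Set.disjoint_left.2 fun x hx hx' => hx'.2 hx.1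
  rw [h2, Set.ncard_union_eq h3]
  have h4 := Set.ncard_inter_add_ncard_sdiff_eq_ncard A B
  have h5 := Set.ncard_inter_add_ncard_sdiff_eq_ncard B A
  rw [Set.inter_comm] at h5
  exact ⟨(A \ B).ncard, by omega⟩

lemma zmod_two_eq_one_iff (a b : ZMod 2) : a + b = 1 ↔ ¬(a = 1 ↔ b = 1) := by
  revert a b; decide

lemma zmod_two_eq_zero_of_ne_one {a : ZMod 2} (h : a ≠ 1) : a = 0 := by
  revert a; decide

/-- Euler's formula turns the easy inclusion, that cuts are closed curves, into an equality: both
are vector spaces over the field with two elements, and their dimensions agree.  The map `sec`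
selects one region in every component of the graph of regions. -/
lemma exact_of_card {Ω C U F Q : Type*} [Finite Ω] [Finite C] [Finite U] [Finite F] [Finite Q]
    (s t : C → Ω) (u : C → U) (φ : C → F)
    (conn : ∀ X : Set Ω, (∀ c, s c ∈ X ↔ t c ∈ X) → X = ∅ ∨ X = Set.univ)
    (even_u : ∀ (X : Set Ω) l, Even {c | ¬(s c ∈ X ↔ t c ∈ X) ∧ u c = l}.ncard)
    (even_φ : ∀ (X : Set Ω) l, Even {c | ¬(s c ∈ X ↔ t c ∈ X) ∧ φ c = l}.ncard)
    (sec : Q → U ⊕ F)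
    (hsec : ∀ z : U ⊕ F → ZMod 2, (∀ c, z (.inl (u c)) = z (.inr (φ c))) →
      (∀ q, z (sec q) = 0) → z = 0)
    (hcard : Nat.card C + Nat.card Q + 1 ≤ Nat.card Ω + Nat.card U + Nat.card F)
    (D : Set C) (hDu : ∀ l, Even {c | c ∈ D ∧ u c = l}.ncard)
    (hDφ : ∀ l, Even {c | c ∈ D ∧ φ c = l}.ncard) :
    ∃ X : Set Ω, D = {c | ¬(s c ∈ X ↔ t c ∈ X)} := by
  classical
  have := Fintype.ofFinite Ω
  have := Fintype.ofFinite C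
  have := Fintype.ofFinite U
  have := Fintype.ofFinite F
  have := Fintype.ofFinite Q
  let A : Matrix (U ⊕ F) C (ZMod 2) :=
    Matrix.of fun l c =>
    l.elim (fun l => if u c = l then 1 else 0) (fun l => if φ c = l then 1 else 0)
  let δ : (Ω → ZMod 2) →ₗ[ZMod 2] (C → ZMod 2) :=
    LinearMap.funLeft (ZMod 2) (ZMod 2) s + LinearMap.funLeft (ZMod 2) (ZMod 2) t
  have hδ : ∀ x c, δ x c = x (s c) + x (t c) := fun x c => rfl
  -- a set of edges that is even at every region is a vector in the kernel of `A`
  have hA : ∀ y : C → ZMod 2, (∀ l, Even {c | y c = 1 ∧ u c = l}.ncard) →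
      (∀ l, Even {c | y c = 1 ∧ φ c = l}.ncard) → y ∈ LinearMap.ker A.mulVecLin := by
    intro y h1 h2
    rw [LinearMap.mem_ker]
    ext l
    have h3 : A.mulVecLin y l = 0 := by
      rcases l with l | l
      · have h4 : A.mulVecLin y (.inl l) = ∑ c, if u c = l then y c else 0 := by
          simp [A, Matrix.mulVec, dotProduct]
        rw [h4, SphereMap.sum_zmod_two_eq, ZMod.natCast_eq_zero_iff_even]
        exact h1 l
      · have h4 : A.mulVecLin y (.inr l) = ∑ c, if φ c = l then y c else 0 := by
          simp [A, Matrix.mulVec, dotProduct]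
        rw [h4, SphereMap.sum_zmod_two_eq, ZMod.natCast_eq_zero_iff_even]
        exact h2 l
    exact h3
  have hle : LinearMap.range δ ≤ LinearMap.ker A.mulVecLin := by
    rintro _ ⟨x, rfl⟩
    refine hA _ (fun l => ?_) (fun l => ?_)
    · simp only [hδ, zmod_two_eq_one_iff]
      exact even_u {a | x a = 1} l
    · simp only [hδ, zmod_two_eq_one_iff]
      exact even_φ {a | x a = 1} l
  have h1 := LinearMap.finrank_range_add_finrank_ker A.mulVecLin
  have h2 := LinearMap.finrank_range_add_finrank_ker A.transpose.mulVecLin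
  have h3 := LinearMap.finrank_range_add_finrank_ker δ
  have h4 : Module.finrank (ZMod 2) (LinearMap.range A.mulVecLin)
      = Module.finrank (ZMod 2) (LinearMap.range A.transpose.mulVecLin) :=
    (Matrix.rank_transpose A).symm
  have h5 : Module.finrank (ZMod 2) (LinearMap.ker A.transpose.mulVecLin) ≤ Nat.card Q := by
    have hinj : Function.Injective ((LinearMap.funLeft (ZMod 2) (ZMod 2) sec).comp
        (LinearMap.ker A.transpose.mulVecLin).subtype) := by
      rw [← LinearMap.ker_eq_bot, LinearMap.ker_eq_bot']
      rintro ⟨z, hz⟩ hz0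
      rw [Submodule.mk_eq_zero]
      refine hsec z (fun c => ?_) fun q => congrFun hz0 q
      have h6 : A.transpose.mulVecLin z c = 0 := by
        rw [LinearMap.mem_ker.1 hz]; rfl
      have h7 : A.transpose.mulVecLin z c = z (.inl (u c)) + z (.inr (φ c)) := by
        simp [A, Matrix.vecMul, dotProduct]
      rw [h7] at h6
      rwa [CharTwo.add_eq_zero] at h6
    have := LinearMap.finrank_le_finrank_of_injective hinj
    rwa [Module.finrank_fintype_fun_eq_card, ← Nat.card_eq_fintype_card] at this
  have h6 : Module.finrank (ZMod 2) (LinearMap.ker δ) ≤ 1 := by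
    rcases isEmpty_or_nonempty Ω with hΩ | ⟨⟨a⟩⟩
    · refine (Submodule.finrank_le _).trans ?_
      rw [Module.finrank_fintype_fun_eq_card]
      simp
    · have hinj : Function.Injective ((LinearMap.proj (R := ZMod 2) (φ := fun _ => ZMod 2) a).comp
          (LinearMap.ker δ).subtype) := by
        rw [← LinearMap.ker_eq_bot, LinearMap.ker_eq_bot']
        rintro ⟨x, hx⟩ hx0
        have hx0 : x a = 0 := hx0
        rw [Submodule.mk_eq_zero]
        have hc := conn {b | x b = 1} (fun c => by
          have : δ x c = 0 := by rw [LinearMap.mem_ker.1 hx]; rfl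
          rw [hδ, CharTwo.add_eq_zero] at this
          simp [this])
        rcases hc with h | h
        · ext b
          refine zmod_two_eq_zero_of_ne_one fun hb => ?_
          exact (h ▸ hb : b ∈ (∅ : Set Ω))
        · have : a ∈ {b | x b = 1} := h ▸ Set.mem_univ a
          rw [Set.mem_ofPred_eq, hx0] at this
          exact absurd this (by decide)
      have := LinearMap.finrank_le_finrank_of_injective hinj
      simpa using this
  rw [Module.finrank_fintype_fun_eq_card, ← Nat.card_eq_fintype_card] at h1 h2 h3
  rw [Nat.card_sum] at h2
  have heq : LinearMap.range δ = LinearMap.ker A.mulVecLin :=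
    Submodule.eq_of_le_of_finrank_le hle (by omega)
  let y : C → ZMod 2 := fun c => if c ∈ D then 1 else 0
  have hy1 : ∀ c, y c = 1 ↔ c ∈ D := fun c => by simp [y]
  have hy : y ∈ LinearMap.range δ := by
    rw [heq]
    refine hA y (fun l => ?_) (fun l => ?_)
    · simpa only [hy1] using hDu l
    · simpa only [hy1] using hDφ l
  obtain ⟨x, hx⟩ := hy
  refine ⟨{a | x a = 1}, ?_⟩
  ext c
  rw [← hy1, ← hx, hδ, zmod_two_eq_one_iff]
  exact Iff.rfl

/-! ### Corners, boundary walks and faces -/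

section Corners

variable {V : Type*} {G : SimpleGraph V}

lemma exists_corner (v : V) : ∃ c : Corner G, c.vertex = v := by
  by_cases h : G.IsIsolated v
  · exact ⟨.inr ⟨v, h⟩, rfl⟩
  · have h : ¬ ∀ w, ¬ G.Adj v w := h
    push Not at h
    obtain ⟨w, hw⟩ := h
    exact ⟨.inl ⟨(v, w), hw⟩, rfl⟩

namespace RotationSystem

variable (R : RotationSystem G)

@[simp] lemma nextCorner_inl (d : G.Dart) : R.nextCorner (.inl d) = .inl (R.rot d.symm) := rfl

lemma boundary_nextCorner (c : Corner G) : R.boundary (R.nextCorner c) = R.boundary c :=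
  Quotient.sound (s := Equiv.Perm.SameCycle.setoid R.nextCorner)
    (Equiv.Perm.sameCycle_apply_left.2 (Equiv.Perm.SameCycle.refl _ _))

lemma exists_boundary (b : R.Boundary) : ∃ c, R.boundary c = b := Quotient.exists_rep b

@[simp] lemma component_boundary (c : Corner G) :
    R.component (R.boundary c) = G.connectedComponentMk c.vertex := rfl

/-- The rotation, extended to the corners at isolated vertices. -/
def turn : Equiv.Perm (Corner G) := Equiv.sumCongr R.rot (Equiv.refl _)

lemma vertex_turn (c : Corner G) : (R.turn c).vertex = c.vertex := by
  rcases c with d | v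
  · exact R.rot_fst d
  · rfl

/-- A property that is passed on by the rotation holds at all corners of a vertex or at none. -/
lemma iff_of_vertex_eq {r : Corner G → Prop} (h : ∀ c, r (R.turn c) ↔ r c) {c c' : Corner G}
    (hv : c.vertex = c'.vertex) : r c ↔ r c' := by
  rcases c with d | v <;> rcases c' with d' | v'
  · obtain ⟨i, rfl⟩ := R.rot_sameCycle d d' hv
    have h' : ∀ d, r (.inl (R.rot d)) ↔ r (.inl d) := fun d => h (.inl d)
    induction i with
    | zero => simp
    | succ n ih =>
      rw [add_comm, zpow_add, zpow_one, Equiv.Perm.mul_apply, h']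
      exact ih (by rw [hv, add_comm, zpow_add, zpow_one, Equiv.Perm.mul_apply]; exact R.rot_fst _)
    | pred n ih =>
      rw [← h' ((R.rot ^ (-(n : ℤ) - 1)) d), ← Equiv.Perm.mul_apply, ← zpow_one_add]
      rw [show (1 + (-(n : ℤ) - 1)) = -(n : ℤ) by ring]
      refine ih ?_
      rw [hv]
      change ((R.rot ^ (-(n : ℤ) - 1)) d).fst = ((R.rot ^ (-(n : ℤ))) d).fst
      rw [← R.rot_fst, ← Equiv.Perm.mul_apply, ← zpow_one_add]
      rw [show (1 + (-(n : ℤ) - 1)) = -(n : ℤ) by ring]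
  · have hv : d.fst = v'.1 := hv
    exact absurd (hv ▸ d.adj) (v'.2 _)
  · have hv : v.1 = d'.fst := hv
    exact absurd (hv.symm ▸ d'.adj) (v.2 _)
  · have hv : v = v' := Subtype.ext hv
    rw [hv]

/-- A property of corners that depends only on the vertex and is passed on along edges holds in
all of a connected component or nowhere in it. -/
lemma iff_of_component_eq {r : Corner G → Prop}
    (hv : ∀ c c', c.vertex = c'.vertex → (r c ↔ r c'))
    (he : ∀ d : G.Dart, r (.inl d) ↔ r (.inl d.symm)) {c c' : Corner G}
    (h : G.connectedComponentMk c.vertex = G.connectedComponentMk c'.vertex) : r c ↔ r c' := by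
  replace h := SimpleGraph.ConnectedComponent.exact h
  generalize hw : c'.vertex = w at h
  rw [SimpleGraph.reachable_iff_reflTransGen] at h
  induction h generalizing c' with
  | refl => exact hv _ _ hw.symm
  | @tail x y _ hxy ih =>
    obtain ⟨e, rfl⟩ := exists_corner (G := G) x
    refine (ih (c' := e) rfl).trans ?_
    let d : G.Dart := ⟨(e.vertex, y), hxy⟩
    exact (hv e (.inl d) rfl).trans ((he d).trans (hv _ _ hw.symm))

end RotationSystem

lemma iff_of_sameCycle {α : Type*} {σ : Equiv.Perm α} {r : α → Prop} (h : ∀ c, r (σ c) ↔ r c)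
    {c c' : α} (hs : σ.SameCycle c c') : r c ↔ r c' := by
  obtain ⟨i, rfl⟩ := hs
  induction i with
  | zero => simp
  | succ n ih => rw [ih, add_comm, zpow_add, zpow_one, Equiv.Perm.mul_apply, h]
  | pred n ih =>
    rw [ih, ← h ((σ ^ (-(n : ℤ) - 1)) c), ← Equiv.Perm.mul_apply, ← zpow_one_add]
    rw [show (1 + (-(n : ℤ) - 1)) = -(n : ℤ) by ring]

namespace PlaneEmbedding

variable (P : PlaneEmbedding G)

/-- A property of boundary walks that is constant on components and on faces is constant, since
the incidence graph of components and faces is connected. -/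
lemma iff_of_boundary {r : P.Boundary → Prop}
    (hc : ∀ b b', P.component b = P.component b' → (r b ↔ r b'))
    (hf : ∀ b b', P.face b = P.face b' → (r b ↔ r b')) (b b' : P.Boundary) : r b ↔ r b' := by
  suffices key : ∀ b b', r b → r b' from ⟨key b b', key b' b⟩
  intro b b' hb
  let U : Set (G.ConnectedComponent ⊕ Quotient P.faceSetoid) :=
    {x | Sum.elim (fun K => ∃ b, P.component b = K ∧ r b) (fun f => ∃ b, P.face b = f ∧ r b) x}
  have hU : .inl (P.component b') ∈ U := by
    refine mem_of_reachable ?_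
      (P.incidence_isTree.1.preconnected (.inl (P.component b)) (.inl (P.component b')))
      (show .inl (P.component b) ∈ U from ⟨b, rfl, hb⟩)
    intro x hx y hxy
    rw [SimpleGraph.fromRel_adj] at hxy
    rcases hxy.2 with ⟨a, rfl, rfl⟩ | ⟨a, rfl, rfl⟩
    · obtain ⟨a', ha', hr⟩ := hx
      exact ⟨a, rfl, (hc a a' ha'.symm).2 hr⟩
    · obtain ⟨a', ha', hr⟩ := hx
      exact ⟨a, rfl, (hf a a' ha'.symm).2 hr⟩
  obtain ⟨a, ha, hr⟩ := hU
  exact (hc a b' ha).1 hr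

section Count

instance [Finite V] : Finite G.Dart :=
  Finite.of_injective (fun d : G.Dart => d.toProd) SimpleGraph.Dart.ext

instance [Finite V] : Finite P.Boundary :=
  inferInstanceAs (Finite (Quotient _))

instance [Finite V] : Finite P.Face :=
  inferInstanceAs (Finite (Quotient _))

lemma sum_ncard_fiber {α β : Type*} [Finite α] [Fintype β] (f : α → β) :
    ∑ b, {a | f a = b}.ncard = Nat.card α := by
  classical
  have := Fintype.ofFinite α
  rw [Nat.card_eq_fintype_card, ← Finset.card_univ,
    Finset.card_eq_sum_card_fiberwise (f := f) (t := Finset.univ) (by simp)]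
  refine Finset.sum_congr rfl fun b _ => ?_
  rw [Set.ncard_eq_toFinset_card']
  congr 1
  ext a
  simp

/-- The boundary walks are edges of the incidence tree of components and faces. -/
lemma card_boundary_add_one_le [Finite V] :
    Nat.card P.Boundary + 1 ≤ Nat.card G.ConnectedComponent + Nat.card P.Face := by
  classical
  have := Fintype.ofFinite V
  have h1 : Finite (G.ConnectedComponent ⊕ Quotient P.faceSetoid) := inferInstance
  have := Fintype.ofFinite (G.ConnectedComponent ⊕ Quotient P.faceSetoid)
  have hT := P.incidence_isTree
  generalize hTe : SimpleGraph.fromRel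
    (fun x y : G.ConnectedComponent ⊕ Quotient P.faceSetoid =>
      ∃ b, x = Sum.inl (P.component b) ∧ y = Sum.inr (Quotient.mk P.faceSetoid b)) = T at hT
  have hcard := hT.card_edgeFinset
  rw [SimpleGraph.edgeFinset_card, ← Nat.card_eq_fintype_card, ← Nat.card_eq_fintype_card,
    Nat.card_sum] at hcard
  have hle : Nat.card P.Boundary ≤ Nat.card T.edgeSet := by
    refine Nat.card_le_card_of_injective (fun b => ⟨s(.inl (P.component b),
      .inr (Quotient.mk P.faceSetoid b)), ?_⟩) ?_
    · rw [SimpleGraph.mem_edgeSet, ← hTe, SimpleGraph.fromRel_adj]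
      exact ⟨by simp, .inl ⟨b, rfl, rfl⟩⟩
    · intro b b' hb
      simp only [Subtype.mk.injEq, Sym2.eq_iff, Sum.inl.injEq, Sum.inr.injEq, reduceCtorEq,
        and_self, or_false] at hb
      exact P.boundary_unique b b' hb.1 (Quotient.exact hb.2)
  change _ ≤ _ + Nat.card (Quotient P.faceSetoid)
  omega

/-- Euler's formula, summed over the components. -/
lemma card_euler [Finite V] :
    Nat.card V + Nat.card P.Boundary
      = Nat.card G.edgeSet + 2 * Nat.card G.ConnectedComponent := by
  classical
  have := Fintype.ofFinite V
  have : Fintype G.ConnectedComponent := Fintype.ofFinite _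
  have h := Finset.sum_congr (rfl : (Finset.univ : Finset G.ConnectedComponent) = _)
    fun K _ => P.euler K
  rw [Finset.sum_add_distrib, Finset.sum_add_distrib] at h
  have h1 : ∑ K : G.ConnectedComponent, K.supp.ncard = Nat.card V :=
    sum_ncard_fiber (fun v => G.connectedComponentMk v)
  have h2 := sum_ncard_fiber P.component
  have h3 : ∑ K : G.ConnectedComponent, {e ∈ G.edgeSet | ∀ v ∈ e, v ∈ K.supp}.ncard
      = Nat.card G.edgeSet := by
    rw [← sum_ncard_fiber (fun e : G.edgeSet => G.connectedComponentMk e.1.out.1)]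
    refine Finset.sum_congr rfl fun K _ => ?_
    rw [← Set.ncard_image_of_injective _ Subtype.val_injective]
    congr 1
    ext e
    simp only [Set.mem_ofPred_eq, Set.mem_image, Subtype.exists, exists_and_right,
      exists_eq_right]
    constructor
    · rintro ⟨he, h⟩
      exact ⟨he, h _ (Sym2.out_fst_mem e)⟩
    · rintro ⟨he, h⟩
      refine ⟨he, fun v hv => ?_⟩
      rw [SimpleGraph.ConnectedComponent.mem_supp_iff, ← h]
      have h4 : e = s(e.out.1, e.out.2) := e.out_eq.symm
      rw [h4, SimpleGraph.mem_edgeSet] at he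
      rw [h4, Sym2.mem_iff] at hv
      rcases hv with rfl | hv
      · rfl
      · rw [hv]
        exact SimpleGraph.ConnectedComponent.sound he.symm.reachable
  rw [h1, h2, h3] at h
  simpa [mul_comm, Nat.card_eq_fintype_card] using h

lemma card_corner [Finite V] :
    Nat.card (Corner G) = 2 * Nat.card G.edgeSet + Nat.card {v : V // G.IsIsolated v} := by
  classical
  have := Fintype.ofFinite V
  rw [Corner, Nat.card_sum, Nat.card_eq_fintype_card (α := G.Dart),
    SimpleGraph.dart_card_eq_twice_card_edges, SimpleGraph.edgeFinset_card,
    ← Nat.card_eq_fintype_card]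

end Count

end PlaneEmbedding
end Corners

/-! ### The sphere map of a plane graph -/

section Sphere

variable {V : Type*} {G : SimpleGraph V}

/-- The edge of a corner, or the isolated vertex at which it lies. -/
def Corner.element : Corner G → G.edgeSet ⊕ {v : V // G.IsIsolated v}
  | Sum.inl d => Sum.inl ⟨d.edge, d.edge_mem⟩
  | Sum.inr v => Sum.inr v

lemma RotationSystem.element_nextCorner_symm (R : RotationSystem G) (c : Corner G) :
    (R.nextCorner.symm c).element = (R.turn.symm c).element := by
  rcases c with d | v
  · have h1 : R.nextCorner.symm (.inl d) = .inl (R.rot.symm d).symm := by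
      rw [Equiv.symm_apply_eq]; simp
    have h2 : R.turn.symm (.inl d) = .inl (R.rot.symm d) := rfl
    rw [h1, h2]
    simp [Corner.element]
  · rfl

lemma RotationSystem.vertex_turn_symm (R : RotationSystem G) (c : Corner G) :
    (R.turn.symm c).vertex = c.vertex := by
  rw [← R.vertex_turn, Equiv.apply_symm_apply]

variable (P : PlaneEmbedding G)

/-- The elements of the sphere map of a plane graph: the edges, the isolated vertices, and for
every boundary walk a point in the face that it bounds. -/
abbrev Element : Type _ := (G.edgeSet ⊕ {v : V // G.IsIsolated v}) ⊕ P.Boundary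

/-- The adjacencies in the sphere map of a plane graph: consecutive elements around a vertex, two
parallel ones between the point of a boundary walk and some element of the walk, and the cycles
on the points of the walks that bound the same face. -/
abbrev Adjacency : Type _ := Corner G ⊕ (P.Boundary × Bool ⊕ P.Boundary)

variable {P} {k : ℕ} (X : EnhancementChoice P k)

/-- One end of an adjacency. -/
def sphereS : Adjacency P → Element P
  | .inl c => .inl c.element
  | .inr (.inl b) => .inr b.1
  | .inr (.inr b) => .inr b

/-- The other end of an adjacency. -/
def sphereT : Adjacency P → Element P
  | .inl c => .inl (P.nextCorner.symm c).element
  | .inr (.inl b) => .inl (X.start b.1).1.element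
  | .inr (.inr b) => .inr (X.order b)

/-- The region of the first colour: the vertex of a corner, and one extra region for every
boundary walk and every face. -/
def sphereU : Adjacency P → V ⊕ (P.Boundary ⊕ P.Face)
  | .inl c => .inl c.vertex
  | .inr (.inl b) => .inr (.inl b.1)
  | .inr (.inr b) => .inr (.inr (P.face b))

/-- The region of the second colour: the boundary walk of a corner, and one extra region for every
boundary walk and every face. -/
def sphereF : Adjacency P → P.Boundary ⊕ (P.Boundary ⊕ P.Face)
  | .inl c => .inl (P.boundary c)
  | .inr (.inl b) => .inr (.inl b.1)
  | .inr (.inr b) => .inr (.inr (P.face b))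

/-- The elements around a vertex hang together, those of the two ends of an edge share the edge,
and the points of the boundary walks link the components of the graph through the faces. -/
lemma sphere_conn (S : Set (Element P)) (h : ∀ c, sphereS c ∈ S ↔ sphereT X c ∈ S) :
    S = ∅ ∨ S = Set.univ := by
  have h1 : ∀ c : Corner G, Sum.inl (P.turn c).element ∈ S ↔ Sum.inl c.element ∈ S := by
    intro c
    have := h (.inl (P.turn c))
    change _ ↔ Sum.inl (P.nextCorner.symm (P.turn c)).element ∈ S at this
    rwa [P.element_nextCorner_symm, Equiv.symm_apply_apply] at this
  have h2 : ∀ c c' : Corner G, G.connectedComponentMk c.vertex = G.connectedComponentMk c'.vertex →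
      (Sum.inl c.element ∈ S ↔ Sum.inl c'.element ∈ S) := fun c c' hcc =>
    RotationSystem.iff_of_component_eq (r := fun c => Sum.inl c.element ∈ S)
      (fun c c' hv => P.iff_of_vertex_eq (r := fun c => Sum.inl c.element ∈ S) h1 hv)
      (fun d => by simp [Corner.element]) hcc
  have h3 : ∀ b, Sum.inr b ∈ S ↔ Sum.inl (X.start b).1.element ∈ S := fun b =>
    h (.inr (.inl (b, true)))
  have h4 : ∀ b b' : P.Boundary, Sum.inr b ∈ S ↔ Sum.inr b' ∈ S := by
    refine P.iff_of_boundary (fun b b' hb => ?_) fun b b' hb => ?_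
    · rw [h3, h3]
      apply h2
      rw [← P.component_boundary, ← P.component_boundary, X.start_boundary, X.start_boundary, hb]
    · exact iff_of_sameCycle (r := fun b => Sum.inr b ∈ S) (fun b => (h (.inr (.inr b))).symm) (X.order_sameCycle b b' hb)
  have h5 : ∀ c : Corner G, Sum.inl c.element ∈ S ↔ Sum.inr (P.boundary c) ∈ S := by
    intro c
    rw [h3]
    apply h2
    rw [← P.component_boundary, ← P.component_boundary, X.start_boundary]
  have h6 : ∀ x : Element P, ∃ b, x ∈ S ↔ Sum.inr b ∈ S := by
    rintro ((⟨e, he⟩ | v) | b)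
    · induction e with | h u w =>
      exact ⟨_, h5 (.inl ⟨(u, w), he⟩)⟩
    · exact ⟨_, h5 (.inr v)⟩
    · exact ⟨b, Iff.rfl⟩
  have h7 : ∀ x y : Element P, x ∈ S → y ∈ S := by
    intro x y hx
    obtain ⟨b, hb⟩ := h6 x
    obtain ⟨b', hb'⟩ := h6 y
    exact hb'.2 ((h4 b b').1 (hb.1 hx))
  rcases S.eq_empty_or_nonempty with h | ⟨x, hx⟩
  · exact .inl h
  · exact .inr (Set.eq_univ_of_forall fun y => h7 x y hx)

variable [Finite V]

/-- At the extra regions a cut is even: the two parallel adjacencies at the point of a boundary walk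
are cut together, and those between the points in a face form a cycle. -/
lemma even_ncard_inr (S : Set (Element P)) (l : P.Boundary ⊕ P.Face)
    (q : P.Boundary × Bool ⊕ P.Boundary → P.Boundary ⊕ P.Face)
    (hq : ∀ b, q (.inl b) = .inl b.1) (hq' : ∀ b, q (.inr b) = .inr (P.face b)) :
    Even {c | ¬(sphereS (.inr c) ∈ S ↔ sphereT X (.inr c) ∈ S) ∧ q c = l}.ncard := by
  rcases l with b | f
  · by_cases h2 : sphereS (.inr (.inl (b, true))) ∈ S ↔ sphereT X (.inr (.inl (b, true))) ∈ S
    · suffices h : {c | ¬(sphereS (.inr c) ∈ S ↔ sphereT X (.inr c) ∈ S) ∧ q c = .inl b} = ∅ by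
        simp [h]
      ext (⟨a, i⟩ | a)
      · simp only [Set.mem_ofPred_eq, hq, Sum.inl.injEq, Set.mem_empty_iff_false, iff_false]
        rintro ⟨h1, rfl⟩
        exact h1 h2
      · simp [hq']
    · have h : {c | ¬(sphereS (.inr c) ∈ S ↔ sphereT X (.inr c) ∈ S) ∧ q c = .inl b}
          = {.inl (b, true), .inl (b, false)} := by
        ext (⟨a, i⟩ | a)
        · simp only [Set.mem_ofPred_eq, hq, Sum.inl.injEq]
          constructor
          · rintro ⟨h1, rfl⟩
            cases i <;> simp
          · rintro (h1 | h1) <;>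
            · cases h1
              exact ⟨h2, rfl⟩
        · simp [hq']
      rw [h, Set.ncard_pair (by simp)]
      exact even_two
  · have h : {c | ¬(sphereS (.inr c) ∈ S ↔ sphereT X (.inr c) ∈ S) ∧ q c = .inr f}
        = Sum.inr '' {b | ¬(Sum.inr b ∈ S ↔ Sum.inr (X.order b) ∈ S) ∧ P.face b = f} := by
      ext (⟨a, i⟩ | a)
      · simp [hq]
      · simp [hq', sphereS, sphereT]
    rw [h, Set.ncard_image_of_injective _ Sum.inr_injective]
    exact even_ncard_perm X.order _ _ fun b => by rw [X.order_face]

/-- Around a vertex and along a boundary walk the elements form a cycle, which is cut an even number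
of times. -/
lemma even_ncard_inl (S : Set (Element P)) (σ : Equiv.Perm (Corner G))
    (hσ : ∀ c, (P.nextCorner.symm c).element = (σ.symm c).element) (q : Corner G → Prop)
    (hq : ∀ c, q (σ c) ↔ q c) :
    Even {c : Corner G | ¬(sphereS (.inl c) ∈ S ↔ sphereT X (.inl c) ∈ S) ∧ q c}.ncard := by
  have := even_ncard_perm σ.symm (fun c => (Sum.inl c.element : Element P) ∈ S) q
    (fun c => by rw [← hq, Equiv.apply_symm_apply])
  simpa only [sphereS, sphereT, hσ] using this

lemma sphere_even_u (S : Set (Element P)) (l) :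
    Even {c | ¬(sphereS c ∈ S ↔ sphereT X c ∈ S) ∧ sphereU c = l}.ncard := by
  rcases l with v | l
  · have h : {c | ¬(sphereS c ∈ S ↔ sphereT X c ∈ S) ∧ sphereU c = .inl v} = Sum.inl ''
        {c : Corner G | ¬(sphereS (.inl c) ∈ S ↔ sphereT X (.inl c) ∈ S) ∧ c.vertex = v} := by
      ext (c | b | b) <;> simp [sphereU]
    rw [h, Set.ncard_image_of_injective _ Sum.inl_injective]
    exact even_ncard_inl X S P.turn P.element_nextCorner_symm _ fun c => by rw [P.vertex_turn]
  · have h : {c | ¬(sphereS c ∈ S ↔ sphereT X c ∈ S) ∧ sphereU c = .inr l} = Sum.inr ''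
        {c | ¬(sphereS (.inr c) ∈ S ↔ sphereT X (.inr c) ∈ S) ∧
          Sum.elim (fun b => .inl b.1) (fun b => .inr (P.face b)) c = l} := by
      ext (c | b | b) <;> simp [sphereU]
    rw [h, Set.ncard_image_of_injective _ Sum.inr_injective]
    exact even_ncard_inr X S l _ (fun _ => rfl) fun _ => rfl

lemma sphere_even_F (S : Set (Element P)) (l) :
    Even {c | ¬(sphereS c ∈ S ↔ sphereT X c ∈ S) ∧ sphereF c = l}.ncard := by
  rcases l with v | l
  · have h : {c | ¬(sphereS c ∈ S ↔ sphereT X c ∈ S) ∧ sphereF c = .inl v} = Sum.inl ''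
        {c : Corner G | ¬(sphereS (.inl c) ∈ S ↔ sphereT X (.inl c) ∈ S) ∧
          P.boundary c = v} := by
      ext (c | b | b) <;> simp [sphereF]
    rw [h, Set.ncard_image_of_injective _ Sum.inl_injective]
    exact even_ncard_inl X S P.nextCorner (fun _ => rfl) _ fun c => by
      rw [P.boundary_nextCorner]
  · have h : {c | ¬(sphereS c ∈ S ↔ sphereT X c ∈ S) ∧ sphereF c = .inr l} = Sum.inr ''
        {c | ¬(sphereS (.inr c) ∈ S ↔ sphereT X (.inr c) ∈ S) ∧
          Sum.elim (fun b => .inl b.1) (fun b => .inr (P.face b)) c = l} := by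
      ext (c | b | b) <;> simp [sphereF]
    rw [h, Set.ncard_image_of_injective _ Sum.inr_injective]
    exact even_ncard_inr X S l _ (fun _ => rfl) fun _ => rfl

/-- One region in every component of the graph of regions. -/
noncomputable def sphereSec : G.ConnectedComponent ⊕ (P.Boundary ⊕ P.Face) →
    (V ⊕ (P.Boundary ⊕ P.Face)) ⊕ (P.Boundary ⊕ (P.Boundary ⊕ P.Face))
  | .inl K => .inl (.inl K.out)
  | .inr l => .inl (.inr l)

omit [Finite V] in
/-- The graph of regions has exactly one component for each component of `G`, and one for each extra
region. -/
lemma sphereSec_spec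
    (z : (V ⊕ (P.Boundary ⊕ P.Face)) ⊕ (P.Boundary ⊕ (P.Boundary ⊕ P.Face)) → ZMod 2)
    (hz : ∀ c : Adjacency P, z (.inl (sphereU c)) = z (.inr (sphereF c)))
    (h0 : ∀ q, z (sphereSec q) = 0) : z = 0 := by
  have h1 : ∀ c : Corner G, z (.inl (.inl c.vertex)) = z (.inr (.inl (P.boundary c))) :=
    fun c => hz (.inl c)
  have h2 : ∀ v, z (.inl (.inl v)) = 0 := by
    intro v
    obtain ⟨c, hc⟩ := exists_corner (G := G) v
    obtain ⟨c', hc'⟩ := exists_corner (G := G) (G.connectedComponentMk v).out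
    rw [← hc]
    refine (RotationSystem.iff_of_component_eq (r := fun c => z (.inl (.inl c.vertex)) = 0)
      (c := c) (c' := c') (fun c c' h => by rw [h]) (fun d => ?_) ?_).2 ?_
    · rw [h1, ← P.boundary_nextCorner, ← h1]
      have : (P.nextCorner (.inl d)).vertex = Corner.vertex (.inl d.symm) := P.rot_fst _
      rw [this]
    · rw [hc, hc']
      exact (Quot.out_eq (G.connectedComponentMk v)).symm
    · rw [hc']
      exact h0 (.inl _)
  ext ((v | l) | b | b | f)
  · exact h2 v
  · exact h0 (.inr l)
  · obtain ⟨c, rfl⟩ := P.exists_boundary b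
    rw [← h1, h2]
    rfl
  · exact (hz (.inr (.inl (b, true)))).symm.trans (h0 (.inr (.inl b)))
  · obtain ⟨b, rfl⟩ : ∃ b, P.face b = f := Quotient.exists_rep f
    exact (hz (.inr (.inr b))).symm.trans (h0 (.inr (.inr (P.face b))))

/-- The sphere map of a plane graph.  Within a connected component of the graph it is the medial
graph, the two colours of regions being the vertices and the boundary walks.  The points of the
boundary walks join these pieces to one map, in which each extra region of the first colour meets
a single extra region of the second. -/
def sphereMap : SphereMap (Element P) (Adjacency P) (V ⊕ (P.Boundary ⊕ P.Face))
    (P.Boundary ⊕ (P.Boundary ⊕ P.Face)) where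
  s := sphereS
  t := sphereT X
  u := sphereU
  φ := sphereF
  conn := sphere_conn X
  even_u := sphere_even_u X
  even_φ := sphere_even_F X
  exact := exact_of_card _ _ _ _ (sphere_conn X) (sphere_even_u X) (sphere_even_F X)
    sphereSec sphereSec_spec (by
      have h1 := P.card_boundary_add_one_le
      have h2 := P.card_euler
      have h3 := PlaneEmbedding.card_corner (G := G)
      have h4 : Nat.card (P.Boundary × Bool) = Nat.card P.Boundary * 2 := by
        rw [Nat.card_prod]; simp
      simp only [Nat.card_sum] at h3 ⊢
      omega)

lemma ncard_element_le (x : G.edgeSet ⊕ {v : V // G.IsIsolated v}) :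
    {c : Corner G | c.element = x}.ncard ≤ 2 := by
  rcases x with ⟨e, he⟩ | v
  · induction e with | h u w =>
    let d : G.Dart := ⟨(u, w), he⟩
    have h : {c : Corner G | c.element = .inl ⟨s(u, w), he⟩} ⊆ {.inl d, .inl d.symm} := by
      rintro (d' | v) h
      · have h : d'.edge = d.edge := congrArg Subtype.val (Sum.inl_injective h)
        rcases (SimpleGraph.dart_edge_eq_iff _ _).1 h with rfl | rfl
        · exact .inl rfl
        · exact .inr rfl
      · cases h
    exact (Set.ncard_le_ncard h).trans ((Set.ncard_insert_le _ _).trans (by simp))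
  · have h : {c : Corner G | c.element = .inr v} ⊆ {.inr v} := by
      rintro (d' | v') h
      · cases h
      · cases h
        rfl
    exact (Set.ncard_le_ncard h).trans (by simp)

/-- An edge has two corners, hence at most four neighbours around its ends and two adjacencies to
the point of each of at most two boundary walks. -/
lemma width_singleton_le (x : Element P) : (sphereMap X).width {x} ≤ 8 := by
  rcases x with x | b
  · have h1 := ncard_element_le x
    let E : Set (Corner G) := {c | c.element = x}
    have h2 : (sphereMap X).cut {.inl x} ⊆ Sum.inl '' (E ∪ P.nextCorner '' E) ∪
        Sum.inr '' (Sum.inl '' ((P.boundary '' E) ×ˢ (Set.univ : Set Bool))) := by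
      intro c hc
      have hc : ¬(sphereS c = .inl x ↔ sphereT X c = .inl x) := hc
      rcases c with c | ⟨b, i⟩ | b
      · left
        refine ⟨c, ?_, rfl⟩
        have : c.element = x ∨ (P.nextCorner.symm c).element = x := by
          by_contra hcon
          push Not at hcon
          simp [sphereS, sphereT, hcon] at hc
        rcases this with h | h
        · exact .inl h
        · exact .inr ⟨_, h, by simp⟩
      · right
        refine ⟨_, ⟨(b, i), ⟨⟨(X.start b).1, ?_, X.start_boundary b⟩, trivial⟩, rfl⟩, rfl⟩
        have : (X.start b).1.element = x := by
          by_contra hcon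
          simp [sphereS, sphereT, hcon] at hc
        exact this
      · simp [sphereS, sphereT] at hc
    have h3 := Set.ncard_le_ncard h2
    have h4 := Set.ncard_union_le (Sum.inl '' (E ∪ P.nextCorner '' E))
      (Sum.inr '' (Sum.inl '' ((P.boundary '' E) ×ˢ (Set.univ : Set Bool))) :
        Set (Adjacency P))
    rw [Set.ncard_image_of_injective _ Sum.inl_injective,
      Set.ncard_image_of_injective _ Sum.inr_injective,
      Set.ncard_image_of_injective _ Sum.inl_injective, Set.ncard_prod, Set.ncard_univ] at h4
    have h5 := Set.ncard_union_le E (P.nextCorner '' E)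
    have h6 : (P.nextCorner '' E).ncard ≤ E.ncard := Set.ncard_image_le (Set.toFinite _)
    have h7 : (P.boundary '' E).ncard ≤ E.ncard := Set.ncard_image_le (Set.toFinite _)
    have h8 : E.ncard ≤ 2 := h1
    have h9 : Nat.card Bool = 2 := by simp
    rw [h9] at h4
    have h10 : (sphereMap X).width {.inl x} = ((sphereMap X).cut {.inl x}).ncard := rfl
    omega
  · have h2 : (sphereMap X).cut {.inr b} ⊆ {.inr (.inl (b, true)), .inr (.inl (b, false)),
        .inr (.inr b), .inr (.inr (X.order.symm b))} := by
      intro c hc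
      have hc : ¬(sphereS c = .inr b ↔ sphereT X c = .inr b) := hc
      rcases c with c | ⟨a, i⟩ | a
      · simp [sphereS, sphereT] at hc
      · have : a = b := by
          by_contra hcon
          simp [sphereS, sphereT, hcon] at hc
        subst this
        cases i <;> simp
      · have : a = b ∨ a = X.order.symm b := by
          by_contra hcon
          push Not at hcon
          rw [Ne, Ne, Equiv.eq_symm_apply] at hcon
          simp [sphereS, sphereT, hcon] at hc
        rcases this with rfl | rfl <;> simp
    have h3 := Set.ncard_le_ncard h2
    have h4 : ({.inr (.inl (b, true)), .inr (.inl (b, false)),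
        .inr (.inr b), .inr (.inr (X.order.symm b))} : Set (Adjacency P)).ncard ≤ 4 := by
      refine (Set.ncard_insert_le _ _).trans (Nat.succ_le_succ ?_)
      refine (Set.ncard_insert_le _ _).trans (Nat.succ_le_succ ?_)
      exact (Set.ncard_insert_le _ _).trans (by simp)
    have h10 : (sphereMap X).width {.inr b} = ((sphereMap X).cut {.inr b}).ncard := rfl
    omega

/-- A set of elements sees a vertex of the graph only if the set of its edges does. -/
lemma regionBoundary_subset (S : Set (Element P)) :
    (sphereMap X).regionBoundary (Set.range Sum.inl) S ⊆
      Sum.inl '' edgeBoundary {e : G.edgeSet | .inl (.inl e) ∈ S} := by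
  rintro _ ⟨⟨v, rfl⟩, ⟨a, ha, hav⟩, b, hb, hbv⟩
  have key : ∀ x, (sphereMap X).Incident x (.inl v) →
      (∃ e : G.edgeSet, x = .inl (.inl e) ∧ v ∈ (e : Sym2 V)) ∨
      (∃ h : G.IsIsolated v, x = .inl (.inr ⟨v, h⟩)) := by
    have key' : ∀ c : Corner G, c.vertex = v →
        (∃ e : G.edgeSet, (.inl c.element : Element P) = .inl (.inl e) ∧ v ∈ (e : Sym2 V)) ∨
        (∃ h : G.IsIsolated v, (.inl c.element : Element P) = .inl (.inr ⟨v, h⟩)) := by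
      rintro (d | ⟨v', hv'⟩) rfl
      · exact .inl ⟨_, rfl, Sym2.mem_mk_left _ _⟩
      · exact .inr ⟨hv', rfl⟩
    rintro x ⟨c, hc, hx⟩
    rcases c with c | b | b
    · have hc : c.vertex = v := Sum.inl_injective hc
      rcases hx with hx | hx
      · rw [← hx]
        exact key' c hc
      · rw [← hx]
        change (∃ e : G.edgeSet, Sum.inl (P.nextCorner.symm c).element = _ ∧ _) ∨
          (∃ h, Sum.inl (P.nextCorner.symm c).element = _)
        rw [P.element_nextCorner_symm]
        exact key' _ ((P.vertex_turn_symm c).trans hc)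
    · cases hc
    · cases hc
  refine ⟨v, ?_, rfl⟩
  rcases key a hav with ⟨e, rfl, hv⟩ | ⟨hi, rfl⟩ <;>
    rcases key b hbv with ⟨e', rfl, hv'⟩ | ⟨hi', rfl⟩
  · exact ⟨⟨e, ha, hv⟩, e', hb, hv'⟩
  · obtain ⟨w, hw⟩ := Sym2.mem_iff_exists.1 hv
    exact absurd (show s(v, w) ∈ G.edgeSet from hw ▸ e.2) (hi' w)
  · obtain ⟨w, hw⟩ := Sym2.mem_iff_exists.1 hv'
    exact absurd (show s(v, w) ∈ G.edgeSet from hw ▸ e'.2) (hi w)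
  · exact absurd ha hb

/-- An optimal branch decomposition of a plane graph can be rearranged such that every set of
edges that occurs in it, together with some isolated vertices and boundary walks, is enclosed
by few short closed curves. -/
theorem carved_sphereMap [Nonempty V] :
    Carved (fun S => (sphereMap X).width S ≤ 8 * branchwidth G + 8) Set.univ := by
  refine SphereMap.carved_width (R := Set.range Sum.inl) ?_ (width_singleton_le X) ?_
  · rintro (c | b | b) (c' | b' | b') h hR
    · exact absurd ⟨_, rfl⟩ hR
    · cases h
    · cases h
    · cases h
    · exact congrArg (fun b => Sum.inr (Sum.inl b)) (Sum.inl_injective (Sum.inr_injective h))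
    · cases h
    · cases h
    · cases h
    · exact congrArg (fun b => Sum.inr (Sum.inr b)) (Sum.inr_injective (Sum.inr_injective h))
  · have hne : (Set.univ : Set (Element P)).Nonempty := by
      obtain ⟨v⟩ := ‹Nonempty V›
      obtain ⟨c, -⟩ := exists_corner (G := G) v
      exact ⟨.inl c.element, trivial⟩
    have hle : ∀ (S : Set (Element P)) (A : Set G.edgeSet),
        {e : G.edgeSet | .inl (.inl e) ∈ S} = A → (edgeBoundary A).ncard ≤ branchwidth G →
        ((sphereMap X).regionBoundary (Set.range Sum.inl) S).ncard ≤ branchwidth G := by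
      rintro S _ rfl h
      refine (Set.ncard_le_ncard (regionBoundary_subset X S)).trans ?_
      rwa [Set.ncard_image_of_injective _ Sum.inl_injective]
    refine CarvedOrEmpty.carved ?_ hne
    have hE : CarvedOrEmpty (fun S => ((sphereMap X).regionBoundary (Set.range Sum.inl) S).ncard
        ≤ branchwidth G) (⋃ e ∈ (Set.univ : Set G.edgeSet), {.inl (.inl e)}) := by
      have hbi : ∀ A : Set G.edgeSet, {e : G.edgeSet | (.inl (.inl e) : Element P) ∈
          ⋃ e ∈ A, ({.inl (.inl e)} : Set (Element P))} = A := by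
        intro A
        ext e
        simp only [Set.mem_ofPred_eq, Set.mem_iUnion, Set.mem_singleton_iff, Sum.inl.injEq]
        exact ⟨fun ⟨e', h, h'⟩ => h' ▸ h, fun h => ⟨e, h, rfl⟩⟩
      rcases isEmpty_or_nonempty G.edgeSet with hG | hG
      · left; simp
      · have hc := carved_branchwidth (H := G)
        refine CarvedOrEmpty.biUnion (fun a b hab => by simpa using hab)
          (fun e => .inr (.single _ (hle _ {e} ?_ (hc.good_singleton (Set.mem_univ e)))))
          (fun A hA => hle _ A (hbi A) hA) hc
        ext e'
        simp
    have huniv : (Set.univ : Set (Element P))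
        = (⋃ e ∈ (Set.univ : Set G.edgeSet), {.inl (.inl e)}) ∪
          {x | ∀ e : G.edgeSet, x ≠ .inl (.inl e)} := by
      ext x
      simp only [Set.mem_univ, Set.iUnion_true, true_iff, Set.mem_union, Set.mem_iUnion,
        Set.mem_singleton_iff, Set.mem_ofPred_eq]
      tauto
    have hu : (edgeBoundary (Set.univ : Set G.edgeSet)).ncard ≤ branchwidth G := by
      simp [edgeBoundary]
    have hn : (edgeBoundary (∅ : Set G.edgeSet)).ncard ≤ branchwidth G := by
      simp [edgeBoundary]
    rw [huniv]
    refine CarvedOrEmpty.union_finite (Set.toFinite _) ?_ hE (fun x hx => hle _ ∅ ?_ hn)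
      fun Y hY => hle _ Set.univ ?_ hu
    · rw [Set.disjoint_left]
      intro x hx hx'
      simp only [Set.mem_univ, Set.iUnion_true, Set.mem_iUnion, Set.mem_singleton_iff] at hx
      obtain ⟨e, he⟩ := hx
      exact hx' e he
    · ext e
      simpa using fun h => hx e h.symm
    · ext e
      simp
end Sphere

/-! ### Branchwidth of an enhancement -/

section Columns

/-- At most one step in `k` steps along the columns leads on to the next point of the cycle. -/
lemma colNext_iterate {α : Type*} (π : α → α) {k : ℕ} (a : α) (s : Fin k) {n : ℕ} (hn : n ≤ k) :
    (∃ h : s.val + n < k, (colNext π)^[n] (a, s) = (a, ⟨s.val + n, h⟩)) ∨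
    (k ≤ s.val + n ∧ ∃ h : s.val + n - k < k,
      (colNext π)^[n] (a, s) = (π a, ⟨s.val + n - k, h⟩)) := by
  induction n with
  | zero => exact .inl ⟨s.2, rfl⟩
  | succ n ih =>
    rw [Function.iterate_succ_apply']
    rcases ih (by omega) with ⟨h, h'⟩ | ⟨h1, h, h'⟩
    · rw [h']
      by_cases h2 : s.val + n + 1 < k
      · exact .inl ⟨h2, by simp only [colNext, h2, dite_true]; rfl⟩
      · refine .inr ⟨by omega, by omega, ?_⟩
        simp only [colNext, h2, dite_false, Prod.mk.injEq, Fin.mk.injEq, true_and]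
        omega
    · have := s.2
      refine .inr ⟨by omega, by omega, ?_⟩
      have h2 : s.val + n - k + 1 < k := by omega
      rw [h']
      simp only [colNext, h2, dite_true, Prod.mk.injEq, Fin.mk.injEq, true_and]
      omega

/-- Only a first column is preceded by the column of another point of the cycle. -/
lemma eq_of_colNext_eq {α : Type*} {π : α → α} {k : ℕ} {p q : α × Fin k}
    (h : colNext π p = q) (hq : q.2.val ≠ 0) : p.1 = q.1 ∧ p.2.val + 1 = q.2.val := by
  subst h
  unfold colNext at hq ⊢
  split_ifs at hq ⊢
  · exact ⟨rfl, rfl⟩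
  · exact absurd rfl hq

variable {V : Type*} {G : SimpleGraph V} {P : PlaneEmbedding G} {k : ℕ}

instance [Finite V] : Finite P.NontrivialBoundary :=
  inferInstanceAs (Finite {b : P.Boundary // ∃ b', b' ≠ b ∧ P.face b' = P.face b})

instance [Finite V] : Finite (EnhVertex P k) :=
  Finite.of_surjective (fun x : V ⊕ ((Corner G × Fin k) × Fin k ⊕
      (P.NontrivialBoundary × Fin k) × Fin k) => match x with
    | .inl v => EnhVertex.old v
    | .inr (.inl (p, h)) => .ring p h
    | .inr (.inr ((b, t), h)) => .hub b t h) (by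
      rintro (v | ⟨p, h⟩ | ⟨b, t, h⟩)
      exacts [⟨.inl v, rfl⟩, ⟨.inr (.inl (p, h)), rfl⟩, ⟨.inr (.inr ((b, t), h)), rfl⟩])

variable (P k) in
/-- The edges of an enhancement are distributed over the edges of the graph, the columns of the
annuli around the boundary walks, and the columns of the annuli in the middle of the faces. -/
abbrev Column : Type _ :=
  G.edgeSet ⊕ ((Corner G × Fin k) ⊕ (P.NontrivialBoundary × Fin k))

/-- The element of the sphere map to which a column belongs. -/
def Column.element : Column P k → Element P
  | .inl e => .inl (.inl e)
  | .inr (.inl p) => .inl p.1.element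
  | .inr (.inr q) => .inr q.1.1

variable (X : EnhancementChoice P k)

/-- The vertices at which the edges of a column may end.  A column of an annulus has the edges
within it, those to the next column, and the spokes or links that end in it. -/
inductive Touches : Column P k → EnhVertex P k → Prop
  | edge (e : G.edgeSet) (v : V) : v ∈ (e : Sym2 V) → Touches (.inl e) (.old v)
  | spoke (p : Corner G × Fin k) : Touches (.inr (.inl p)) (.old p.1.vertex)
  | ring (p : Corner G × Fin k) (h : Fin k) : Touches (.inr (.inl p)) (.ring p h)
  | ringNext (p : Corner G × Fin k) (h : Fin k) :
      Touches (.inr (.inl p)) (.ring (colNext P.nextCorner p) h)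
  | hub (b : P.NontrivialBoundary) (t : Fin k) (h : Fin k) :
      Touches (.inr (.inr (b, t))) (.hub b t h)
  | hubNext (b b' : P.NontrivialBoundary) (t t' : Fin k) (h : Fin k) :
      colNext X.order (b.1, t) = (b'.1, t') → Touches (.inr (.inr (b, t))) (.hub b' t' h)
  | link (b : P.NontrivialBoundary) (t : Fin k) (h : Fin k) : h.val + 1 = k →
      Touches (.inr (.inr (b, t))) (.ring ((colNext P.nextCorner)^[t.val] (X.start b.1)) h)

variable {X} in
lemma EnhRel.exists_touches {x y : EnhVertex P k} (h : EnhRel X x y) :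
    ∃ q, Touches X q x ∧ Touches X q y := by
  rcases h with ⟨u, v, h⟩ | ⟨p, h⟩ | ⟨p, h, h', -⟩ | ⟨p, h, -⟩ | ⟨b, b', t, t', h, h'⟩ |
    ⟨b, t, h, h', -⟩ | ⟨b, t, h, h'⟩
  · exact ⟨.inl ⟨s(u, v), h⟩, .edge _ _ (Sym2.mem_mk_left _ _), .edge _ _ (Sym2.mem_mk_right _ _)⟩
  · exact ⟨_, .ring p h, .ringNext p h⟩
  · exact ⟨_, .ring p h, .ring p h'⟩
  · exact ⟨_, .spoke p, .ring p h⟩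
  · exact ⟨_, .hub b t h, .hubNext b b' t t' h h'⟩
  · exact ⟨_, .hub b t h, .hub b t h'⟩
  · exact ⟨_, .link b t h h', .hub b t h⟩

lemma exists_touches (e : (enhancement X).edgeSet) :
    ∃ q, ∀ x ∈ (e : Sym2 (EnhVertex P k)), Touches X q x := by
  obtain ⟨e, he⟩ := e
  induction e with | h x y =>
  have he : x ≠ y ∧ (EnhRel X x y ∨ EnhRel X y x) := he
  rcases he.2 with h | h <;> obtain ⟨q, h1, h2⟩ := h.exists_touches <;>
    refine ⟨q, fun z hz => ?_⟩ <;> rcases Sym2.mem_iff.1 hz with rfl | rfl <;> assumption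

/-- The column of an edge. -/
noncomputable def columnOf (e : (enhancement X).edgeSet) : Column P k := (exists_touches X e).choose

lemma touches_columnOf {e : (enhancement X).edgeSet} {x : EnhVertex P k}
    (h : x ∈ (e : Sym2 (EnhVertex P k))) : Touches X (columnOf X e) x :=
  (exists_touches X e).choose_spec x h

/-- The vertices of an enhancement along an adjacency of the sphere map.  Any vertex that lies on
edges of columns of different elements is among them for an adjacency that separates the two. -/
def seam : Adjacency P → Set (EnhVertex P k)
  | .inl c => {.old c.vertex} ∪ (Set.range (fun h : Fin k => .ring (c, ⟨0, h.pos⟩) h) ∪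
      Set.range (fun t : Fin k => .ring (c, t) ⟨k - 1, Nat.sub_one_lt t.pos.ne'⟩))
  | .inr (.inl b) => Set.range (fun t : Fin k =>
      .ring ((colNext P.nextCorner)^[t.val] (X.start b.1)) ⟨k - 1, Nat.sub_one_lt t.pos.ne'⟩)
  | .inr (.inr b) => {x | ∃ (b' : P.NontrivialBoundary) (h : Fin k),
      b'.1 = X.order b ∧ x = .hub b' ⟨0, h.pos⟩ h}

lemma ncard_range_fin_le {β : Type*} (f : Fin k → β) : (Set.range f).ncard ≤ k := by
  rw [← Set.image_univ]
  refine (Set.ncard_image_le (Set.toFinite _)).trans ?_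
  simp [Set.ncard_univ]

lemma ncard_seam_le (c : Adjacency P) : (seam X c).ncard ≤ 2 * k + 1 := by
  rcases c with c | b | b
  · have h1 := Set.ncard_union_le {EnhVertex.old (P := P) (k := k) c.vertex}
      (Set.range (fun h : Fin k => .ring (c, ⟨0, h.pos⟩) h) ∪
      Set.range (fun t : Fin k => .ring (c, t) ⟨k - 1, Nat.sub_one_lt t.pos.ne'⟩))
    have h2 := Set.ncard_union_le
      (Set.range (fun h : Fin k => EnhVertex.ring (P := P) (c, ⟨0, h.pos⟩) h))
      (Set.range (fun t : Fin k => .ring (c, t) ⟨k - 1, Nat.sub_one_lt t.pos.ne'⟩))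
    have h3 := ncard_range_fin_le (fun h : Fin k => EnhVertex.ring (P := P) (c, ⟨0, h.pos⟩) h)
    have h4 := ncard_range_fin_le
      (fun t : Fin k => EnhVertex.ring (P := P) (c, t) ⟨k - 1, Nat.sub_one_lt t.pos.ne'⟩)
    rw [Set.ncard_singleton] at h1
    change Set.ncard (_ ∪ _) ≤ _
    omega
  · refine (ncard_range_fin_le _).trans (by omega)
  · by_cases h : ∃ b' : P.NontrivialBoundary, b'.1 = X.order b
    · obtain ⟨b', hb'⟩ := h
      have h : seam X (.inr (.inr b)) ⊆
          Set.range (fun h : Fin k => EnhVertex.hub b' ⟨0, h.pos⟩ h) := by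
        rintro _ ⟨b'', h, hb, rfl⟩
        obtain rfl : b'' = b' := Subtype.ext (hb.trans hb'.symm)
        exact ⟨h, rfl⟩
      exact (Set.ncard_le_ncard h (Set.finite_range _)).trans
        ((ncard_range_fin_le _).trans (by omega))
    · have h : seam X (.inr (.inr b)) = ∅ := by
        ext x
        simp only [Set.mem_empty_iff_false, iff_false]
        rintro ⟨b', -, hb, -⟩
        exact h ⟨b', hb⟩
      simp [h]

/-- An element of the sphere map whose columns have edges at the given vertex. -/
noncomputable def home : EnhVertex P k → Element P
  | .old v => .inl (exists_corner (G := G) v).choose.element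
  | .ring p _ => .inl p.1.element
  | .hub b _ _ => .inr b.1

/-- At a vertex of the enhancement that lies on no seam over the cut of `S`, all columns belong to
elements of `S` or none does. -/
lemma element_mem_iff_home_mem (S : Set (Element P)) {q : Column P k} {x : EnhVertex P k}
    (hq : Touches X q x)
    (hx : ∀ c, x ∈ seam X c → (sphereS c ∈ S ↔ sphereT X c ∈ S)) :
    q.element ∈ S ↔ home x ∈ S := by
  have hold : ∀ c c' : Corner G, c.vertex = c'.vertex → x = .old c.vertex →
      (Sum.inl c.element ∈ S ↔ Sum.inl c'.element ∈ S) := by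
    rintro c c' hcc rfl
    have := P.iff_of_vertex_eq
      (r := fun c'' => c''.vertex = c.vertex → (Sum.inl c''.element : Element P) ∈ S)
      (fun c'' => by
        rw [P.vertex_turn]
        refine forall_congr' fun h => ?_
        have := hx (.inl (P.turn c'')) (.inl (by rw [P.vertex_turn, h]; rfl))
        change _ ↔ Sum.inl (P.nextCorner.symm (P.turn c'')).element ∈ S at this
        rwa [P.element_nextCorner_symm, Equiv.symm_apply_apply] at this) hcc
    simpa [hcc] using this
  rcases hq with ⟨e, v, h⟩ | p | ⟨p, h⟩ | ⟨p, h⟩ | ⟨b, t, h⟩ | ⟨b, b', t, t', h, h'⟩ | ⟨b, t, h, h'⟩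
  · obtain ⟨w, hw⟩ := Sym2.mem_iff_exists.1 h
    have hvw : G.Adj v w := by
      have := e.2
      rwa [hw] at this
    obtain rfl : e = ⟨s(v, w), hvw⟩ := Subtype.ext hw
    exact hold (.inl ⟨(v, w), hvw⟩) _ (exists_corner (G := G) v).choose_spec.symm rfl
  · exact hold _ _ (exists_corner (G := G) _).choose_spec.symm rfl
  · rfl
  · obtain ⟨c, t⟩ := p
    by_cases ht : t.val + 1 < k
    · simp [colNext, ht, home, Column.element]
    · have h0 : colNext P.nextCorner (c, t) = (P.nextCorner c, ⟨0, t.pos⟩) := by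
        simp [colNext, ht]
      rw [h0] at hx ⊢
      have := hx (.inl (P.nextCorner c)) (.inr (.inl ⟨h, rfl⟩))
      change Sum.inl (P.nextCorner c).element ∈ S ↔
        Sum.inl (P.nextCorner.symm (P.nextCorner c)).element ∈ S at this
      rw [Equiv.symm_apply_apply] at this
      exact this.symm
  · rfl
  · by_cases ht : t.val + 1 < k
    · simp only [colNext, ht, dite_true, Prod.mk.injEq] at h'
      rw [Subtype.ext h'.1]
      rfl
    · simp only [colNext, ht, dite_false, Prod.mk.injEq] at h'
      have := hx (.inr (.inr b.1)) ⟨b', h, h'.1.symm, by rw [h'.2]⟩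
      change Sum.inr b.1 ∈ S ↔ Sum.inr (X.order b.1) ∈ S at this
      rw [h'.1] at this
      exact this
  · obtain rfl : h = ⟨k - 1, Nat.sub_one_lt t.pos.ne'⟩ := by
      ext
      simp only
      omega
    have h1 := hx (.inr (.inl (b.1, true))) ⟨t, rfl⟩
    change Sum.inr b.1 ∈ S ↔ Sum.inl (X.start b.1).1.element ∈ S at h1
    refine h1.trans ?_
    rcases colNext_iterate P.nextCorner (X.start b.1).1 (X.start b.1).2 t.2.le with
      ⟨h2, h3⟩ | ⟨-, h2, h3⟩
    · change _ ↔ Sum.inl ((colNext P.nextCorner)^[t.val] (X.start b.1)).1.element ∈ S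
      rw [h3]
    · change _ ↔ Sum.inl ((colNext P.nextCorner)^[t.val] (X.start b.1)).1.element ∈ S
      rw [h3] at hx ⊢
      have := hx (.inl (P.nextCorner (X.start b.1).1)) (.inr (.inr ⟨_, rfl⟩))
      change Sum.inl (P.nextCorner (X.start b.1).1).element ∈ S ↔
        Sum.inl (P.nextCorner.symm (P.nextCorner (X.start b.1).1)).element ∈ S at this
      rw [Equiv.symm_apply_apply] at this
      exact this.symm

end Columns

section EnhancementWidth

variable {V : Type*} {G : SimpleGraph V} {P : PlaneEmbedding G} {k : ℕ}
  (X : EnhancementChoice P k)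

lemma ncard_biUnion_le_mul {ι β : Type*} {s : Set ι} (hs : s.Finite) (f : ι → Set β) {n : ℕ}
    (h : ∀ i ∈ s, (f i).ncard ≤ n) : (⋃ i ∈ s, f i).ncard ≤ s.ncard * n := by
  induction s, hs using Set.Finite.induction_on with
  | empty => simp
  | @insert a s ha hs ih =>
    rw [Set.biUnion_insert, Set.ncard_insert_of_notMem ha hs, add_mul, one_mul, add_comm]
    exact (Set.ncard_union_le _ _).trans (add_le_add (h a (.inl rfl))
      (ih fun i hi => h i (.inr hi)))

/-- The edges that belong to a set of elements of the sphere map have few vertices in common with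
the other edges if few adjacencies leave the set. -/
lemma ncard_edgeBoundary_elements_le [Finite V] (S : Set (Element P)) :
    (edgeBoundary {e | (columnOf X e).element ∈ S}).ncard
      ≤ (sphereMap X).width S * (2 * k + 1) := by
  have h : edgeBoundary {e | (columnOf X e).element ∈ S} ⊆
      ⋃ c ∈ (sphereMap X).cut S, seam X c := by
    rintro x ⟨⟨e, he, hx⟩, e', he', hx'⟩
    by_contra hcon
    have hx0 : ∀ c, x ∈ seam X c → (sphereS c ∈ S ↔ sphereT X c ∈ S) := by
      intro c hc
      by_contra hc'
      exact hcon (Set.mem_biUnion (show c ∈ (sphereMap X).cut S from hc') hc)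
    exact he' ((element_mem_iff_home_mem X S (touches_columnOf X hx') hx0).2
      ((element_mem_iff_home_mem X S (touches_columnOf X hx) hx0).1 he))
  exact (Set.ncard_le_ncard h).trans
    (ncard_biUnion_le_mul (Set.toFinite _) _ fun c _ => ncard_seam_le X c)

variable {X}

lemma Touches.of_ring {q : Column P k} {p : Corner G × Fin k} {h : Fin k}
    (hq : Touches X q (.ring p h)) : q = .inr (.inl p) ∨
      (∃ p', colNext P.nextCorner p' = p ∧ q = .inr (.inl p')) ∨ h.val + 1 = k := by
  generalize hx : EnhVertex.ring p h = x at hq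
  cases hq <;> cases hx
  · exact .inl rfl
  · exact .inr (.inl ⟨_, rfl, rfl⟩)
  · exact .inr (.inr ‹_›)

lemma Touches.of_hub {q : Column P k} {b : P.NontrivialBoundary} {t h : Fin k}
    (hq : Touches X q (.hub b t h)) : q = .inr (.inr (b, t)) ∨
      ∃ b' t', colNext X.order (b'.1, t') = (b.1, t) ∧ q = .inr (.inr (b', t')) := by
  generalize hx : EnhVertex.hub b t h = x at hq
  cases hq <;> cases hx
  · exact .inl rfl
  · exact .inr ⟨_, _, ‹_›, rfl⟩

lemma ncard_hub_le (a : P.Boundary × Fin k) :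
    {x : EnhVertex P k | ∃ (b : P.NontrivialBoundary) (t h : Fin k),
      a = (b.1, t) ∧ x = .hub b t h}.ncard ≤ k := by
  by_cases hb : ∃ b : P.NontrivialBoundary, b.1 = a.1
  · obtain ⟨b, hb⟩ := hb
    refine (Set.ncard_le_ncard ?_ (Set.finite_range fun h => EnhVertex.hub b a.2 h)).trans
      (ncard_range_fin_le _)
    rintro _ ⟨b', t, h, rfl, rfl⟩
    obtain rfl : b = b' := Subtype.ext hb
    exact ⟨h, rfl⟩
  · convert Nat.zero_le k
    convert Set.ncard_empty (EnhVertex P k)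
    ext x
    simp only [Set.mem_ofPred_eq, Set.mem_empty_iff_false, iff_false]
    rintro ⟨b', t, h, rfl, -⟩
    exact hb ⟨b', rfl⟩

lemma ncard_touches_le [Finite V] (q : Column P k) : {x | Touches X q x}.ncard ≤ 3 * k + 2 := by
  rcases q with ⟨e, he⟩ | p | ⟨b, t⟩
  · induction e with | h u v =>
    have h : {x | Touches X (.inl ⟨s(u, v), he⟩) x} ⊆ {.old u, .old v} := by
      rintro x hx
      cases hx with | edge _ w hw =>
      rcases Sym2.mem_iff.1 hw with rfl | rfl
      · exact .inl rfl
      · exact .inr rfl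
    exact (Set.ncard_le_ncard h).trans
      ((Set.ncard_insert_le _ _).trans (by rw [Set.ncard_singleton]; omega))
  · have h : {x | Touches X (.inr (.inl p)) x} ⊆ insert (.old p.1.vertex)
        (Set.range (fun h => .ring p h) ∪
          Set.range (fun h => .ring (colNext P.nextCorner p) h)) := by
      rintro x hx
      cases hx
      · exact .inl rfl
      · exact .inr (.inl ⟨_, rfl⟩)
      · exact .inr (.inr ⟨_, rfl⟩)
    have h1 := Set.ncard_le_ncard h
    have h2 := Set.ncard_insert_le (EnhVertex.old (P := P) p.1.vertex)
      (Set.range (fun h => EnhVertex.ring p h) ∪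
          Set.range (fun h => .ring (colNext P.nextCorner p) h))
    have h3 := Set.ncard_union_le (Set.range (fun h => EnhVertex.ring (P := P) p h))
      (Set.range (fun h => .ring (colNext P.nextCorner p) h))
    have h4 := ncard_range_fin_le (fun h => EnhVertex.ring (P := P) p h)
    have h5 := ncard_range_fin_le (fun h => EnhVertex.ring (P := P) (colNext P.nextCorner p) h)
    omega
  · have h : {x | Touches X (.inr (.inr (b, t))) x} ⊆
        Set.range (fun h => .hub b t h) ∪ (Set.range
          (fun h => .ring ((colNext P.nextCorner)^[t.val] (X.start b.1)) h) ∪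
          {x | ∃ (b' : P.NontrivialBoundary) (t' h : Fin k),
            colNext X.order (b.1, t) = (b'.1, t') ∧ x = .hub b' t' h}) := by
      rintro x hx
      cases hx
      · exact .inl ⟨_, rfl⟩
      · exact .inr (.inr ⟨_, _, _, ‹_›, rfl⟩)
      · exact .inr (.inl ⟨_, rfl⟩)
    have h1 := Set.ncard_le_ncard h
    have h2 := Set.ncard_union_le (Set.range (fun h => EnhVertex.hub b t h)) (Set.range
          (fun h => .ring ((colNext P.nextCorner)^[t.val] (X.start b.1)) h) ∪
          {x | ∃ (b' : P.NontrivialBoundary) (t' h : Fin k),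
            colNext X.order (b.1, t) = (b'.1, t') ∧ x = .hub b' t' h})
    have h3 := Set.ncard_union_le (Set.range
          (fun h => EnhVertex.ring ((colNext P.nextCorner)^[t.val] (X.start b.1)) h))
          {x | ∃ (b' : P.NontrivialBoundary) (t' h : Fin k),
            colNext X.order (b.1, t) = (b'.1, t') ∧ x = .hub b' t' h}
    have h4 := ncard_range_fin_le (fun h => EnhVertex.hub b t h)
    have h5 := ncard_range_fin_le
      (fun h => EnhVertex.ring (P := P) ((colNext P.nextCorner)^[t.val] (X.start b.1)) h)
    have h6 := ncard_hub_le (P := P) (colNext X.order (b.1, t))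
    omega

/-- The first columns of a corner meet the other columns in the vertex of the corner, the first column,
the column after the last, and the roof. -/
lemma ncard_edgeBoundary_ring_le [Finite V] (c : Corner G) (j : Fin k) :
    (edgeBoundary {e | ∃ i ≤ j, columnOf X e = .inr (.inl (c, i))}).ncard ≤ 3 * k + 2 := by
  let r : Fin k := ⟨k - 1, Nat.sub_one_lt j.pos.ne'⟩
  let A : Set (EnhVertex P k) := Set.range fun h => .ring (c, ⟨0, j.pos⟩) h
  let B : Set (EnhVertex P k) := Set.range fun h => .ring (colNext P.nextCorner (c, j)) h
  let C : Set (EnhVertex P k) := Set.range fun t => .ring (c, t) r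
  have h : edgeBoundary {e | ∃ i ≤ j, columnOf X e = .inr (.inl (c, i))} ⊆
      insert (.old c.vertex) (A ∪ (B ∪ C)) := by
    rintro x ⟨⟨e, ⟨i, hij, he⟩, hx⟩, e', he', hx'⟩
    replace hx := touches_columnOf X hx
    replace hx' := touches_columnOf X hx'
    rw [he] at hx
    have key : ∀ i ≤ j, ∀ h, x = .ring (c, i) h → x ∈ A ∪ (B ∪ C) := by
      rintro i hij h rfl
      rcases hx'.of_ring with h1 | ⟨p, hp, h1⟩ | h1
      · exact absurd ⟨i, hij, h1⟩ he'
      · by_cases hi : i.val = 0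
        · exact .inl ⟨h, by simp [← hi]⟩
        · obtain ⟨h2, h3⟩ := eq_of_colNext_eq hp hi
          refine absurd ⟨p.2, ?_, ?_⟩ he'
          · simp only at h3
            rw [Fin.le_def] at hij ⊢
            omega
          · rw [h1]
            simp only at h2
            rw [← h2]
      · refine .inr (.inr ⟨i, ?_⟩)
        simp only [EnhVertex.ring.injEq, true_and, r, Fin.ext_iff]
        omega
    cases hx with
    | spoke => exact .inl rfl
    | ring _ h => exact .inr (key i hij h rfl)
    | ringNext _ h =>
      rcases hij.eq_or_lt with rfl | hij
      · exact .inr (.inr (.inl ⟨h, rfl⟩))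
      · have h1 : i.val + 1 < k := by
          rw [Fin.lt_def] at hij
          have := j.2
          omega
        refine .inr (key ⟨i + 1, h1⟩ hij h ?_)
        simp [colNext, h1]
  have h1 := Set.ncard_le_ncard h
  have h2 := Set.ncard_insert_le (EnhVertex.old c.vertex) (A ∪ (B ∪ C))
  have h3 := Set.ncard_union_le A (B ∪ C)
  have h4 := Set.ncard_union_le B C
  have h5 : A.ncard ≤ k := ncard_range_fin_le _
  have h6 : B.ncard ≤ k := ncard_range_fin_le _
  have h7 : C.ncard ≤ k := ncard_range_fin_le _
  omega

/-- The first columns of a boundary walk in the middle of a face meet the other columns in the first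
column, the column after the last, and the ends of their links. -/
lemma ncard_edgeBoundary_hub_le [Finite V] (b : P.NontrivialBoundary) (j : Fin k) :
    (edgeBoundary {e | ∃ i ≤ j, columnOf X e = .inr (.inr (b, i))}).ncard ≤ 3 * k + 2 := by
  let r : Fin k := ⟨k - 1, Nat.sub_one_lt j.pos.ne'⟩
  let A : Set (EnhVertex P k) := Set.range fun h => .hub b ⟨0, j.pos⟩ h
  let B : Set (EnhVertex P k) := {x | ∃ (b' : P.NontrivialBoundary) (t h : Fin k),
      colNext X.order (b.1, j) = (b'.1, t) ∧ x = .hub b' t h}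
  let C : Set (EnhVertex P k) :=
    Set.range fun t : Fin k => .ring ((colNext P.nextCorner)^[t.val] (X.start b.1)) r
  have h : edgeBoundary {e | ∃ i ≤ j, columnOf X e = .inr (.inr (b, i))} ⊆ A ∪ (B ∪ C) := by
    rintro x ⟨⟨e, ⟨i, hij, he⟩, hx⟩, e', he', hx'⟩
    replace hx := touches_columnOf X hx
    replace hx' := touches_columnOf X hx'
    rw [he] at hx
    have key : ∀ i ≤ j, ∀ h, x = .hub b i h → x ∈ A ∪ (B ∪ C) := by
      rintro i hij h rfl
      rcases hx'.of_hub with h1 | ⟨b', t', hp, h1⟩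
      · exact absurd ⟨i, hij, h1⟩ he'
      · by_cases hi : i.val = 0
        · exact .inl ⟨h, by simp [← hi]⟩
        · obtain ⟨h2, h3⟩ := eq_of_colNext_eq hp hi
          refine absurd ⟨t', ?_, ?_⟩ he'
          · simp only at h3
            rw [Fin.le_def] at hij ⊢
            omega
          · rw [h1, show b' = b from Subtype.ext h2]
    cases hx with
    | hub _ _ h => exact key i hij h rfl
    | hubNext _ b' _ t' h hn =>
      rcases hij.eq_or_lt with rfl | hij
      · exact .inr (.inl ⟨_, _, h, hn, rfl⟩)
      · have h1 : i.val + 1 < k := by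
          rw [Fin.lt_def] at hij
          have := j.2
          omega
        refine key ⟨i + 1, h1⟩ hij h ?_
        simp only [colNext, h1, dite_true, Prod.mk.injEq] at hn
        rw [show b' = b from Subtype.ext hn.1.symm, hn.2]
    | link _ _ h hh =>
      refine .inr (.inr ⟨i, ?_⟩)
      simp only [EnhVertex.ring.injEq, true_and, r, Fin.ext_iff]
      omega
  have h1 := Set.ncard_le_ncard h
  have h3 := Set.ncard_union_le A (B ∪ C)
  have h4 := Set.ncard_union_le B C
  have h5 : A.ncard ≤ k := ncard_range_fin_le _
  have h6 : B.ncard ≤ k := ncard_hub_le _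
  have h7 : C.ncard ≤ k := ncard_range_fin_le _
  omega

variable {w : ℕ}

lemma carvedOrEmpty_column [Finite V] (hw : 3 * k + 2 ≤ w) (q : Column P k) :
    CarvedOrEmpty (fun A => (edgeBoundary A).ncard ≤ w) {e | columnOf X e = q} := by
  refine .of_forall_subset (Set.toFinite _) fun A hA => ?_
  refine (Set.ncard_le_ncard (t := {x | Touches X q x}) ?_).trans ((ncard_touches_le q).trans hw)
  rintro x ⟨⟨e, he, hx⟩, -⟩
  rw [← show columnOf X e = q from hA he]
  exact touches_columnOf X hx

/-- Consecutive columns are put together from left to right. -/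
lemma carvedOrEmpty_strip [Finite V] (hw : 3 * k + 2 ≤ w) {f : Fin k → Column P k}
    (hf : Function.Injective f)
    (h : ∀ j, (edgeBoundary {e | ∃ i ≤ j, columnOf X e = f i}).ncard ≤ w) :
    CarvedOrEmpty (fun A => (edgeBoundary A).ncard ≤ w) {e | ∃ i, columnOf X e = f i} := by
  have h1 : ∀ j ≤ k, (⋃ i < j, {e | ∃ h : i < k, columnOf X e = f ⟨i, h⟩}) =
      {e | ∃ i : Fin k, i.val < j ∧ columnOf X e = f i} := by
    intro j hj
    ext e
    simp only [Set.mem_iUnion, Set.mem_ofPred_eq]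
    exact ⟨fun ⟨i, hij, hi, he⟩ => ⟨⟨i, hi⟩, hij, he⟩, fun ⟨i, hij, he⟩ => ⟨i, hij, i.2, he⟩⟩
  have h2 : {e | ∃ i, columnOf X e = f i} =
      ⋃ i < k, {e | ∃ h : i < k, columnOf X e = f ⟨i, h⟩} := by
    rw [h1 k le_rfl]
    ext e
    exact ⟨fun ⟨i, h⟩ => ⟨i, i.2, h⟩, fun ⟨i, _, h⟩ => ⟨i, h⟩⟩
  rw [h2]
  refine .prefixes (fun i j hij => Set.disjoint_left.2 ?_) (fun i hi => ?_) fun j hj => ?_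
  · rintro e ⟨hi, he⟩ ⟨hj, he'⟩
    exact hij (congrArg Fin.val (hf (he.symm.trans he')))
  · simpa only [hi, exists_true_left] using carvedOrEmpty_column hw (f ⟨i, hi⟩)
  · rw [h1 j hj]
    rcases j with _ | j
    · simp [edgeBoundary]
    · simpa only [Nat.lt_succ_iff, Fin.le_def] using h ⟨j, hj⟩

/-- The edges of one element of the sphere map: for an edge of the graph these are the edge itself and
the columns at its two corners. -/
lemma carvedOrEmpty_element [Finite V] (hw : 8 * k + 6 ≤ w) (x : Element P) :
    CarvedOrEmpty (fun A => (edgeBoundary A).ncard ≤ w)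
      {e | (columnOf X e).element = x} := by
  let C (c : Corner G) : Set (enhancement X).edgeSet := {e | ∃ i, columnOf X e = .inr (.inl (c, i))}
  have hC : ∀ c, CarvedOrEmpty (fun A => (edgeBoundary A).ncard ≤ w) (C c) := fun c =>
    carvedOrEmpty_strip (by omega) (fun i j h => by simpa using h)
      fun j => (ncard_edgeBoundary_ring_le c j).trans (by omega)
  rcases x with (e | v) | b
  · obtain ⟨e, he⟩ := e
    induction e with | h u v =>
    let d : G.Dart := ⟨(u, v), he⟩
    have hd : d ≠ d.symm := d.symm_ne.symm
    have hCb : ∀ c, (edgeBoundary (C c)).ncard ≤ 3 * k + 2 := by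
      intro c
      rcases k.eq_zero_or_pos with hk | hk
      · have : C c = ∅ := by
          ext e
          simp only [Set.mem_empty_iff_false, iff_false]
          rintro ⟨i, -⟩
          exact absurd i.2 (by omega)
        simp [this, edgeBoundary]
      · have : C c = {e | ∃ i ≤ ⟨k - 1, by omega⟩, columnOf X e = .inr (.inl (c, i))} := by
          ext e
          refine exists_congr fun i => ⟨fun h => ⟨?_, h⟩, fun h => h.2⟩
          rw [Fin.le_def]
          exact Nat.le_sub_one_of_lt i.2
        rw [this]
        exact ncard_edgeBoundary_ring_le c _
    have hE := carvedOrEmpty_column (X := X) (show 3 * k + 2 ≤ w by omega) (.inl ⟨s(u, v), he⟩)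
    have hEb : (edgeBoundary {e | columnOf X e = .inl ⟨s(u, v), he⟩}).ncard ≤ 2 := by
      refine (Set.ncard_le_ncard (t := {.old u, .old v}) ?_).trans
        ((Set.ncard_insert_le _ _).trans (by simp))
      rintro x ⟨⟨e, he, hx⟩, -⟩
      have hx := touches_columnOf X hx
      rw [show columnOf X e = _ from he] at hx
      cases hx with | edge _ w hw =>
      rcases Sym2.mem_iff.1 hw with rfl | rfl
      · exact .inl rfl
      · exact .inr rfl
    have hu : {e | (columnOf X e).element = .inl (.inl ⟨s(u, v), he⟩)} =
        ({e | columnOf X e = .inl ⟨s(u, v), he⟩} ∪ C (.inl d)) ∪ C (.inl d.symm) := by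
      ext e
      simp only [Set.mem_ofPred_eq, Set.mem_union, C]
      rcases columnOf X e with e' | ⟨d' | v', t⟩ | ⟨b, t⟩
      · simp [Column.element]
      · have : d'.edge = s(u, v) ↔ d' = d ∨ d' = d.symm := SimpleGraph.dart_edge_eq_iff d' d
        simp [Column.element, Corner.element, this]
      · simp [Column.element, Corner.element]
      · simp [Column.element]
    rw [hu]
    have b1 := Set.ncard_le_ncard
      (edgeBoundary_union_subset {e | columnOf X e = .inl ⟨s(u, v), he⟩} (C (.inl d)))
    have b2 := Set.ncard_union_le
      (edgeBoundary {e | columnOf X e = .inl ⟨s(u, v), he⟩}) (edgeBoundary (C (.inl d)))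
    have b3 := Set.ncard_le_ncard (edgeBoundary_union_subset
      ({e | columnOf X e = .inl ⟨s(u, v), he⟩} ∪ C (.inl d)) (C (.inl d.symm)))
    have b4 := Set.ncard_union_le
      (edgeBoundary ({e | columnOf X e = .inl ⟨s(u, v), he⟩} ∪ C (.inl d)))
      (edgeBoundary (C (.inl d.symm)))
    have b5 := hCb (.inl d)
    have b6 := hCb (.inl d.symm)
    refine .union ?_ (.union ?_ hE (hC _) ?_) (hC _) ?_
    · rw [Set.disjoint_left]
      rintro e (he | ⟨i, he⟩) ⟨i', he'⟩
      · cases he.symm.trans he'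
      · have := he.symm.trans he'
        simp [hd] at this
    · rw [Set.disjoint_left]
      rintro e he ⟨i', he'⟩
      cases he.symm.trans he'
    · omega
    · omega
  · convert hC (.inr v) using 1
    ext e
    simp only [Set.mem_ofPred_eq, C]
    rcases columnOf X e with e' | ⟨d' | v', t⟩ | ⟨b, t⟩ <;>
      simp [Column.element, Corner.element]
  · by_cases hb : ∃ b', b' ≠ b ∧ P.face b' = P.face b
    · convert carvedOrEmpty_strip (w := w) (X := X) (by omega)
        (f := fun i => .inr (.inr (⟨b, hb⟩, i)))
        (fun i j h => (Prod.mk.inj (Sum.inr_injective (Sum.inr_injective h))).2)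
        (fun j => (ncard_edgeBoundary_hub_le ⟨b, hb⟩ j).trans (by omega)) using 1
      ext e
      simp only [Set.mem_ofPred_eq]
      rcases columnOf X e with e' | ⟨c, t⟩ | ⟨b', t⟩
      · simp [Column.element]
      · simp [Column.element]
      · have : b'.1 = b ↔ b' = ⟨b, hb⟩ := ⟨fun h => Subtype.ext h, fun h => by rw [h]⟩
        simp only [Column.element, Sum.inr.injEq, this]
        exact ⟨fun h => ⟨t, by rw [h]⟩, fun ⟨_, h⟩ => (Prod.mk.inj h).1⟩
    · left
      ext e
      simp only [Set.mem_ofPred_eq, Set.mem_empty_iff_false, iff_false]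
      rcases columnOf X e with e' | ⟨c, t⟩ | ⟨b', t⟩
      · simp [Column.element]
      · simp [Column.element]
      · rintro h
        have h : b'.1 = b := Sum.inr_injective h
        exact hb (h ▸ b'.2)

variable (X) in
/-- The carving of the sphere map has width at most `8 * bw G + 8`, and a seam has at most `2 * k + 1`
vertices. -/
theorem branchwidth_enhancement_le [Finite V] [Nonempty V] (hk : 3 ≤ k) :
    branchwidth (enhancement X) ≤ 48 * k * max 1 (branchwidth G) := by
  have hm1 := le_max_left 1 (branchwidth G)
  have hm2 := le_max_right 1 (branchwidth G)
  generalize max 1 (branchwidth G) = m at hm1 hm2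
  have hkm : k ≤ k * m := Nat.le_mul_of_pos_right k hm1
  have hw : 8 * k + 6 ≤ 48 * k * m := by
    rw [mul_assoc]
    omega
  apply branchwidth_le_of_carved
  -- replace each element of the sphere map by its edges
  have h := CarvedOrEmpty.biUnion
    (T := fun x => {e : (enhancement X).edgeSet | (columnOf X e).element = x})
    (g' := fun A => (edgeBoundary A).ncard ≤ 48 * k * m)
    (fun x y hxy => Set.disjoint_left.2 ?_) (carvedOrEmpty_element hw) (fun S hS => ?_)
    (carved_sphereMap X)
  · have hu : (⋃ x ∈ (Set.univ : Set (Element P)),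
        {e : (enhancement X).edgeSet | (columnOf X e).element = x}) = Set.univ := by
      ext e
      simp
    rw [hu] at h
    refine h.carved ?_
    obtain ⟨v⟩ := ‹Nonempty V›
    obtain ⟨c, -⟩ := exists_corner (G := G) v
    exact ⟨⟨s(.ring (c, ⟨0, by omega⟩) ⟨0, by omega⟩, .ring (c, ⟨0, by omega⟩) ⟨1, by omega⟩),
      ⟨by simp, .inl (.ringPath _ _ _ rfl)⟩⟩, trivial⟩
  · rintro e he he'
    exact hxy (he.symm.trans he')
  · have hu : (⋃ x ∈ S, {e : (enhancement X).edgeSet | (columnOf X e).element = x}) =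
        {e | (columnOf X e).element ∈ S} := by
      ext e
      simp
    rw [hu]
    refine (ncard_edgeBoundary_elements_le X S).trans ((Nat.mul_le_mul_right _ hS).trans ?_)
    calc (8 * branchwidth G + 8) * (2 * k + 1) ≤ (16 * m) * (3 * k) :=
          Nat.mul_le_mul (by omega) (by omega)
      _ = 48 * k * m := by ring

end EnhancementWidth

/-! ### An annulus with fewer than three vertices removed -/

section Cylinder

/-- Fewer than three points cannot meet `k ≥ 3` disjoint sets. -/
lemma exists_forall_notMem {W : Type*} {k : ℕ} (hk : 3 ≤ k) {S : Set W} (hS : S.Finite)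
    (hS3 : S.ncard < 3) {B : Fin k → W → Prop} (hB : ∀ t t' x, B t x → B t' x → t = t') :
    ∃ t, ∀ x, B t x → x ∉ S := by
  by_contra! h
  choose f hf hfS using h
  have h1 : Function.Injective f := fun t t' h => hB _ _ _ (hf t) (h ▸ hf t')
  have h2 := Set.ncard_le_ncard (Set.range_subset_iff.2 hfS) hS
  rw [← Set.image_univ, Set.ncard_image_of_injective _ h1, Set.ncard_univ, Nat.card_fin] at h2
  omega

lemma exists_colNext_eq {α : Type*} (π : Equiv.Perm α) {k : ℕ} (p : α × Fin k) :
    ∃ q, colNext π q = p := by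
  obtain ⟨a, t⟩ := p
  rcases Nat.eq_zero_or_pos t.val with h | h
  · refine ⟨(π.symm a, ⟨k - 1, Nat.sub_one_lt t.pos.ne'⟩), ?_⟩
    have h1 : ¬ k - 1 + 1 < k := by omega
    simp [colNext, h1, ← h]
  · have := t.2
    refine ⟨(a, ⟨t - 1, by omega⟩), ?_⟩
    have h1 : t.val - 1 + 1 < k := by omega
    simp only [colNext, h1, dite_true, Prod.mk.injEq, true_and, Fin.ext_iff]
    omega

lemma colNext_snd {α : Type*} (π : α → α) {k : ℕ} (p : α × Fin k) :
    (colNext π p).2.val = if p.2.val + 1 < k then p.2.val + 1 else 0 := by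
  unfold colNext
  split_ifs <;> rfl

variable {W α : Type*} {k : ℕ} {S : Set W} {r : W → Prop} {f : α × Fin k → Fin k → W}
  {π : Equiv.Perm α} {h₀ : Fin k}

/-- In a layer that is disjoint from `S`, the property `r` depends only on the cycle. -/
lemma layer_iff (hh₀ : ∀ p, f p h₀ ∉ S)
    (hcycle : ∀ p h, f p h ∉ S → f (colNext π p) h ∉ S → (r (f p h) ↔ r (f (colNext π p) h)))
    (a : α) (t : Fin k) : r (f (a, t) h₀) ↔ r (f (a, ⟨0, t.pos⟩) h₀) := by
  obtain ⟨t, ht⟩ := t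
  induction t with
  | zero => rfl
  | succ t ih =>
    rw [← ih (by omega)]
    have := hcycle (a, ⟨t, by omega⟩) h₀ (hh₀ _) (hh₀ _)
    simp only [colNext, ht, dite_true] at this
    exact this.symm

lemma layer_iff_next (hh₀ : ∀ p, f p h₀ ∉ S)
    (hcycle : ∀ p h, f p h ∉ S → f (colNext π p) h ∉ S → (r (f p h) ↔ r (f (colNext π p) h)))
    (a : α) : r (f (π a, ⟨0, h₀.pos⟩) h₀) ↔ r (f (a, ⟨0, h₀.pos⟩) h₀) := by
  have hlt : k - 1 < k := Nat.sub_one_lt h₀.pos.ne'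
  rw [← layer_iff hh₀ hcycle a ⟨k - 1, hlt⟩]
  have := hcycle (a, ⟨k - 1, hlt⟩) h₀ (hh₀ _) (hh₀ _)
  have h1 : ¬ k - 1 + 1 < k := by omega
  simp only [colNext, h1, dite_false] at this
  exact this.symm

/-- All of an annulus that remains after the removal of fewer than three vertices hangs together
with an intact layer: if the column of a vertex is damaged, one of the neighbouring columns is
intact. -/
lemma cylinder_iff (hk : 3 ≤ k) (hS : S.Finite) (hS3 : S.ncard < 3)
    (hf : ∀ p h p' h', f p h = f p' h' → p = p') (hh₀ : ∀ p, f p h₀ ∉ S)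
    (hcycle : ∀ p h, f p h ∉ S → f (colNext π p) h ∉ S → (r (f p h) ↔ r (f (colNext π p) h)))
    (hpath : ∀ p h h', h.val + 1 = h'.val → f p h ∉ S → f p h' ∉ S → (r (f p h) ↔ r (f p h')))
    {p : α × Fin k} {h : Fin k} (hp : f p h ∉ S) :
    r (f p h) ↔ r (f (p.1, ⟨0, h₀.pos⟩) h₀) := by
  have hfree : ∀ p : α × Fin k, (∀ h, f p h ∉ S) → ∀ h, r (f p h) ↔ r (f p h₀) := by
    intro p hp
    have h0 : ∀ h, r (f p h) ↔ r (f p ⟨0, h₀.pos⟩) := by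
      rintro ⟨h, hh⟩
      induction h with
      | zero => rfl
      | succ h ih =>
        rw [← ih (by omega)]
        exact (hpath p ⟨h, by omega⟩ ⟨h + 1, hh⟩ rfl (hp _) (hp _)).symm
    exact fun h => (h0 h).trans (h0 h₀).symm
  refine Iff.trans ?_ (layer_iff hh₀ hcycle p.1 p.2)
  change _ ↔ r (f p h₀)
  by_cases h1 : ∀ h, f p h ∉ S
  · exact hfree p h1 h
  by_cases h2 : ∀ h, f (colNext π p) h ∉ S
  · rw [hcycle p h hp (h2 h), hfree _ h2, hcycle p h₀ (hh₀ _) (hh₀ _)]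
  obtain ⟨q, rfl⟩ := exists_colNext_eq π p
  by_cases h3 : ∀ h, f q h ∉ S
  · rw [← hcycle q h (h3 h) hp, hfree _ h3, hcycle q h₀ (hh₀ _) (hh₀ _)]
  exfalso
  push Not at h1 h2 h3
  obtain ⟨i, h1⟩ := h1
  obtain ⟨j, h2⟩ := h2
  obtain ⟨l, h3⟩ := h3
  have e1 := colNext_snd π q
  have e2 := colNext_snd π (colNext π q)
  have hq := q.2.2
  have n1 : f (colNext π q) i ≠ f q l := fun h => by
    rw [hf _ _ _ _ h] at e1
    split_ifs at e1 <;> omega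
  have n2 : f (colNext π (colNext π q)) j ≠ f (colNext π q) i := fun h => by
    rw [hf _ _ _ _ h] at e2
    split_ifs at e1 e2 <;> omega
  have n3 : f (colNext π (colNext π q)) j ≠ f q l := fun h => by
    rw [hf _ _ _ _ h] at e2
    split_ifs at e1 e2 <;> omega
  have h4 : ({f (colNext π (colNext π q)) j, f (colNext π q) i, f q l} : Set W) ⊆ S := by
    rintro x (rfl | rfl | rfl) <;> assumption
  have h5 := Set.ncard_le_ncard h4 hS
  rw [Set.ncard_eq_three.2 ⟨_, _, _, n2, n3, n1, rfl⟩] at h5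
  omega

end Cylinder

/-! ### Enhancements are 3-connected -/

section ThreeConnectivity

variable {V : Type*} {G : SimpleGraph V} {P : PlaneEmbedding G} {k : ℕ}
  (X : EnhancementChoice P k)

/-- The cyclic order of the walks around a face preserves the non-trivial faces. -/
lemma order_nontrivial (b : P.Boundary) : (∃ b', b' ≠ X.order b ∧ P.face b' = P.face (X.order b)) ↔
    ∃ b', b' ≠ b ∧ P.face b' = P.face b := by
  rw [X.order_face]
  by_cases h : X.order b = b
  · rw [h]
  · exact ⟨fun _ => ⟨X.order b, h, X.order_face b⟩, fun _ => ⟨b, Ne.symm h, rfl⟩⟩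

/-- The cyclic order of the boundary walks of the non-trivial faces. -/
def hubOrder : Equiv.Perm P.NontrivialBoundary := X.order.subtypePerm (order_nontrivial X)

lemma colNext_hubOrder (q : P.NontrivialBoundary × Fin k) :
    colNext X.order (q.1.1, q.2) = ((colNext (hubOrder X) q).1.1, (colNext (hubOrder X) q).2) := by
  unfold colNext
  split_ifs <;> rfl

variable {X} {S : Set (EnhVertex P k)} {r : EnhVertex P k → Prop} {h₀ : Fin k}

section

variable (hk : 3 ≤ k) (hS : S.Finite) (hS3 : S.ncard < 3)
  (hr : ∀ x y, EnhRel X x y → x ∉ S → y ∉ S → (r x ↔ r y))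

include hk hS hS3 hr

lemma ring_iff (hh₀ : ∀ p, .ring p h₀ ∉ S) {p : Corner G × Fin k} {h : Fin k}
    (hp : .ring p h ∉ S) : r (.ring p h) ↔ r (.ring (p.1, ⟨0, h₀.pos⟩) h₀) :=
  cylinder_iff (f := EnhVertex.ring) (π := P.nextCorner) hk hS hS3
    (fun _ _ _ _ e => (EnhVertex.ring.inj e).1) hh₀ (fun p h => hr _ _ (.ringCycle p h))
    (fun p h h' e => hr _ _ (.ringPath p h h' e)) hp

lemma hub_iff (hh₀ : ∀ b t, .hub b t h₀ ∉ S) {b : P.NontrivialBoundary} {t h : Fin k}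
    (hp : .hub b t h ∉ S) : r (.hub b t h) ↔ r (.hub b ⟨0, h₀.pos⟩ h₀) :=
  cylinder_iff (f := fun q h => EnhVertex.hub q.1 q.2 h) (π := hubOrder X) (p := (b, t))
    hk hS hS3 (fun _ _ _ _ e => Prod.ext (EnhVertex.hub.inj e).1 (EnhVertex.hub.inj e).2.1)
    (fun p => hh₀ p.1 p.2)
    (fun p h => hr _ _ (.hubCycle _ _ _ _ h (colNext_hubOrder X p)))
    (fun p h h' e => hr _ _ (.hubPath p.1 p.2 h h' e)) hp

/-- A vertex of the graph that remains is joined to the annulus at each of its corners, since one of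
the `k` spokes is left. -/
lemma old_iff (hh₀ : ∀ p, .ring p h₀ ∉ S) {c : Corner G} (hc : .old c.vertex ∉ S) :
    r (.old c.vertex) ↔ r (.ring (c, ⟨0, h₀.pos⟩) h₀) := by
  obtain ⟨t, ht⟩ := exists_forall_notMem hk hS hS3
    (B := fun t x => x = EnhVertex.ring (c, t) ⟨0, h₀.pos⟩) (by rintro t t' _ rfl h; simpa using h)
  have ht := ht _ rfl
  exact (hr _ _ (.spoke (c, t) _ rfl) hc ht).trans (ring_iff hk hS hS3 hr hh₀ ht)

omit hk hS hS3 in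
lemma ring_iff_nextCorner (hh₀ : ∀ p, .ring p h₀ ∉ S) (c : Corner G) :
    r (.ring (P.nextCorner c, ⟨0, h₀.pos⟩) h₀) ↔ r (.ring (c, ⟨0, h₀.pos⟩) h₀) :=
  layer_iff_next (f := EnhVertex.ring) (π := P.nextCorner) hh₀
    (fun p h => hr _ _ (.ringCycle p h)) c

/-- The annuli around the boundary walks through a vertex remain connected with one another.  If
the vertex itself is removed, neighbouring ones are connected around the other end of the edge
between them.  At most one of these ends is removed as well, and as the corners at the vertex form
a cycle, one step may be missing. -/
lemma ring_iff_turn [Finite V] (hh₀ : ∀ p, .ring p h₀ ∉ S) (c : Corner G) :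
    r (.ring (P.turn c, ⟨0, h₀.pos⟩) h₀) ↔ r (.ring (c, ⟨0, h₀.pos⟩) h₀) := by
  by_cases hv : .old c.vertex ∈ S
  swap
  · rw [← old_iff hk hS hS3 hr hh₀ hv,
      ← old_iff hk hS hS3 hr hh₀ (c := P.turn c) (by rwa [P.vertex_turn]), P.vertex_turn]
  rcases c with d | v
  swap
  · rfl
  have heven := even_ncard_perm P.rot (fun d => r (.ring (.inl d, ⟨0, h₀.pos⟩) h₀))
    (fun d' => d'.fst = d.fst) (fun d' => by rw [P.rot_fst])
  have hsub : {d' | ¬(r (.ring (.inl d', ⟨0, h₀.pos⟩) h₀) ↔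
      r (.ring (.inl (P.rot d'), ⟨0, h₀.pos⟩) h₀)) ∧ d'.fst = d.fst} ⊆
      {d' | d'.fst = d.fst ∧ EnhVertex.old d'.snd ∈ S} := by
    rintro d' ⟨h, hd'⟩
    refine ⟨hd', by_contra fun h' => h ?_⟩
    have e1 := ring_iff_nextCorner hr hh₀ (.inl d')
    have e2 := ring_iff_nextCorner hr hh₀ (.inl d'.symm)
    rw [P.nextCorner_inl] at e1 e2
    rw [SimpleGraph.Dart.symm_symm] at e2
    have hv1 : Corner.vertex (.inl (P.rot d'.symm)) = d'.snd := P.rot_fst _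
    have e3 := old_iff hk hS hS3 hr hh₀ (c := .inl (P.rot d'.symm)) (by rwa [hv1])
    have e4 := old_iff hk hS hS3 hr hh₀ (c := .inl d'.symm) h'
    rw [hv1] at e3
    exact e1.symm.trans (e3.symm.trans (e4.trans e2.symm))
  have hone : {d' : G.Dart | d'.fst = d.fst ∧ EnhVertex.old (P := P) (k := k) d'.snd ∈ S}.ncard ≤ 1 := by
    rw [Set.ncard_le_one]
    rintro d₁ ⟨h1, h1'⟩ d₂ ⟨h2, h2'⟩
    by_contra hne
    have hsnd : d₁.snd ≠ d₂.snd := fun h =>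
      hne (SimpleGraph.Dart.ext _ _ (Prod.ext (h1.trans h2.symm) h))
    have h4 : ({.old d.fst, .old d₁.snd, .old d₂.snd} : Set (EnhVertex P k)) ⊆ S := by
      rintro x (rfl | rfl | rfl) <;> assumption
    have h5 := Set.ncard_le_ncard h4 hS
    rw [Set.ncard_eq_three.2 ⟨_, _, _, by simp [← h1, d₁.adj.ne],
      by simp [← h2, d₂.adj.ne], by simpa using hsnd, rfl⟩] at h5
    omega
  have h0 := (Set.ncard_le_ncard hsub).trans hone
  rw [even_iff_two_dvd] at heven
  have h1 := (Set.ncard_eq_zero (Set.toFinite _)).1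
    (Nat.eq_zero_of_dvd_of_lt heven (by omega))
  by_contra hcon
  exact Set.eq_empty_iff_forall_notMem.1 h1 d ⟨fun h => hcon h.symm, rfl⟩

/-- The annulus around a boundary walk remains connected with the annulus in the middle of the
face, since one of the `k` disjoint edges between them is left. -/
lemma ring_iff_hub (hh₀ : ∀ p, .ring p h₀ ∉ S) (hh₀' : ∀ b t, .hub b t h₀ ∉ S)
    (b : P.NontrivialBoundary) :
    r (.ring ((X.start b.1).1, ⟨0, h₀.pos⟩) h₀) ↔ r (.hub b ⟨0, h₀.pos⟩ h₀) := by
  let s := X.start b.1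
  have hs := fun t : Fin k => colNext_iterate P.nextCorner s.1 s.2 t.2.le
  obtain ⟨t, ht⟩ := exists_forall_notMem hk hS hS3 (B := fun t x =>
      x = EnhVertex.ring ((colNext P.nextCorner)^[t.val] s) ⟨k - 1, by omega⟩ ∨
      x = .hub b t ⟨k - 1, by omega⟩) (by
    rintro t t' x (rfl | rfl) (h | h)
    · have h := (EnhVertex.ring.inj h).1
      have h : ((colNext P.nextCorner)^[t.val] s).2.val =
        ((colNext P.nextCorner)^[t'.val] s).2.val := by rw [h]
      have ht := t.2
      have ht' := t'.2
      ext
      rcases hs t with ⟨h1, h2⟩ | ⟨h0, h1, h2⟩ <;> rcases hs t' with ⟨h1', h2'⟩ | ⟨h0', h1', h2'⟩ <;>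
      · change (colNext P.nextCorner)^[t.val] s = _ at h2
        change (colNext P.nextCorner)^[t'.val] s = _ at h2'
        rw [h2, h2'] at h
        simp only at h
        omega
    · cases h
    · cases h
    · exact (EnhVertex.hub.inj h).2.1)
  have h1 := ht _ (.inl rfl)
  have h2 := ht _ (.inr rfl)
  have h3 := hr _ _ (.link b t ⟨k - 1, by omega⟩ (by simp only; omega)) h1 h2
  refine Iff.trans ?_ (h3.trans (hub_iff hk hS hS3 hr hh₀' h2))
  refine Iff.trans ?_ (ring_iff hk hS hS3 hr hh₀ h1).symm
  rcases hs t with ⟨_, h4⟩ | ⟨_, _, h4⟩ <;> change (colNext P.nextCorner)^[t.val] s = _ at h4 <;>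
    rw [h4]
  exact (ring_iff_nextCorner hr hh₀ _).symm

/-- A property that is passed on along the edges between vertices outside of `S` holds for all of
these vertices or for none. -/
lemma iff_of_notMem [Finite V] {x y : EnhVertex P k} (hx : x ∉ S) (hy : y ∉ S) : r x ↔ r y := by
  obtain ⟨h₀, hh⟩ := exists_forall_notMem hk hS hS3
    (B := fun h x => (∃ p, x = EnhVertex.ring p h) ∨ ∃ b t, x = .hub b t h) (by
      rintro t t' _ (⟨p, rfl⟩ | ⟨b, s, rfl⟩) (⟨p', h⟩ | ⟨b', s', h⟩)
      · exact (EnhVertex.ring.inj h).2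
      · cases h
      · cases h
      · exact (EnhVertex.hub.inj h).2.2)
  have hh₀ : ∀ p, .ring p h₀ ∉ S := fun p => hh _ (.inl ⟨p, rfl⟩)
  have hh₀' : ∀ b t, .hub b t h₀ ∉ S := fun b t => hh _ (.inr ⟨b, t, rfl⟩)
  let ρ (c : Corner G) : Prop := r (.ring (c, ⟨0, h₀.pos⟩) h₀)
  have hvertex : ∀ c c' : Corner G, c.vertex = c'.vertex → (ρ c ↔ ρ c') := fun c c' h =>
    P.iff_of_vertex_eq (r := ρ) (ring_iff_turn hk hS hS3 hr hh₀) h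
  have hcomp : ∀ c c' : Corner G,
      G.connectedComponentMk c.vertex = G.connectedComponentMk c'.vertex → (ρ c ↔ ρ c') :=
    fun c c' h => RotationSystem.iff_of_component_eq (r := ρ) hvertex (fun d =>
      (ring_iff_nextCorner hr hh₀ (.inl d)).symm.trans
        (hvertex (P.nextCorner (.inl d)) (.inl d.symm) (P.rot_fst _))) h
  -- the walks of a component agree, and those of a face agree through the annulus in its middle
  have hb : ∀ b b' : P.Boundary, ρ (X.start b).1 ↔ ρ (X.start b').1 := by
    refine P.iff_of_boundary (fun b b' h => ?_) fun b b' h => ?_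
    · apply hcomp
      rw [← P.component_boundary, ← P.component_boundary, X.start_boundary, X.start_boundary, h]
    · have hcyc := X.order_sameCycle b b' h
      by_cases hbb : b = b'
      · rw [hbb]
      have hn : ∃ a, a ≠ b ∧ P.face a = P.face b := ⟨b', Ne.symm hbb, h.symm⟩
      have hn' : ∃ a, a ≠ b' ∧ P.face a = P.face b' := ⟨b, hbb, h⟩
      have e := iff_of_sameCycle (σ := X.order)
        (r := fun b => ∃ hb : ∃ a, a ≠ b ∧ P.face a = P.face b,
          r (.hub ⟨b, hb⟩ ⟨0, h₀.pos⟩ h₀)) (fun b => by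
          by_cases hb : ∃ a, a ≠ b ∧ P.face a = P.face b
          · have hb' := (order_nontrivial X b).2 hb
            have := layer_iff_next (f := fun q h => EnhVertex.hub q.1 q.2 h) (π := hubOrder X)
              (fun p => hh₀' p.1 p.2)
              (fun p h => hr _ _ (.hubCycle _ _ _ _ h (colNext_hubOrder X p))) ⟨b, hb⟩
            exact ⟨fun ⟨_, h⟩ => ⟨hb, this.1 h⟩, fun ⟨_, h⟩ => ⟨hb', this.2 h⟩⟩
          · exact ⟨fun ⟨h, _⟩ => absurd ((order_nontrivial X b).1 h) hb,
              fun ⟨h, _⟩ => absurd h hb⟩) hcyc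
      simp only [hn, hn', exists_true_left] at e
      exact (ring_iff_hub hk hS hS3 hr hh₀ hh₀' ⟨b, hn⟩).trans
        (e.trans (ring_iff_hub hk hS hS3 hr hh₀ hh₀' ⟨b', hn'⟩).symm)
  have hρ : ∀ c, ρ c ↔ ρ (X.start (P.boundary c)).1 := by
    intro c
    apply hcomp
    rw [← P.component_boundary, ← P.component_boundary, X.start_boundary]
  have hall : ∀ x, x ∉ S → ∃ b, r x ↔ ρ (X.start b).1 := by
    rintro (v | ⟨p, h⟩ | ⟨b, t, h⟩) hx
    · obtain ⟨c, rfl⟩ := exists_corner (G := G) v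
      exact ⟨_, (old_iff hk hS hS3 hr hh₀ hx).trans (hρ c)⟩
    · exact ⟨_, (ring_iff hk hS hS3 hr hh₀ hx).trans (hρ p.1)⟩
    · exact ⟨_, (hub_iff hk hS hS3 hr hh₀' hx).trans
        (ring_iff_hub hk hS hS3 hr hh₀ hh₀' b).symm⟩
  obtain ⟨b, hxb⟩ := hall x hx
  obtain ⟨b', hyb⟩ := hall y hy
  exact hxb.trans ((hb b b').trans hyb.symm)

end

variable (X) in
theorem threeConnected_enhancement [Finite V] [Nonempty V] (hk : 3 ≤ k) :
    ThreeConnected (enhancement X) := by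
  obtain ⟨v⟩ := ‹Nonempty V›
  obtain ⟨c, -⟩ := exists_corner (G := G) v
  have hcard : 3 < Nat.card (EnhVertex P k) := by
    have h := Nat.card_le_card_of_injective
      (fun q : Fin k × Fin k => EnhVertex.ring (P := P) (c, q.1) q.2) (by
        rintro ⟨a, b⟩ ⟨a', b'⟩ h
        simpa using h)
    rw [Nat.card_prod, Nat.card_fin] at h
    have := Nat.mul_le_mul hk hk
    omega
  refine ⟨hcard, fun S hS hS3 => ?_⟩
  have hne : (Sᶜ : Set (EnhVertex P k)).Nonempty := by
    rw [Set.nonempty_compl]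
    rintro rfl
    rw [Set.ncard_univ] at hS3
    omega
  have : Nonempty ↑(Sᶜ : Set (EnhVertex P k)) := hne.to_subtype
  refine ⟨fun x y => ?_⟩
  let r (z : EnhVertex P k) : Prop :=
    ∃ hz : z ∈ Sᶜ, ((enhancement X).induce Sᶜ).Reachable x ⟨z, hz⟩
  have hr : ∀ z w, EnhRel X z w → z ∉ S → w ∉ S → (r z ↔ r w) := by
    intro z w hzw hz hw
    by_cases hne : z = w
    · rw [hne]
    · have hadj : ((enhancement X).induce Sᶜ).Adj ⟨z, hz⟩ ⟨w, hw⟩ := ⟨hne, .inl hzw⟩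
      exact ⟨fun ⟨_, h⟩ => ⟨hw, h.trans hadj.reachable⟩,
        fun ⟨_, h⟩ => ⟨hz, h.trans hadj.symm.reachable⟩⟩
  exact ((iff_of_notMem hk hS hS3 hr x.2 y.2).1 ⟨x.2, .rfl⟩).2

end ThreeConnectivity

end Cyl

theorem mainTheorem6 :
    ∃ c₂ : ℕ, ∀ (V : Type*) [Fintype V] [Nonempty V] (G : SimpleGraph V)
      (P : Cyl.PlaneEmbedding G) (k : ℕ), 3 ≤ k → ∀ X : Cyl.EnhancementChoice P k,
        Cyl.ThreeConnected (Cyl.enhancement X) ∧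
        Cyl.branchwidth (Cyl.enhancement X) ≤ c₂ * k * max 1 (Cyl.branchwidth G) := by
  refine ⟨48, fun V _ _ G P k hk X => ⟨?_, ?_⟩⟩
  · exact Cyl.threeConnected_enhancement X hk
  · exact Cyl.branchwidth_enhancement_le X hk
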